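/- Let $M$ be a compact (Hausdorff) complex manifold of complex dimension $n$ and let $g$ be a smooth Hermitian metric on $M$, i.e. a Riemannian metric with $g(JX,JY)=g(X,Y)$, with fundamental form $\omega(X,Y)=g(JX,Y)$. Let $R$ be the curvature tensor of the Chern connection, in local holomorphic coordinates $R_{i\bar jk\bar l}=-h_{p\bar l}\,\partial_{\bar j}\Gamma^p_{ik}$ with $\Gamma^p_{ik}=h^{p\bar q}\partial_i h_{k\bar q}$ and $\omega=\sqrt{-1}\,h_{i\bar j}\,dz^i\wedge d\bar z^j$, and for $0\neq X\in T^{1,0}_pM$ let $H(X)=R(X,\bar X,X,\bar X)/|X|^4$, where $|X|^2=h_{i\bar j}X^i\overline{X^j}$, be the holomorphic sectional curvature. Assume that $H$ is pointwise constant and nonpositive: there is a function $c:M\to\mathbb R$ with $c\le 0$ such that $H(X)=c(p)$ for all $p\in M$ and all nonzero $X\in T^{1,0}_pM$. Call $\omega$ locally conformal Kähler (LCK) if there is a smooth closed real $1$-form $\theta$ (a Lee form) with $d\omega=\theta\wedge\omega$; Vaisman if, in addition, $\theta$ can be chosen parallel for the Levi-Civita connection of $g$; Gauduchon if $\partial\bar\partial\omega^{n-1}=0$;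 and Kähler if $d\omega=0$. Then: 1. if $\omega$ is Vaisman, then $\omega$ is Kähler; 2. if $\omega$ is locally conformal Kähler and Gauduchon, then $\omega$ is Kähler. -/

import Mathlib

open scoped Manifold ContDiff

noncomputable section

namespace HermGeom

/-- The model space `ℂⁿ` of an `n`-dimensional complex manifold. -/
abbrev Model (n : ℕ) : Type := EuclideanSpace ℂ (Fin n)

/-! ### The smooth manifold underlying a complex manifold -/

/-- Biholomorphic changes of coordinates are smooth in the real sense. -/
theorem contDiffGroupoid_complex_le_real (n : ℕ) :
    contDiffGroupoid ω 𝓘(ℂ, Model n) ≤ contDiffGroupoid ∞ 𝓘(ℝ, Model n) := by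
  rw [contDiffGroupoid, contDiffGroupoid]
  apply groupoid_of_pregroupoid_le
  intro f s hfs
  have h : ContDiffOn ℂ ω (𝓘(ℂ, Model n) ∘ f ∘ 𝓘(ℂ, Model n).symm)
      (𝓘(ℂ, Model n).symm ⁻¹' s ∩ Set.range 𝓘(ℂ, Model n)) := hfs
  have h' : ContDiffOn ℝ ∞ (𝓘(ℂ, Model n) ∘ f ∘ 𝓘(ℂ, Model n).symm)
      (𝓘(ℂ, Model n).symm ⁻¹' s ∩ Set.range 𝓘(ℂ, Model n)) :=
    (h.restrict_scalars ℝ).of_le le_top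
  exact h'

/-- A complex manifold is a smooth real manifold with the same charts. -/
instance instIsManifoldReal {n : ℕ} {M : Type*} [TopologicalSpace M]
    [ChartedSpace (Model n) M] [IsManifold 𝓘(ℂ, Model n) ω M] :
    IsManifold 𝓘(ℝ, Model n) ∞ M :=
  { toHasGroupoid := hasGroupoid_of_le
      (IsManifold.toHasGroupoid (I := 𝓘(ℂ, Model n)) (n := ω) (M := M))
      (contDiffGroupoid_complex_le_real n) }

/-! ### Calculus of differential forms on `ℂⁿ` -/

section ModelForms

variable {n : ℕ}

/-- Multiplication by the imaginary unit, as a real linear map of `ℂⁿ`. -/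
def mulI (n : ℕ) : Model n →L[ℝ] Model n :=
  Complex.I • ContinuousLinearMap.id ℝ (Model n)

/-- The multilinear map `(v₁, …, v_{k+l}) ↦ α(v₁, …, v_k) β(v_{k+1}, …, v_{k+l})`. -/
def tensorForm {A : Type*} [NormedCommRing A] [NormedAlgebra ℝ A] {k l : ℕ}
    (α : Model n [⋀^Fin k]→L[ℝ] A) (β : Model n [⋀^Fin l]→L[ℝ] A) :
    ContinuousMultilinearMap ℝ (fun _ : Fin (k + l) => Model n) A where
  toMultilinearMap := (LinearMap.mul' ℝ A).compMultilinearMap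
    ((MultilinearMap.domCoprod α.toMultilinearMap β.toMultilinearMap).domDomCongr finSumFinEquiv)
  cont := by
    have h : Continuous fun v : Fin (k + l) → Model n =>
        α (fun i => v (Fin.castAdd l i)) * β (fun j => v (Fin.natAdd k j)) :=
      (α.cont.comp (by fun_prop)).mul (β.cont.comp (by fun_prop))
    exact h

/-- The wedge product of alternating forms,
`(α ∧ β)(v) = 1/(k! l!) ∑_σ sgn(σ) α(v_{σ(1)}, …, v_{σ(k)}) β(v_{σ(k+1)}, …, v_{σ(k+l)})`. -/
def wedge {A : Type*} [NormedCommRing A] [NormedAlgebra ℝ A] {k l : ℕ}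
    (α : Model n [⋀^Fin k]→L[ℝ] A) (β : Model n [⋀^Fin l]→L[ℝ] A) :
    Model n [⋀^Fin (k + l)]→L[ℝ] A :=
  ((k.factorial * l.factorial : ℝ)⁻¹) • ContinuousMultilinearMap.alternatization (tensorForm α β)

theorem wedge_apply {A : Type*} [NormedCommRing A] [NormedAlgebra ℝ A] {k l : ℕ}
    (α : Model n [⋀^Fin k]→L[ℝ] A) (β : Model n [⋀^Fin l]→L[ℝ] A) (v : Fin (k + l) → Model n) :
    wedge α β v = ((k.factorial * l.factorial : ℝ)⁻¹) • ∑ σ : Equiv.Perm (Fin (k + l)),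
      Equiv.Perm.sign σ • (α (fun i => v (σ (Fin.castAdd l i))) *
        β (fun j => v (σ (Fin.natAdd k j)))) := by
  rw [wedge, ContinuousAlternatingMap.smul_apply,
    ContinuousMultilinearMap.alternatization_apply_apply]
  rfl

/-- The power `α ∧ ⋯ ∧ α` (`k` factors) of a `2`-form; the empty power is the constant `1`. -/
def wedgePow (α : Model n [⋀^Fin 2]→L[ℝ] ℂ) : (k : ℕ) → Model n [⋀^Fin (2 * k)]→L[ℝ] ℂ
  | 0 => ContinuousAlternatingMap.constOfIsEmpty ℝ (Model n) (Fin 0) 1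
  | k + 1 => wedge (wedgePow α k) α

/-- The operator `∂ = ∑ᵢ dzⁱ ∧ ∂/∂zⁱ` on complex-valued forms: the exterior derivative in which the
derivative of the coefficients is replaced by its complex linear part. -/
def del {k : ℕ} (α : Model n → Model n [⋀^Fin k]→L[ℝ] ℂ) (z : Model n) :
    Model n [⋀^Fin (k + 1)]→L[ℝ] ℂ :=
  .alternatizeUncurryFin
    ((1 / 2 : ℂ) • (fderiv ℝ α z - Complex.I • (fderiv ℝ α z).comp (mulI n)))

/-- The operator `∂̄ = ∑ᵢ dz̄ⁱ ∧ ∂/∂z̄ⁱ` on complex-valued forms: the exterior derivative in which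
the derivative of the coefficients is replaced by its complex antilinear part. -/
def delbar {k : ℕ} (α : Model n → Model n [⋀^Fin k]→L[ℝ] ℂ) (z : Model n) :
    Model n [⋀^Fin (k + 1)]→L[ℝ] ℂ :=
  .alternatizeUncurryFin
    ((1 / 2 : ℂ) • (fderiv ℝ α z + Complex.I • (fderiv ℝ α z).comp (mulI n)))

/-- The `i`-th vector of the standard basis of `ℂⁿ`, i.e. `∂/∂xⁱ` where `zⁱ = xⁱ + √-1 yⁱ`. -/
def basisVec (i : Fin n) : Model n := EuclideanSpace.single i (1 : ℂ)

/-- The Wirtinger derivative `∂f/∂zⁱ = (∂f/∂xⁱ - √-1 ∂f/∂yⁱ) / 2`. -/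
def dz (i : Fin n) (f : Model n → ℂ) (z : Model n) : ℂ :=
  (1 / 2) * (fderiv ℝ f z (basisVec i) - Complex.I * fderiv ℝ f z (mulI n (basisVec i)))

/-- The Wirtinger derivative `∂f/∂z̄ⁱ = (∂f/∂xⁱ + √-1 ∂f/∂yⁱ) / 2`. -/
def dzbar (i : Fin n) (f : Model n → ℂ) (z : Model n) : ℂ :=
  (1 / 2) * (fderiv ℝ f z (basisVec i) + Complex.I * fderiv ℝ f z (mulI n (basisVec i)))

end ModelForms

/-! ### Hermitian metrics and differential forms on complex manifolds -/

section Manifold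

variable {n : ℕ} {M : Type*} [TopologicalSpace M] [ChartedSpace (Model n) M]

/-- The complex structure `J` on the tangent space at `x`. Mathlib identifies this space with `ℂⁿ`
through the preferred holomorphic chart at `x`, and `J` is multiplication by `√-1` there (in every
other holomorphic chart too, as coordinate changes have complex linear derivatives). -/
def complexStructure (x : M) :
    TangentSpace 𝓘(ℝ, Model n) x →L[ℝ] TangentSpace 𝓘(ℝ, Model n) x :=
  mulI n

/-- A field of alternating `k`-forms (with values in `F`) on the real tangent spaces. -/
abbrev FormField (n : ℕ) (M : Type*) [TopologicalSpace M] [ChartedSpace (Model n) M]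
    (F : Type*) [NormedAddCommGroup F] [NormedSpace ℝ F] (k : ℕ) :=
  (x : M) → TangentSpace 𝓘(ℝ, Model n) x [⋀^Fin k]→L[ℝ] F

/-- The differential at `z` of the inverse of the chart `φ`. -/
def chartInvDeriv (φ : OpenPartialHomeomorph M (Model n)) (z : Model n) :
    Model n →L[ℝ] TangentSpace 𝓘(ℝ, Model n) (φ.symm z) :=
  mfderiv 𝓘(ℝ, Model n) 𝓘(ℝ, Model n) φ.symm z

/-- The expression of a form in the chart `φ`, i.e. its pullback under the inverse of `φ`
(meaningful on the target of `φ`). -/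
def FormField.inChart {F : Type*} [NormedAddCommGroup F] [NormedSpace ℝ F] {k : ℕ}
    (α : FormField n M F k) (φ : OpenPartialHomeomorph M (Model n)) (z : Model n) :
    Model n [⋀^Fin k]→L[ℝ] F :=
  (α (φ.symm z)).compContinuousLinearMap (chartInvDeriv φ z)

/-- A smooth form: its expressions in charts are smooth. -/
def FormField.IsSmooth {F : Type*} [NormedAddCommGroup F] [NormedSpace ℝ F] {k : ℕ}
    (α : FormField n M F k) : Prop :=
  ∀ φ ∈ atlas (Model n) M, ContDiffOn ℝ ∞ (α.inChart φ) φ.target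

/-- A closed form: `dα = 0`, computed in charts. -/
def FormField.IsClosed {F : Type*} [NormedAddCommGroup F] [NormedSpace ℝ F] {k : ℕ}
    (α : FormField n M F k) : Prop :=
  ∀ φ ∈ atlas (Model n) M, ∀ z ∈ φ.target, extDeriv (α.inChart φ) z = 0

variable [IsManifold 𝓘(ℂ, Model n) ω M]

variable (n M) in
/-- A Hermitian metric: a smooth Riemannian metric `g` with `g(JX, JY) = g(X, Y)`. -/
structure HermitianMetric extends
    Bundle.ContMDiffRiemannianMetric 𝓘(ℝ, Model n) ∞ (Model n)
      (fun x : M => TangentSpace 𝓘(ℝ, Model n) x) where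
  inner_complexStructure (x : M) (v w : TangentSpace 𝓘(ℝ, Model n) x) :
    inner x (complexStructure x v) (complexStructure x w) = inner x v w

namespace HermitianMetric

variable (g : HermitianMetric n M)

theorem inner_complexStructure_self (x : M) (v : TangentSpace 𝓘(ℝ, Model n) x) :
    g.inner x (complexStructure x v) v = 0 := by
  have hJ : complexStructure x (complexStructure x v) = -v := by
    have h (a : Model n) : mulI n (mulI n a) = -a := by
      change Complex.I • Complex.I • a = -a
      rw [smul_smul, Complex.I_mul_I, neg_one_smul]
    exact h v
  have h := g.inner_complexStructure x (complexStructure x v) v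
  have h2 := g.symm x v (complexStructure x v)
  rw [hJ, map_neg, neg_apply] at h
  linarith

/-- The fundamental form `ω(X, Y) = g(JX, Y)`. -/
def fundamentalForm : FormField n M ℝ 2 := fun x =>
  { toFun := fun v => g.inner x (complexStructure x (v 0)) (v 1)
    map_update_add' := by
      intro _ v i a b
      fin_cases i <;> simp [Function.update]
    map_update_smul' := by
      intro _ v i c a
      fin_cases i <;> simp [Function.update]
    cont := by
      have h (B : Model n →L[ℝ] Model n →L[ℝ] ℝ) :
          Continuous fun v : Fin 2 → Model n => B (mulI n (v 0)) (v 1) := by fun_prop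
      exact h (g.inner x)
    map_eq_zero_of_eq' := by
      intro v i j hv hij
      have h01 : v 0 = v 1 := by
        fin_cases i <;> fin_cases j <;> simp_all
      change g.inner x (complexStructure x (v 0)) (v 1) = 0
      rw [← h01]
      exact g.inner_complexStructure_self x (v 0) }

/-- The Hermitian metric is Kähler: `dω = 0`. -/
def IsKahler : Prop := g.fundamentalForm.IsClosed

/-- `θ` is a Lee form: a smooth closed real `1`-form with `dω = θ ∧ ω`. -/
structure IsLeeForm (θ : FormField n M ℝ 1) : Prop where
  smooth : θ.IsSmooth
  closed : θ.IsClosed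
  eq_wedge : ∀ φ ∈ atlas (Model n) M, ∀ z ∈ φ.target,
    extDeriv (g.fundamentalForm.inChart φ) z =
      wedge (θ.inChart φ z) (g.fundamentalForm.inChart φ z)

/-- The Hermitian metric is locally conformal Kähler. -/
def IsLCK : Prop := ∃ θ : FormField n M ℝ 1, g.IsLeeForm θ

/-- The metric in the chart `φ`. -/
def chartInner (φ : OpenPartialHomeomorph M (Model n)) (z u v : Model n) : ℝ :=
  g.inner (φ.symm z) (chartInvDeriv φ z u) (chartInvDeriv φ z v)

/-- In the chart `φ`, the vector `Γ` is the Levi-Civita covariant derivative at `z`, in direction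
`u`, of the constant vector field `v`. By the Koszul formula this is the unique vector with
`2 g(Γ, w) = u g(v, w) + v g(u, w) - w g(u, v)` for all `w`. -/
def IsChristoffel (φ : OpenPartialHomeomorph M (Model n)) (z u v Γ : Model n) : Prop :=
  ∀ w : Model n, 2 * g.chartInner φ z Γ w =
    fderiv ℝ (fun y => g.chartInner φ y v w) z u
      + fderiv ℝ (fun y => g.chartInner φ y u w) z v
      - fderiv ℝ (fun y => g.chartInner φ y u v) z w

/-- The `1`-form `θ` is parallel for the Levi-Civita connection: in every chart
`(∇_u θ)(v) = u (θ(v)) - θ(∇_u v)` vanishes for all constant vector fields `u`, `v`. -/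
def IsParallel (θ : FormField n M ℝ 1) : Prop :=
  ∀ φ ∈ atlas (Model n) M, ∀ z ∈ φ.target, ∀ u v Γ : Model n, g.IsChristoffel φ z u v Γ →
    fderiv ℝ (fun y => θ.inChart φ y ![v]) z u - θ.inChart φ z ![Γ] = 0

/-- A Vaisman metric: locally conformal Kähler with parallel Lee form. -/
def IsVaisman : Prop := ∃ θ : FormField n M ℝ 1, g.IsLeeForm θ ∧ g.IsParallel θ

/-- The fundamental form in the chart `φ`, with complex coefficients. -/
def chartOmega (φ : OpenPartialHomeomorph M (Model n)) (z : Model n) :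
    Model n [⋀^Fin 2]→L[ℝ] ℂ :=
  Complex.ofRealCLM.compContinuousAlternatingMap (g.fundamentalForm.inChart φ z)

/-- A Gauduchon metric: `∂∂̄ ω^{n-1} = 0`. -/
def IsGauduchon : Prop :=
  ∀ φ ∈ atlas (Model n) M, ∀ z ∈ φ.target,
    del (delbar fun y => wedgePow (g.chartOmega φ y) (n - 1)) z = 0

/-- The matrix `h_{i j̄} = h(∂/∂zⁱ, ∂/∂z̄ʲ)` of the complex bilinear extension `h` of the metric,
in the chart `φ`; here `∂/∂zⁱ = (eᵢ - √-1 J eᵢ) / 2` and `∂/∂z̄ʲ = (eⱼ + √-1 J eⱼ) / 2`. -/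
def chartMatrix (φ : OpenPartialHomeomorph M (Model n)) (z : Model n) :
    Matrix (Fin n) (Fin n) ℂ := fun i j =>
  (1 / 4) * ((g.chartInner φ z (basisVec i) (basisVec j) : ℂ)
    + (g.chartInner φ z (mulI n (basisVec i)) (mulI n (basisVec j)) : ℂ)
    + Complex.I * ((g.chartInner φ z (basisVec i) (mulI n (basisVec j)) : ℂ)
      - (g.chartInner φ z (mulI n (basisVec i)) (basisVec j) : ℂ)))

/-- The Christoffel symbols `Γ_{ij}^k = h^{k l̄} ∂_i h_{j l̄}` of the Chern connection, where
`h^{k l̄}` is the transposed inverse of `h_{i j̄}`. -/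
def chernSymbol (φ : OpenPartialHomeomorph M (Model n)) (i j k : Fin n) (z : Model n) : ℂ :=
  ∑ l, (g.chartMatrix φ z)⁻¹ l k * dz i (fun y => g.chartMatrix φ y j l) z

/-- The curvature components `R_{i j̄ k l̄} = - h_{p l̄} ∂_{j̄} Γ_{ik}^p` of the Chern connection. -/
def chernCurvature (φ : OpenPartialHomeomorph M (Model n)) (z : Model n) (i j k l : Fin n) : ℂ :=
  -∑ p, g.chartMatrix φ z p l * dzbar j (g.chernSymbol φ i k p) z

/-- The Chern holomorphic sectional curvature `H(X) = R(X, X̄, X, X̄) / |X|⁴` of the vector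
`∑ᵢ Xⁱ ∂/∂zⁱ` of type `(1, 0)`, where `|X|² = h_{i j̄} Xⁱ X̄ʲ`. Its value is always real. -/
def holSectCurvature (φ : OpenPartialHomeomorph M (Model n)) (z : Model n) (X : Fin n → ℂ) : ℂ :=
  (∑ i, ∑ j, ∑ k, ∑ l,
      g.chernCurvature φ z i j k l * X i * star (X j) * X k * star (X l)) /
    (∑ i, ∑ j, g.chartMatrix φ z i j * X i * star (X j)) ^ 2

/-- The holomorphic sectional curvature is pointwise constant, with value `c p` at `p`. -/
def HasPointwiseConstantHSC (c : M → ℝ) : Prop :=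
  ∀ φ ∈ atlas (Model n) M, ∀ z ∈ φ.target, ∀ X : Fin n → ℂ, X ≠ 0 →
    g.holSectCurvature φ z X = (c (φ.symm z) : ℂ)

end HermitianMetric

end Manifold

end HermGeom

end

/-! In a chart write the Lee form as θ = df, so that e^{-f}ω is Kähler. The torsion of the Chern
connection is then governed by ∂f, and the curvature fails the Kähler symmetries R_{ij̄kl̄} =
R_{kj̄il̄} = R_{il̄kj̄} only by terms in the complex Hessian of f (`curvature_sub_curvature`).
Polarizing H = c therefore determines R completely in terms of c, h and ∂∂̄f (`four_mul_curvature`).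

Tracing this formula produces a (1,0)-form β with ∂β = 0 and ∂̄_j β_i = Φ h_{ij̄}, where Φ = tr ∂∂̄f
+ 2(n+1)c. Differentiating once more and using the torsion identity gives, for n ≥ 2, the Schur-type
equation dΦ = -Φ df (`LocalLCK.schur`). Hence Φe^f is locally constant.

Both the Vaisman and the Gauduchon condition force tr ∂∂̄f = -(n-1)/2 |θ|²
(`sum_hessian_of_parallel`, `sum_hessian_of_gauduchon`). In the first case this is the Koszul
formula combined with dω = θ ∧ ω. In the second, ω^{n-1} = e^{(n-1)f}(e^{-f}ω)^{n-1} with a closed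
second factor, so ∂∂̄ω^{n-1} = 0 says that the trace of the Hessian of e^{(n-1)f} vanishes. Either
way Φ = -(n-1)/2 |θ|² + 2(n+1)c is a globally defined function, and c ≤ 0 makes it nonpositive, with
θ = 0 wherever it vanishes.

Thus w = -1/Φ is globally defined on M and locally a constant multiple of e^f, the constant being
nonnegative. Where the constant is positive, a local maximum of w is one of f, and e^{(n-1)f} solves
a linear elliptic equation without lower order terms, so the strong maximum principle makes f
constant nearby. On the compact M this makes w locally constant (`eventually_const_of_isLocalMax`),
hence θ = 0 and dω = θ ∧ ω = 0. For n ≤ 1 a 3-form vanishes for reasons of dimension. -/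

noncomputable section

set_option maxSynthPendingDepth 3

namespace HermGeom

/-! ### Iterated alternatization and powers of a bilinear form -/

section Alternatization

open ContinuousAlternatingMap

variable {E : Type*} [NormedAddCommGroup E] [NormedSpace ℝ E] {k : ℕ}

variable (E k) in
/-- Alternatization of a form-valued bilinear map, as a continuous linear map. -/
def altTwo :
    (E →L[ℝ] E →L[ℝ] E [⋀^Fin k]→L[ℝ] ℂ) →L[ℝ] E [⋀^Fin (k + 2)]→L[ℝ] ℂ :=
  (alternatizeUncurryFinCLM ℝ E ℂ).comp
    ((alternatizeUncurryFinCLM ℝ E ℂ).postcomp E)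

theorem altTwo_apply (T : E →L[ℝ] E →L[ℝ] E [⋀^Fin k]→L[ℝ] ℂ)
    (v : Fin (k + 2) → E) :
    altTwo E k T v = ∑ i : Fin (k + 2), (-1 : ℤ) ^ (i : ℕ) • ∑ j : Fin (k + 1), (-1 : ℤ) ^ (j : ℕ) •
      T (v i) (v (i.succAbove j)) (fun s => v (i.succAbove (j.succAbove s))) := by
  change alternatizeUncurryFin ((alternatizeUncurryFinCLM ℝ E ℂ).comp T) v = _
  rw [alternatizeUncurryFin_apply]
  refine Finset.sum_congr rfl fun i _ => ?_
  rw [ContinuousLinearMap.comp_apply, alternatizeUncurryFinCLM_apply, alternatizeUncurryFin_apply]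
  rfl

/-- The sum of T and its flip is symmetric in the two outer slots, and alternatization kills such a
map; this is the algebra behind d² = 0. -/
theorem altTwo_flip (T : E →L[ℝ] E →L[ℝ] E [⋀^Fin k]→L[ℝ] ℂ) :
    altTwo E k T.flip = -altTwo E k T := by
  rw [eq_neg_iff_add_eq_zero, ← map_add]
  exact alternatizeUncurryFin_alternatizeUncurryFinCLM_comp_of_symmetric
    (f := T.flip + T) fun x y => by simp [add_comm]

theorem altTwo_congr_neg_flip {T T' : E →L[ℝ] E →L[ℝ] E [⋀^Fin k]→L[ℝ] ℂ}
    (h : ∀ u v, T' u v = T v u) : altTwo E k T' = -altTwo E k T := by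
  rw [← altTwo_flip]
  congr 1
  ext1 u
  ext1 v
  simp [h]

/-- Alternatization of a form-valued trilinear map. -/
def altThree (T : E →L[ℝ] E →L[ℝ] E →L[ℝ] E [⋀^Fin k]→L[ℝ] ℂ) :
    E [⋀^Fin (k + 3)]→L[ℝ] ℂ :=
  alternatizeUncurryFin ((altTwo E k).comp T)

theorem altThree_add (T T' : E →L[ℝ] E →L[ℝ] E →L[ℝ] E [⋀^Fin k]→L[ℝ] ℂ) :
    altThree (T + T') = altThree T + altThree T' := by
  rw [altThree, ContinuousLinearMap.comp_add, alternatizeUncurryFin_add]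
  rfl

/-- Alternatizing the innermost slot first leaves a map in the two outer slots, to which the
two-slot sign rule applies. -/
theorem altThree_eq_altTwo
    (T : E →L[ℝ] E →L[ℝ] E →L[ℝ] E [⋀^Fin k]→L[ℝ] ℂ)
    (S : E →L[ℝ] E →L[ℝ] E [⋀^Fin (k + 1)]→L[ℝ] ℂ)
    (h : ∀ u v, S u v = alternatizeUncurryFin (T u v)) :
    altThree T = altTwo E (k + 1) S := by
  change alternatizeUncurryFin ((altTwo E k).comp T) =
    alternatizeUncurryFin ((alternatizeUncurryFinCLM ℝ E ℂ).comp S)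
  congr 1
  ext1 u
  change alternatizeUncurryFin ((alternatizeUncurryFinCLM ℝ E ℂ).comp (T u)) =
    alternatizeUncurryFin (S u)
  congr 1
  ext1 v
  simp [h]

theorem altThree_swap_last
    {T T' : E →L[ℝ] E →L[ℝ] E →L[ℝ] E [⋀^Fin k]→L[ℝ] ℂ}
    (h : ∀ u v w, T' u v w = T u w v) : altThree T' = -altThree T := by
  have : (altTwo E k).comp T' = -(altTwo E k).comp T := by
    ext1 u
    exact altTwo_congr_neg_flip (fun v w => h u v w)
  rw [altThree, altThree, this, ← alternatizeUncurryFinCLM_apply, map_neg]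
  rfl

theorem altThree_swap_first
    {T T' : E →L[ℝ] E →L[ℝ] E →L[ℝ] E [⋀^Fin k]→L[ℝ] ℂ}
    (h : ∀ u v w, T' u v w = T v u w) : altThree T' = -altThree T := by
  let A : (E →L[ℝ] E →L[ℝ] E [⋀^Fin k]→L[ℝ] ℂ) →L[ℝ] E →L[ℝ] E [⋀^Fin (k + 1)]→L[ℝ] ℂ :=
    (alternatizeUncurryFinCLM ℝ E ℂ).postcomp E
  rw [altThree_eq_altTwo T (A.comp T) fun u v => rfl,
    altThree_eq_altTwo T' (A.comp T') fun u v => rfl]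
  refine altTwo_congr_neg_flip fun u v => ?_
  change alternatizeUncurryFin (T' u v) = alternatizeUncurryFin (T v u)
  congr 1
  ext1 w
  exact h u v w

/-- A rotation of three slots is a product of two transpositions, whose signs cancel. -/
theorem altThree_rotate
    {T T' : E →L[ℝ] E →L[ℝ] E →L[ℝ] E [⋀^Fin k]→L[ℝ] ℂ}
    (h : ∀ u v w, T' u v w = T v w u) : altThree T' = altThree T := by
  let T'' : E →L[ℝ] E →L[ℝ] E →L[ℝ] E [⋀^Fin k]→L[ℝ] ℂ := T'.flip
  have h1 : altThree T'' = -altThree T' := altThree_swap_first fun u v w => rfl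
  have h2 : altThree T'' = -altThree T := altThree_swap_last fun u v w => by
    change T' v u w = _
    rw [h]
  exact neg_injective (h1.symm.trans h2)

/-- Rotation does not change the alternatization, so three times it is the alternatization of the
cyclic sum. Closedness of a 2-form given as a bilinear map enters through this cyclic condition. -/
theorem altThree_eq_zero_of_cyclic
    {T : E →L[ℝ] E →L[ℝ] E →L[ℝ] E [⋀^Fin k]→L[ℝ] ℂ}
    (h : ∀ u v w, T u v w + T v w u + T w u v = 0) : altThree T = 0 := by
  let F : (E →L[ℝ] E →L[ℝ] E [⋀^Fin k]→L[ℝ] ℂ) →L[ℝ]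
      (E →L[ℝ] E →L[ℝ] E [⋀^Fin k]→L[ℝ] ℂ) :=
    (ContinuousLinearMap.flipₗᵢ ℝ E E
      (E [⋀^Fin k]→L[ℝ] ℂ)).toLinearIsometry.toContinuousLinearMap
  let T₁ : E →L[ℝ] E →L[ℝ] E →L[ℝ] E [⋀^Fin k]→L[ℝ] ℂ :=
    F.comp T.flip
  let T₂ : E →L[ℝ] E →L[ℝ] E →L[ℝ] E [⋀^Fin k]→L[ℝ] ℂ :=
    (F.comp T).flip
  have e₁ : altThree T₁ = altThree T := (altThree_rotate fun u v w => rfl).symm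
  have e₂ : altThree T₂ = altThree T := altThree_rotate fun u v w => rfl
  have hs : T + T₁ + T₂ = 0 := by
    ext1 u
    ext1 v
    ext1 w
    change T u v w + T w u v + T v w u = 0
    rw [← h u v w]
    abel
  have h3 : altThree T + altThree T + altThree T = 0 := by
    calc _ = altThree T + altThree T₁ + altThree T₂ := by rw [e₁, e₂]
      _ = altThree (T + T₁ + T₂) := by rw [altThree_add, altThree_add]
      _ = 0 := by
        rw [hs, altThree, ContinuousLinearMap.comp_zero, ← alternatizeUncurryFinCLM_apply,
          _root_.map_zero]
  have h4 : (3 : ℝ) • altThree T = 0 := by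
    rw [← h3]
    module
  exact (smul_eq_zero.mp h4).resolve_left (by norm_num)

end Alternatization

/-! ### Exterior powers of a bilinear form and their values on symplectic families. -/

section BilinearPower

open ContinuousAlternatingMap

variable {E : Type*} [NormedAddCommGroup E] [NormedSpace ℝ E] {k : ℕ}

variable (E k) in
/-- The bilinear map `(W, B) ↦ ((u, v) ↦ B(u, v) W)`. -/
def bilinSmul : (E [⋀^Fin k]→L[ℝ] ℂ) →L[ℝ] (E →L[ℝ] E →L[ℝ] ℂ) →L[ℝ]
    (E →L[ℝ] E →L[ℝ] E [⋀^Fin k]→L[ℝ] ℂ) :=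
  ((ContinuousLinearMap.compL ℝ E (E →L[ℝ] ℂ) (E →L[ℝ] E [⋀^Fin k]→L[ℝ] ℂ)).comp
    (ContinuousLinearMap.compL ℝ E ℂ (E [⋀^Fin k]→L[ℝ] ℂ))).comp
    (ContinuousLinearMap.lsmul ℝ ℂ).flip

@[simp]
theorem bilinSmul_apply (W : E [⋀^Fin k]→L[ℝ] ℂ) (B : E →L[ℝ] E →L[ℝ] ℂ) (u v : E) :
    bilinSmul E k W B u v = B u v • W := rfl

variable (E k) in
/-- The exterior product `B ∧ W`, up to a factor, of the skew part of a bilinear form `B` with an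
alternating form `W`. -/
def bilinWedge : (E [⋀^Fin k]→L[ℝ] ℂ) →L[ℝ] (E →L[ℝ] E →L[ℝ] ℂ) →L[ℝ] E [⋀^Fin (k + 2)]→L[ℝ] ℂ :=
  ((altTwo E k).postcomp (E →L[ℝ] E →L[ℝ] ℂ)).comp (bilinSmul E k)

theorem bilinWedge_def (W : E [⋀^Fin k]→L[ℝ] ℂ) (B : E →L[ℝ] E →L[ℝ] ℂ) :
    bilinWedge E k W B = altTwo E k (bilinSmul E k W B) := rfl

theorem bilinWedge_apply (W : E [⋀^Fin k]→L[ℝ] ℂ) (B : E →L[ℝ] E →L[ℝ] ℂ)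
    (v : Fin (k + 2) → E) :
    bilinWedge E k W B v = ∑ i : Fin (k + 2), (-1 : ℤ) ^ (i : ℕ) • ∑ j : Fin (k + 1),
      (-1 : ℤ) ^ (j : ℕ) • (B (v i) (v (i.succAbove j)) *
        W (fun s => v (i.succAbove (j.succAbove s)))) := by
  rw [bilinWedge_def, altTwo_apply]
  rfl

/-- The exterior powers of a bilinear form, up to a factor. -/
def bilinPow (B : E →L[ℝ] E →L[ℝ] ℂ) : (m : ℕ) → E [⋀^Fin (2 * m)]→L[ℝ] ℂ
  | 0 => ContinuousAlternatingMap.constOfIsEmpty ℝ E (Fin 0) 1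
  | m + 1 => bilinWedge E (2 * m) (bilinPow B m) B

theorem bilinPow_succ (B : E →L[ℝ] E →L[ℝ] ℂ) (m : ℕ) :
    bilinPow B (m + 1) = bilinWedge E (2 * m) (bilinPow B m) B := rfl

theorem bilinPow_succ_apply (B : E →L[ℝ] E →L[ℝ] ℂ) (m : ℕ) (v : Fin (2 * m + 2) → E) :
    bilinPow B (m + 1) v = bilinWedge E (2 * m) (bilinPow B m) B v := rfl

/-- The powers of a bilinear form depend only on its Gram matrix. -/
theorem bilinPow_congr (B : E →L[ℝ] E →L[ℝ] ℂ) (m : ℕ) (v v' : Fin (2 * m) → E)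
    (h : ∀ i j, B (v i) (v j) = B (v' i) (v' j)) : bilinPow B m v = bilinPow B m v' := by
  induction m with
  | zero => rfl
  | succ m ih =>
    rw [bilinPow_succ_apply, bilinPow_succ_apply, bilinWedge_apply, bilinWedge_apply]
    refine Finset.sum_congr rfl fun i _ => ?_
    congr 1
    refine Finset.sum_congr rfl fun j _ => ?_
    rw [h i, ih _ (fun s => v' (i.succAbove (j.succAbove s))) fun s t => h _ _]

/-- Replacing the orthogonal vector by 0 leaves the Gram matrix unchanged, and a form vanishes when
one argument is 0. -/
theorem bilinPow_eq_zero_of_orthogonal (B : E →L[ℝ] E →L[ℝ] ℂ) (m : ℕ) (v : Fin (2 * m) → E)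
    (i : Fin (2 * m)) (h : ∀ j, B (v i) (v j) = 0) (h' : ∀ j, B (v j) (v i) = 0) :
    bilinPow B m v = 0 := by
  rw [bilinPow_congr B m v (Function.update v i 0)]
  · exact (bilinPow B m).map_coord_zero i (Function.update_self i 0 v)
  · intro j l
    by_cases hj : j = i
    · subst hj
      simp [h l]
    · by_cases hl : l = i
      · subst hl
        simp [h' j]
      · simp [hj, hl]

/-- The standard symplectic matrix. -/
def stdSymplectic (i j : ℕ) : ℂ :=
  if j = i + 1 ∧ i % 2 = 0 then 1 else if i = j + 1 ∧ j % 2 = 0 then -1 else 0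

/-- The Gram matrix of `v` is a multiple of the standard symplectic matrix. -/
def IsSymplecticFamily (B : E →L[ℝ] E →L[ℝ] ℂ) (b : ℂ) {N : ℕ} (v : Fin N → E) : Prop :=
  ∀ i j, B (v i) (v j) = b * stdSymplectic i j

/-- The index paired with `i` by the standard symplectic matrix. -/
def partner {m : ℕ} (i : Fin (2 * m + 2)) : Fin (2 * m + 2) :=
  ⟨if i.val % 2 = 0 then i + 1 else i - 1, by split_ifs <;> omega⟩

/-- The position of the partner of `i` among the indices different from `i`. -/
def partnerPos {m : ℕ} (i : Fin (2 * m + 2)) : Fin (2 * m + 1) :=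
  ⟨if i.val % 2 = 0 then i else i - 1, by split_ifs <;> omega⟩

theorem succAbove_val {N : ℕ} (i : Fin (N + 1)) (j : Fin N) :
    (i.succAbove j : ℕ) = if (j : ℕ) < i then (j : ℕ) else j + 1 := by
  rw [Fin.succAbove]
  split_ifs with h h' h' <;> simp_all [Fin.lt_def]

theorem succAbove_partnerPos {m : ℕ} (i : Fin (2 * m + 2)) :
    i.succAbove (partnerPos i) = partner i := by
  ext
  rw [succAbove_val]
  simp only [partner, partnerPos]
  split_ifs <;> omega

theorem partner_val {m : ℕ} (i : Fin (2 * m + 2)) :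
    i.val % 2 = 0 ∧ (partner i : ℕ) = i + 1 ∨ i.val % 2 = 1 ∧ (i : ℕ) = partner i + 1 := by
  simp only [partner]
  split_ifs <;> omega

theorem stdSymplectic_partner {m : ℕ} (i : Fin (2 * m + 2)) (j : ℕ) (h : j ≠ i) :
    stdSymplectic (partner i) j = 0 ∧ stdSymplectic j (partner i) = 0 := by
  have hp := partner_val i
  unfold stdSymplectic
  exact ⟨by rw [if_neg (by omega), if_neg (by omega)], by rw [if_neg (by omega), if_neg (by omega)]⟩

/-- The position sign compensates the orientation of the pair, so that in the expansion all pairs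
count with the same sign. -/
theorem neg_one_pow_smul_stdSymplectic_partner {m : ℕ} (i : Fin (2 * m + 2)) :
    (-1 : ℤ) ^ (i : ℕ) • stdSymplectic i (partner i) = 1 := by
  unfold stdSymplectic
  rcases partner_val i with ⟨h, h'⟩ | ⟨h, h'⟩
  · rw [(Nat.even_iff.mpr h).neg_one_pow, if_pos ⟨h', h⟩, one_smul]
  · rw [(Nat.odd_iff.mpr h).neg_one_pow, if_neg (by omega), if_pos ⟨h', by omega⟩]
    simp

/-- Deleting a pair of partners shifts the later indices by 2, which preserves parity and partners.
-/
theorem isSymplecticFamily_remove {B : E →L[ℝ] E →L[ℝ] ℂ} {b : ℂ} {m : ℕ}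
    {v : Fin (2 * m + 2) → E} (hv : IsSymplecticFamily B b v) (i : Fin (2 * m + 2)) :
    IsSymplecticFamily B b
      fun s : Fin (2 * m) => v (i.succAbove ((partnerPos i).succAbove s)) := by
  intro s t
  rw [hv]
  congr 1
  -- Here `2 * (i / 2)` is the even member of the deleted pair.
  have key (s : Fin (2 * m)) : ((i.succAbove ((partnerPos i).succAbove s) : Fin (2 * m + 2)) : ℕ) =
      if (s : ℕ) < 2 * (i / 2) then (s : ℕ) else s + 2 := by
    rw [succAbove_val, succAbove_val]
    simp only [partnerPos]
    split_ifs <;> omega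
  rw [key, key]
  unfold stdSymplectic
  congr 1
  · rw [eq_iff_iff]
    split_ifs <;> omega
  · congr 1
    rw [eq_iff_iff]
    split_ifs <;> omega

/-- Evaluation of `A ∧ Bᵐ` on a symplectic family of `B`. -/
theorem bilinWedge_bilinPow_apply {A B : E →L[ℝ] E →L[ℝ] ℂ} {b C : ℂ} {m : ℕ}
    (hC : ∀ v : Fin (2 * m) → E, IsSymplecticFamily B b v → bilinPow B m v = C)
    {v : Fin (2 * m + 2) → E} (hv : IsSymplecticFamily B b v) :
    bilinWedge E (2 * m) (bilinPow B m) A v =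
      (∑ i : Fin (2 * m + 2), (-1 : ℤ) ^ (i : ℕ) • A (v i) (v (partner i))) * C := by
  rw [bilinWedge_apply, Finset.sum_mul]
  refine Finset.sum_congr rfl fun i _ => ?_
  rw [smul_mul_assoc]
  congr 1
  -- The partner of i always sits at an even position among the remaining vectors, so the inner sign
  -- is +1.
  have hp : Even ((partnerPos i : Fin (2 * m + 1)) : ℕ) := by
    simp only [partnerPos]
    split_ifs <;> rw [Nat.even_iff] <;> omega
  -- Only the partner of i contributes: if another vector is paired with v i, the partner stays
  -- among the arguments of the power of B and is orthogonal to all of them.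
  rw [Finset.sum_eq_single (partnerPos i)]
  · rw [hp.neg_one_pow, one_smul, succAbove_partnerPos, hC _ (isSymplecticFamily_remove hv i)]
  · intro j _ hj
    have hpi : partner i ≠ i.succAbove j := by
      rw [← succAbove_partnerPos]
      exact fun h => hj (Fin.succAbove_right_injective h).symm
    obtain ⟨s, hs⟩ := Fin.exists_succAbove_eq (Ne.symm hj)
    have hs' : i.succAbove (j.succAbove s) = partner i := by
      rw [hs, succAbove_partnerPos]
    have hne (t : Fin (2 * m)) :
        ((i.succAbove (j.succAbove t) : Fin (2 * m + 2)) : ℕ) ≠ (i : ℕ) :=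
      fun h => Fin.succAbove_ne i _ (Fin.ext h)
    rw [bilinPow_eq_zero_of_orthogonal B m _ s, mul_zero, smul_zero]
    · intro t
      simp only [hs', hv _ _, (stdSymplectic_partner i _ (hne t)).1, mul_zero]
    · intro t
      simp only [hs', hv _ _, (stdSymplectic_partner i _ (hne t)).2, mul_zero]
  · simp

/-- This is the nonvanishing of a power of a symplectic form on a symplectic family. The value is
the same for all families, which feeds the induction and allows it to be cancelled afterwards. -/
theorem exists_bilinPow_apply_eq (B : E →L[ℝ] E →L[ℝ] ℂ) {b : ℂ} (hb : b ≠ 0) (m : ℕ) :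
    ∃ C ≠ 0, ∀ v : Fin (2 * m) → E, IsSymplecticFamily B b v → bilinPow B m v = C := by
  induction m with
  | zero => exact ⟨1, one_ne_zero, fun v _ => rfl⟩
  | succ m ih =>
    obtain ⟨C, hC0, hC⟩ := ih
    -- Each of the 2m + 2 indices contributes b, by the sign rule for partners.
    refine ⟨((2 * m + 2 : ℕ) * b) * C, ?_, fun v hv => ?_⟩
    · exact mul_ne_zero (mul_ne_zero (Nat.cast_ne_zero.mpr (by omega)) hb) hC0
    · refine (bilinPow_succ_apply B m v).trans ((bilinWedge_bilinPow_apply hC hv).trans ?_)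
      congr 1
      have (i : Fin (2 * m + 2)) : (-1 : ℤ) ^ (i : ℕ) • B (v i) (v (partner i)) = b := by
        have hB : B (v i) (v (partner i)) = b * stdSymplectic i (partner i) := hv i (partner i)
        rw [hB, ← mul_smul_comm, neg_one_pow_smul_stdSymplectic_partner, mul_one]
      rw [Finset.sum_congr rfl fun i _ => this i]
      simp

end BilinearPower

/-! ### Comparison of the permutation-sum wedge product with iterated alternatization. -/

section WedgePower

open ContinuousAlternatingMap

variable {E : Type*} [NormedAddCommGroup E] [NormedSpace ℝ E] {k : ℕ}

/-- Summing the alternating left side over all permutations of its arguments gives (k+1)! copies of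
it, and each of the k + 1 terms of the alternatization then yields the same signed sum. Dividing by
k + 1 leaves k!. -/
theorem factorial_smul_alternatizeUncurryFin (f : E →L[ℝ] E [⋀^Fin k]→L[ℝ] ℂ)
    (v : Fin (k + 1) → E) :
    (k.factorial : ℂ) * alternatizeUncurryFin f v = ∑ σ : Equiv.Perm (Fin (k + 1)),
      Equiv.Perm.sign σ • f (v (σ 0)) (fun i => v (σ i.succ)) := by
  have h1 (σ : Equiv.Perm (Fin (k + 1))) :
      Equiv.Perm.sign σ • alternatizeUncurryFin f (v ∘ σ) = alternatizeUncurryFin f v := by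
    have : alternatizeUncurryFin f (v ∘ σ) = Equiv.Perm.sign σ • alternatizeUncurryFin f v :=
      (alternatizeUncurryFin f).toAlternatingMap.map_perm v σ
    rw [this, smul_smul, Int.units_mul_self, one_smul]
  -- The inverse of the cycle on 0, …, i carries 0 to i and has sign (-1)^i.
  have h2 (i : Fin (k + 1)) : ∑ σ : Equiv.Perm (Fin (k + 1)), Equiv.Perm.sign σ •
        ((-1 : ℤ) ^ (i : ℕ) • f (v (σ i)) (fun s => v (σ (i.succAbove s)))) =
      ∑ σ : Equiv.Perm (Fin (k + 1)),
        Equiv.Perm.sign σ • f (v (σ 0)) (fun i => v (σ i.succ)) := by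
    refine Fintype.sum_equiv (Equiv.mulRight (i.cycleRange.symm)) _ _ fun σ => ?_
    simp only [Equiv.coe_mulRight, Equiv.Perm.coe_mul, Function.comp_apply,
      Fin.cycleRange_symm_zero, Fin.cycleRange_symm_succ, Equiv.Perm.sign_mul, Equiv.Perm.sign_symm,
      Fin.sign_cycleRange]
    rw [mul_smul]
    rcases Nat.even_or_odd i with h | h
    · simp [h.neg_one_pow]
    · simp [h.neg_one_pow]
  have h3 : ((k + 1).factorial : ℂ) * alternatizeUncurryFin f v =
      (k + 1 : ℕ) * ∑ σ : Equiv.Perm (Fin (k + 1)),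
        Equiv.Perm.sign σ • f (v (σ 0)) (fun i => v (σ i.succ)) := by
    calc _ = ∑ σ : Equiv.Perm (Fin (k + 1)),
          Equiv.Perm.sign σ • alternatizeUncurryFin f (v ∘ σ) := by
          rw [Finset.sum_congr rfl fun σ _ => h1 σ]
          simp [Fintype.card_perm]
      _ = ∑ σ : Equiv.Perm (Fin (k + 1)), ∑ i : Fin (k + 1), Equiv.Perm.sign σ •
        ((-1 : ℤ) ^ (i : ℕ) • f (v (σ i)) (fun s => v (σ (i.succAbove s)))) := by
          refine Finset.sum_congr rfl fun σ _ => ?_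
          rw [alternatizeUncurryFin_apply, Finset.smul_sum]
          rfl
      _ = _ := by
          rw [Finset.sum_comm, Finset.sum_congr rfl fun i _ => h2 i]
          simp
  rw [Nat.factorial_succ, Nat.cast_mul, mul_assoc] at h3
  exact mul_left_cancel₀ (Nat.cast_ne_zero.mpr (Nat.succ_ne_zero k)) h3

theorem factorial_smul_altTwo (T : E →L[ℝ] E →L[ℝ] E [⋀^Fin k]→L[ℝ] ℂ) (v : Fin (k + 2) → E) :
    (k.factorial : ℂ) * altTwo E k T v = ∑ σ : Equiv.Perm (Fin (k + 2)),
      Equiv.Perm.sign σ • T (v (σ 0)) (v (σ 1)) (fun i => v (σ i.succ.succ)) := by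
  have h1 := factorial_smul_alternatizeUncurryFin
    ((alternatizeUncurryFinCLM ℝ E ℂ).comp T) v
  -- The inner permutation, extended by fixing 0, is absorbed into the outer one; it has the same
  -- sign.
  have h2 (e : Equiv.Perm (Fin (k + 1))) : ∑ σ : Equiv.Perm (Fin (k + 2)),
        Equiv.Perm.sign σ • Equiv.Perm.sign e •
          T (v (σ 0)) (v (σ (e 0).succ)) (fun i => v (σ (e i.succ).succ)) =
      ∑ σ : Equiv.Perm (Fin (k + 2)),
        Equiv.Perm.sign σ • T (v (σ 0)) (v (σ 1)) (fun i => v (σ i.succ.succ)) := by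
    refine Fintype.sum_equiv (Equiv.mulRight (Equiv.Perm.decomposeFin.symm (0, e))) _ _ fun σ => ?_
    have h01 : (1 : Fin (k + 2)) = (0 : Fin (k + 1)).succ := rfl
    simp only [Equiv.coe_mulRight, Equiv.Perm.coe_mul, Function.comp_apply, h01,
      Equiv.Perm.decomposeFin_symm_apply_zero, Equiv.Perm.decomposeFin_symm_apply_succ,
      Equiv.swap_self, Equiv.refl_apply, Equiv.Perm.sign_mul, Equiv.Perm.decomposeFin.symm_sign,
      if_true, one_mul, mul_smul]
  have h3 : ((k + 1).factorial : ℂ) * ((k.factorial : ℂ) * altTwo E k T v) =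
      ((k + 1).factorial : ℂ) * ∑ σ : Equiv.Perm (Fin (k + 2)),
      Equiv.Perm.sign σ • T (v (σ 0)) (v (σ 1)) (fun i => v (σ i.succ.succ)) := by
    calc _ = (k.factorial : ℂ) * (((k + 1).factorial : ℂ) *
          alternatizeUncurryFin ((alternatizeUncurryFinCLM ℝ E ℂ).comp T) v) := by
          rw [mul_left_comm]
          rfl
      _ = ∑ σ : Equiv.Perm (Fin (k + 2)), Equiv.Perm.sign σ •
          ((k.factorial : ℂ) * alternatizeUncurryFin (T (v (σ 0))) (fun i => v (σ i.succ))) := by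
          rw [h1, Finset.mul_sum]
          refine Finset.sum_congr rfl fun σ _ => ?_
          rw [mul_smul_comm]
          rfl
      _ = ∑ σ : Equiv.Perm (Fin (k + 2)), ∑ e : Equiv.Perm (Fin (k + 1)),
          Equiv.Perm.sign σ • Equiv.Perm.sign e •
          T (v (σ 0)) (v (σ (e 0).succ)) (fun i => v (σ (e i.succ).succ)) := by
          refine Finset.sum_congr rfl fun σ _ => ?_
          rw [factorial_smul_alternatizeUncurryFin, Finset.smul_sum]
      _ = _ := by
          rw [Finset.sum_comm, Finset.sum_congr rfl fun e _ => h2 e]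
          simp [Fintype.card_perm]
  exact mul_left_cancel₀ (Nat.cast_ne_zero.mpr (Nat.factorial_ne_zero _)) h3

/-- The wedge product with a `2`-form is a multiple of `bilinWedge`. -/
theorem wedge_eq_smul_bilinWedge (n k : ℕ) : ∃ κ : ℂ, κ ≠ 0 ∧
    ∀ (W : Model n [⋀^Fin k]→L[ℝ] ℂ) (α : Model n [⋀^Fin 2]→L[ℝ] ℂ)
      (B : Model n →L[ℝ] Model n →L[ℝ] ℂ), (∀ u v, B u v = α ![u, v]) →
      wedge W α = κ • bilinWedge (Model n) k W B := by
  -- The wedge product feeds the first k arguments to W, while `bilinWedge` feeds the first two to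
  -- B. Rotating twice exchanges the blocks.
  let ρ : Equiv.Perm (Fin (k + 2)) := finRotate (k + 2) * finRotate (k + 2)
  have hρ1 (i : Fin k) : ρ (Fin.castAdd 2 i) = i.succ.succ := by
    have hi := i.isLt
    have e1 : finRotate (k + 2) (Fin.castAdd 2 i) = ⟨i + 1, by omega⟩ :=
      finRotate_of_lt (k := (i : ℕ)) (n := k + 1) (by omega)
    have e2 : finRotate (k + 2) ⟨i + 1, by omega⟩ = i.succ.succ :=
      finRotate_of_lt (k := (i : ℕ) + 1) (n := k + 1) (by omega)
    rw [Equiv.Perm.mul_apply, e1, e2]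
  have hρ2 (j : Fin 2) : ρ (Fin.natAdd k j) = ![0, 1] j := by
    have e3 : finRotate (k + 2) (Fin.last (k + 1)) = 0 := finRotate_last
    fin_cases j
    · have e1 : finRotate (k + 2) (Fin.natAdd k 0) = Fin.last (k + 1) :=
        finRotate_of_lt (k := k) (n := k + 1) (by omega)
      change finRotate (k + 2) (finRotate (k + 2) (Fin.natAdd k 0)) = 0
      rw [e1, e3]
    · change finRotate (k + 2) (finRotate (k + 2) (Fin.last (k + 1))) = 1
      rw [e3]
      exact finRotate_of_lt (k := 0) (n := k + 1) (by omega)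
  -- The 2 is the factor 2! of the wedge normalization; the factor k! is accounted for by
  -- `factorial_smul_altTwo`.
  refine ⟨((Equiv.Perm.sign ρ : ℤ) : ℂ) / 2, ?_, fun W α B hB => ?_⟩
  · exact div_ne_zero (Int.cast_ne_zero.mpr (Units.ne_zero _)) two_ne_zero
  ext v
  have h1 := factorial_smul_altTwo (bilinSmul (Model n) k W B) v
  have h2 : ∑ σ : Equiv.Perm (Fin (k + 2)),
      Equiv.Perm.sign σ • (W (fun i => v (σ (Fin.castAdd 2 i))) *
        α (fun j => v (σ (Fin.natAdd k j)))) = Equiv.Perm.sign ρ •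
      ∑ σ : Equiv.Perm (Fin (k + 2)), Equiv.Perm.sign σ •
        bilinSmul (Model n) k W B (v (σ 0)) (v (σ 1)) (fun i => v (σ i.succ.succ)) := by
    rw [Finset.smul_sum]
    symm
    refine Fintype.sum_equiv (Equiv.mulRight ρ) _ _ fun σ => ?_
    have hα : (fun j => v (σ (![0, 1] j))) = ![v (σ 0), v (σ 1)] := by
      ext1 j
      fin_cases j <;> rfl
    simp only [Equiv.coe_mulRight, Equiv.Perm.coe_mul, Function.comp_apply, hρ1, hρ2, hα,
      bilinSmul_apply, hB, Equiv.Perm.sign_mul, ContinuousAlternatingMap.smul_apply, smul_eq_mul]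
    rw [smul_smul, mul_comm (Equiv.Perm.sign ρ), mul_comm (W _)]
  rw [wedge_apply, h2, ← h1, ContinuousAlternatingMap.smul_apply, bilinWedge_def]
  rw [Units.smul_def, zsmul_eq_mul, Complex.real_smul]
  have : (k.factorial : ℂ) ≠ 0 := Nat.cast_ne_zero.mpr (Nat.factorial_ne_zero _)
  simp only [smul_eq_mul, Nat.factorial_two]
  push_cast
  field_simp

theorem bilinWedge_smul_left (c : ℂ) (W : E [⋀^Fin k]→L[ℝ] ℂ) (B : E →L[ℝ] E →L[ℝ] ℂ) :
    bilinWedge E k (c • W) B = c • bilinWedge E k W B := by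
  ext v
  rw [ContinuousAlternatingMap.smul_apply, bilinWedge_apply, bilinWedge_apply,
    Finset.smul_sum (r := c)]
  refine Finset.sum_congr rfl fun i _ => ?_
  rw [smul_comm c, Finset.smul_sum (r := c)]
  congr 1
  refine Finset.sum_congr rfl fun j _ => ?_
  rw [smul_comm c, ContinuousAlternatingMap.smul_apply, mul_smul_comm]

theorem bilinWedge_smul_right (c : ℂ) (W : E [⋀^Fin k]→L[ℝ] ℂ) (B : E →L[ℝ] E →L[ℝ] ℂ) :
    bilinWedge E k W (c • B) = c • bilinWedge E k W B := by
  rw [← bilinWedge_smul_left, bilinWedge_def, bilinWedge_def]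
  congr 1
  ext1 u
  ext1 v
  change (c • B u v) • W = B u v • (c • W)
  rw [smul_comm, smul_assoc]

/-- The factor depends on n and m only, not on the form, so it is constant when the form varies from
point to point. -/
theorem wedgePow_eq_smul_bilinPow (n m : ℕ) : ∃ κ : ℂ, κ ≠ 0 ∧
    ∀ (α : Model n [⋀^Fin 2]→L[ℝ] ℂ)
      (B : Model n →L[ℝ] Model n →L[ℝ] ℂ), (∀ u v, B u v = α ![u, v]) →
      wedgePow α m = κ • bilinPow B m := by
  induction m with
  | zero => exact ⟨1, one_ne_zero, fun α B h => (one_smul _ _).symm⟩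
  | succ m ih =>
    obtain ⟨κ, hκ, h⟩ := ih
    obtain ⟨κ', hκ', h'⟩ := wedge_eq_smul_bilinWedge n (2 * m)
    refine ⟨κ' * κ, mul_ne_zero hκ' hκ, fun α B hB => ?_⟩
    change wedge (wedgePow α m) α = (κ' * κ) • bilinWedge (Model n) (2 * m) (bilinPow B m) B
    rw [h α B hB, h' _ α B hB, mul_smul]
    congr 1
    exact bilinWedge_smul_left κ (bilinPow B m) B

end WedgePower

/-! ### The operators ∂ and ∂̄ on powers of a form and on multiples of a closed form. -/

section WirtingerPart

open ContinuousAlternatingMap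

variable {n k : ℕ} {F F₁ F₂ : Type*} [NormedAddCommGroup F] [NormedSpace ℂ F]
  [NormedAddCommGroup F₁] [NormedSpace ℂ F₁] [NormedAddCommGroup F₂] [NormedSpace ℂ F₂]

/-- The derivative along `(u + s J u) / 2`; this is the complex linear part of the derivative for
`s = -√-1` and the complex antilinear part for `s = √-1`. -/
def wirtinger (s : ℂ) (f : Model n → F) (z : Model n) : Model n →L[ℝ] F :=
  (1 / 2 : ℂ) • (fderiv ℝ f z + s • (fderiv ℝ f z).comp (mulI n))

theorem wirtinger_apply (s : ℂ) (f : Model n → F) (z u : Model n) :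
    wirtinger s f z u = (1 / 2 : ℂ) • (fderiv ℝ f z u + s • fderiv ℝ f z (mulI n u)) := rfl

theorem delbar_eq (α : Model n → Model n [⋀^Fin k]→L[ℝ] ℂ) (z : Model n) :
    delbar α z = alternatizeUncurryFin (wirtinger Complex.I α z) := rfl

theorem del_eq (α : Model n → Model n [⋀^Fin k]→L[ℝ] ℂ) (z : Model n) :
    del α z = alternatizeUncurryFin (wirtinger (-Complex.I) α z) := by
  rw [del, wirtinger, neg_smul, ← sub_eq_add_neg]

/-- The Leibniz rule; complex homogeneity in both arguments is what allows the complex scalar s to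
pass through b. -/
theorem wirtinger_bilinear (s : ℂ) (b : F₁ →L[ℝ] F₂ →L[ℝ] F)
    (hb₁ : ∀ (c : ℂ) x y, b (c • x) y = c • b x y) (hb₂ : ∀ (c : ℂ) x y, b x (c • y) = c • b x y)
    {f₁ : Model n → F₁} {f₂ : Model n → F₂} {z : Model n} (h₁ : DifferentiableAt ℝ f₁ z)
    (h₂ : DifferentiableAt ℝ f₂ z) (u : Model n) :
    wirtinger s (fun y => b (f₁ y) (f₂ y)) z u =
      b (wirtinger s f₁ z u) (f₂ z) + b (f₁ z) (wirtinger s f₂ z u) := by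
  have h := (b.hasFDerivAt_of_bilinear h₁.hasFDerivAt h₂.hasFDerivAt).fderiv
  have e₁ : b (wirtinger s f₁ z u) (f₂ z) = (1 / 2 : ℂ) •
      (b (fderiv ℝ f₁ z u) (f₂ z) + s • b (fderiv ℝ f₁ z (mulI n u)) (f₂ z)) := by
    rw [wirtinger_apply, hb₁, map_add, _root_.add_apply, hb₁]
  have e₂ : b (f₁ z) (wirtinger s f₂ z u) = (1 / 2 : ℂ) •
      (b (f₁ z) (fderiv ℝ f₂ z u) + s • b (f₁ z) (fderiv ℝ f₂ z (mulI n u))) := by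
    rw [wirtinger_apply, hb₂, map_add, hb₂]
  have e₃ (w : Model n) : fderiv ℝ (fun y => b (f₁ y) (f₂ y)) z w =
      b (f₁ z) (fderiv ℝ f₂ z w) + b (fderiv ℝ f₁ z w) (f₂ z) := by
    rw [h]
    rfl
  rw [e₁, e₂, wirtinger_apply, e₃, e₃]
  module

theorem ContDiffAt.wirtinger {s : ℂ} {f : Model n → F} {z : Model n} {r r' : WithTop ℕ∞}
    (hf : ContDiffAt ℝ r f z) (hr : r' + 1 ≤ r) : ContDiffAt ℝ r' (HermGeom.wirtinger s f) z := by
  have h : ContDiffAt ℝ r' (fderiv ℝ f) z := hf.fderiv_right hr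
  have h2 : ContDiffAt ℝ r' (fun y => (fderiv ℝ f y).comp (mulI n)) z :=
    h.clm_comp contDiffAt_const
  exact (h.add (h2.const_smul s)).const_smul (1 / 2 : ℂ)

variable (n k) in
/-- The bilinear map `(W, ℓ) ↦ (u ↦ ℓ(u) W)`. -/
def formSmul : (Model n [⋀^Fin k]→L[ℝ] ℂ) →L[ℝ] (Model n →L[ℝ] ℂ) →L[ℝ]
    (Model n →L[ℝ] Model n [⋀^Fin k]→L[ℝ] ℂ) :=
  (ContinuousLinearMap.compL ℝ (Model n) ℂ (Model n [⋀^Fin k]→L[ℝ] ℂ)).comp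
    (ContinuousLinearMap.lsmul ℝ ℂ).flip

variable (n k) in
/-- The exterior product with a `1`-form. -/
def formWedge : (Model n [⋀^Fin k]→L[ℝ] ℂ) →L[ℝ] (Model n →L[ℝ] ℂ) →L[ℝ]
    (Model n [⋀^Fin (k + 1)]→L[ℝ] ℂ) :=
  ((alternatizeUncurryFinCLM ℝ (Model n) ℂ).postcomp (Model n →L[ℝ] ℂ)).comp (formSmul n k)

theorem formWedge_eq (W : Model n [⋀^Fin k]→L[ℝ] ℂ) (ℓ : Model n →L[ℝ] ℂ) :
    formWedge n k W ℓ = alternatizeUncurryFin (formSmul n k W ℓ) := rfl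

theorem formWedge_smul_left (c : ℂ) (W : Model n [⋀^Fin k]→L[ℝ] ℂ) (ℓ : Model n →L[ℝ] ℂ) :
    formWedge n k (c • W) ℓ = c • formWedge n k W ℓ := by
  rw [formWedge_eq, formWedge_eq, ← alternatizeUncurryFin_smul]
  congr 1
  ext1 u
  change ℓ u • c • W = c • ℓ u • W
  exact smul_comm _ _ _

theorem formWedge_smul_right (c : ℂ) (W : Model n [⋀^Fin k]→L[ℝ] ℂ) (ℓ : Model n →L[ℝ] ℂ) :
    formWedge n k W (c • ℓ) = c • formWedge n k W ℓ := by
  rw [formWedge_eq, formWedge_eq, ← alternatizeUncurryFin_smul]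
  congr 1
  ext1 u
  change (c • ℓ u) • W = c • ℓ u • W
  exact smul_assoc _ _ _

theorem ContDiffAt.bilinPow {B : Model n → Model n →L[ℝ] Model n →L[ℝ] ℂ} {z : Model n}
    {r : WithTop ℕ∞} (hB : ContDiffAt ℝ r B z) (m : ℕ) :
    ContDiffAt ℝ r (fun y => bilinPow (B y) m) z := by
  induction m with
  | zero => exact contDiffAt_const
  | succ m ih => exact ((bilinWedge (Model n) (2 * m)).contDiff.contDiffAt.comp z ih).clm_apply hB

/-- By Leibniz the derivative is a term differentiating W plus one differentiating B. The second
vanishes by the cyclic condition, the first because W is closed for the operator in question. -/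
theorem alternatize_wirtinger_bilinWedge {s : ℂ} {B : Model n → Model n →L[ℝ] Model n →L[ℝ] ℂ}
    {W : Model n → Model n [⋀^Fin k]→L[ℝ] ℂ} {z : Model n} (hB : DifferentiableAt ℝ B z)
    (hcyc : ∀ u v w, wirtinger s B z u v w + wirtinger s B z v w u + wirtinger s B z w u v = 0)
    (hW : DifferentiableAt ℝ W z) (hW0 : alternatizeUncurryFin (wirtinger s W z) = 0) :
    alternatizeUncurryFin (wirtinger s (fun y => bilinWedge (Model n) k (W y) (B y)) z) = 0 := by
  let T₁ : Model n →L[ℝ] Model n →L[ℝ] Model n →L[ℝ] Model n [⋀^Fin k]→L[ℝ] ℂ :=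
    ((bilinSmul (Model n) k).flip (B z)).comp (wirtinger s W z)
  let T₂ : Model n →L[ℝ] Model n →L[ℝ] Model n →L[ℝ] Model n [⋀^Fin k]→L[ℝ] ℂ :=
    (bilinSmul (Model n) k (W z)).comp (wirtinger s B z)
  let T₃ : Model n →L[ℝ] Model n →L[ℝ] Model n →L[ℝ] Model n [⋀^Fin k]→L[ℝ] ℂ :=
    (((ContinuousLinearMap.lsmul ℝ ℂ).flip (wirtinger s W z)).postcomp (Model n)).comp (B z)
  have h1 : altThree T₁ = 0 := by
    -- The derivative of W is rotated into the innermost position, so that it is alternatized first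
    -- and gives 0.
    have hrot : altThree T₁ = altThree T₃ := altThree_rotate fun u v w => rfl
    rw [hrot, altThree_eq_altTwo T₃ 0, _root_.map_zero]
    intro u v
    change 0 = alternatizeUncurryFin (B z u v • wirtinger s W z)
    rw [alternatizeUncurryFin_smul, hW0, smul_zero]
  have h2 : altThree T₂ = 0 := by
    refine altThree_eq_zero_of_cyclic fun u v w => ?_
    change wirtinger s B z u v w • W z + wirtinger s B z v w u • W z +
      wirtinger s B z w u v • W z = 0
    rw [← add_smul, ← add_smul, hcyc, zero_smul]
  have h3 : wirtinger s (fun y => bilinWedge (Model n) k (W y) (B y)) z =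
      (altTwo (Model n) k).comp (T₁ + T₂) := by
    ext1 u
    rw [ContinuousLinearMap.comp_add, _root_.add_apply]
    exact wirtinger_bilinear s (bilinWedge (Model n) k) bilinWedge_smul_left
      (fun c x y => bilinWedge_smul_right c x y) hW hB u
  rw [h3]
  change altThree (T₁ + T₂) = 0
  rw [altThree_add, h1, h2, add_zero]

/-- If `∂B = 0` (or `∂̄B = 0`), then `∂(Bᵐ) = 0` (or `∂̄(Bᵐ) = 0`). -/
theorem alternatize_wirtinger_bilinPow {s : ℂ} {B : Model n → Model n →L[ℝ] Model n →L[ℝ] ℂ}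
    {z : Model n} (hB : DifferentiableAt ℝ B z)
    (hcyc : ∀ u v w, wirtinger s B z u v w + wirtinger s B z v w u + wirtinger s B z w u v = 0)
    (m : ℕ) : DifferentiableAt ℝ (fun y => bilinPow (B y) m) z ∧
      alternatizeUncurryFin (wirtinger s (fun y => bilinPow (B y) m) z) = 0 := by
  induction m with
  | zero =>
    refine ⟨differentiableAt_const _, ?_⟩
    have : wirtinger s (fun y : Model n => bilinPow (B y) 0) z = 0 := by
      ext1 u
      rw [wirtinger_apply]
      have : fderiv ℝ (fun y : Model n => bilinPow (B y) 0) z = 0 := fderiv_const_apply _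
      rw [this]
      simp
    rw [this, ← alternatizeUncurryFinCLM_apply, _root_.map_zero]
  | succ m ih =>
    exact ⟨((bilinWedge (Model n) (2 * m)).differentiableAt.comp z ih.1).clm_apply hB,
      alternatize_wirtinger_bilinWedge hB hcyc ih.1 ih.2⟩

/-- `∂∂̄(φ W) = ∂∂̄φ ∧ W` if `∂W = 0` and `∂̄W = 0`. -/
theorem del_delbar_smul {W : Model n → Model n [⋀^Fin k]→L[ℝ] ℂ} {φ : Model n → ℂ} {z : Model n}
    (hφ : ContDiffAt ℝ 2 φ z) (hW : ContDiffAt ℝ 2 W z)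
    (hbar : ∀ᶠ y in nhds z, alternatizeUncurryFin (wirtinger Complex.I W y) = 0)
    (hdel : alternatizeUncurryFin (wirtinger (-Complex.I) W z) = 0) :
    del (delbar fun y => φ y • W y) z =
      bilinWedge (Model n) k (W z) (wirtinger (-Complex.I) (wirtinger Complex.I φ) z) := by
  -- The formula for ∂̄ is needed on a neighbourhood, since ∂ is applied to it next.
  have h1 : ∀ᶠ y in nhds z, delbar (fun y => φ y • W y) y =
      formWedge n k (W y) (wirtinger Complex.I φ y) := by
    filter_upwards [hbar, hφ.eventually (by simp), hW.eventually (by simp)] with y hy hφy hWy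
    have e (u : Model n) := wirtinger_bilinear Complex.I
      (ContinuousLinearMap.lsmul ℝ ℂ : ℂ →L[ℝ] (Model n [⋀^Fin k]→L[ℝ] ℂ) →L[ℝ] _)
      (fun c x y => smul_assoc c x y) (fun c x y => smul_comm x c y)
      (hφy.differentiableAt (by simp)) (hWy.differentiableAt (by simp)) u
    have e2 : wirtinger Complex.I (fun y => φ y • W y) y =
        formSmul n k (W y) (wirtinger Complex.I φ y) + φ y • wirtinger Complex.I W y := by
      ext1 u
      exact e u
    rw [delbar_eq, e2, alternatizeUncurryFin_add, alternatizeUncurryFin_smul, hy, smul_zero,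
      add_zero]
    rfl
  have h2 : del (delbar fun y => φ y • W y) z =
      del (fun y => formWedge n k (W y) (wirtinger Complex.I φ y)) z := by
    rw [del, del, Filter.EventuallyEq.fderiv_eq h1]
  have e (u : Model n) := wirtinger_bilinear (-Complex.I) (formWedge n k)
    formWedge_smul_left (fun c x y => formWedge_smul_right c x y)
    (hW.differentiableAt (by simp))
    ((ContDiffAt.wirtinger (s := Complex.I) hφ (r' := 1) (by norm_num)).differentiableAt
      (by simp)) u
  set ℓ := wirtinger Complex.I φ
  let T : Model n →L[ℝ] Model n →L[ℝ] Model n [⋀^Fin k]→L[ℝ] ℂ :=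
    ((formSmul n k).flip (ℓ z)).comp (wirtinger (-Complex.I) W z)
  -- This is the term ∂̄φ ∧ ∂W: after exchanging the two slots, ∂W is alternatized first and
  -- vanishes.
  have hT : altTwo (Model n) k T = 0 := by
    let T' : Model n →L[ℝ] Model n →L[ℝ] Model n [⋀^Fin k]→L[ℝ] ℂ :=
      ((ContinuousLinearMap.lsmul ℝ ℂ).flip (wirtinger (-Complex.I) W z)).comp (ℓ z)
    rw [altTwo_congr_neg_flip (T := T') (T' := T) fun u v => rfl]
    have : (alternatizeUncurryFinCLM ℝ (Model n) ℂ).comp T' = 0 := by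
      ext1 u
      change alternatizeUncurryFin (ℓ z u • wirtinger (-Complex.I) W z) = 0
      rw [alternatizeUncurryFin_smul, hdel, smul_zero]
    change -alternatizeUncurryFin ((alternatizeUncurryFinCLM ℝ (Model n) ℂ).comp T') = 0
    rw [this, ← alternatizeUncurryFinCLM_apply, _root_.map_zero, neg_zero]
  have e2 : wirtinger (-Complex.I) (fun y => formWedge n k (W y) (ℓ y)) z =
      (alternatizeUncurryFinCLM ℝ (Model n) ℂ).comp
        (T + bilinSmul (Model n) k (W z) (wirtinger (-Complex.I) ℓ z)) := by
    ext1 u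
    rw [ContinuousLinearMap.comp_add, _root_.add_apply]
    exact e u
  rw [h2, del_eq, e2]
  change altTwo (Model n) k (T + bilinSmul (Model n) k (W z) (wirtinger (-Complex.I) ℓ z)) = _
  rw [map_add, hT, zero_add]
  rfl

end WirtingerPart

/-! ### The strong maximum principle of Hopf. -/

section MaximumPrinciple

open Set Filter Topology Metric

variable {V : Type*} [NormedAddCommGroup V] [InnerProductSpace ℝ V]

/-- Restrict to a line. A positive second derivative would make the point a local minimum as well,
so the restriction would be constant near it and its second derivative zero. -/
theorem second_deriv_nonpos_of_isLocalMax {v : V → ℝ} {z : V} (hv : ContDiffAt ℝ 2 v z)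
    (hmax : IsLocalMax v z) (x : V) : fderiv ℝ (fderiv ℝ v) z x x ≤ 0 := by
  by_contra hpos
  push Not at hpos
  let c : ℝ → V := fun t => z + t • x
  have hc (t : ℝ) : HasDerivAt c x t := by
    have := ((hasDerivAt_id t).smul_const x).const_add z
    rwa [one_smul] at this
  have hc0 : c 0 = z := by simp [c]
  have hct : Tendsto c (𝓝 0) (𝓝 z) := by
    have := (hc 0).continuousAt.tendsto
    rwa [hc0] at this
  have h1 : ∀ᶠ t in 𝓝 (0 : ℝ), HasDerivAt (v ∘ c) (fderiv ℝ v (c t) x) t := by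
    filter_upwards [hct.eventually (hv.eventually (by simp))] with t ht
    exact (ht.differentiableAt (by simp)).hasFDerivAt.comp_hasDerivAt t (hc t)
  have hd : deriv (v ∘ c) =ᶠ[𝓝 0] fun t => fderiv ℝ v (c t) x := by
    filter_upwards [h1] with t ht using ht.deriv
  have h2 : HasDerivAt (fun t => fderiv ℝ v (c t) x) (fderiv ℝ (fderiv ℝ v) z x x) 0 := by
    have hdd : DifferentiableAt ℝ (fderiv ℝ v) z :=
      (hv.fderiv_right (m := 1) (by norm_num)).differentiableAt (by simp)
    have : HasFDerivAt (fderiv ℝ v) (fderiv ℝ (fderiv ℝ v) z) (c 0) := by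
      rw [hc0]
      exact hdd.hasFDerivAt
    have h := (this.comp_hasDerivAt (0 : ℝ) (hc 0)).clm_apply (hasDerivAt_const (0 : ℝ) x)
    simpa using h
  have hdd : deriv (deriv (v ∘ c)) 0 = fderiv ℝ (fderiv ℝ v) z x x := by
    rw [hd.deriv_eq, h2.deriv]
  have hlm : IsLocalMax (v ∘ c) 0 := by
    have : ∀ᶠ t in 𝓝 (0 : ℝ), v (c t) ≤ v z := hct.eventually hmax
    filter_upwards [this] with t ht
    simpa [hc0] using ht
  have hd0 : deriv (v ∘ c) 0 = 0 := hlm.deriv_eq_zero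
  have hlmin : IsLocalMin (v ∘ c) 0 :=
    isLocalMin_of_deriv_deriv_pos (by rw [hdd]; exact hpos) hd0
      h1.self_of_nhds.continuousAt
  have hconst : v ∘ c =ᶠ[𝓝 0] fun _ => v z := by
    filter_upwards [hlm, hlmin] with t h h'
    have := le_antisymm h h'
    simpa [hc0] using this
  have : deriv (deriv (v ∘ c)) 0 = 0 := by
    rw [hconst.deriv.deriv_eq]
    simp
  linarith [hdd ▸ this]

variable (V) in
/-- The inner product as a real bilinear form. -/
def innerBilin : V →L[ℝ] V →L[ℝ] ℝ := innerSL ℝ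

theorem innerBilin_apply (x y : V) : innerBilin V x y = inner ℝ x y := rfl

/-- The bilinear form `(x, y) ↦ ⟨a, x⟩⟨a, y⟩`. -/
def innerSq (a : V) : V →L[ℝ] V →L[ℝ] ℝ := (innerBilin V a).smulRight (innerBilin V a)

theorem innerSq_apply (a x y : V) : innerSq a x y = inner ℝ a x * inner ℝ a y := rfl

theorem continuous_innerSq_sub (y : V) : Continuous fun z : V => innerSq (z - y) := by
  have h : Continuous fun z : V => innerBilin V (z - y) := by fun_prop
  exact ((ContinuousLinearMap.smulRightL ℝ V (V →L[ℝ] ℝ)).continuous.comp h).clm_apply h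

theorem continuous_barrier_hessian (a b : ℝ) (y : V) :
    Continuous fun z : V => a • innerSq (z - y) - b • innerBilin V := by
  have h : Continuous fun z : V => a • innerSq (z - y) := (continuous_innerSq_sub y).const_smul a
  have h' : Continuous fun _ : V => b • innerBilin V := continuous_const
  exact h.sub h'

/-- The bump function `exp(-α |z - y|²)` used as a barrier. -/
theorem fderiv_fderiv_gaussian (α : ℝ) (y z : V) :
    ContDiff ℝ ∞ (fun z : V => Real.exp (-α * ‖z - y‖ ^ 2)) ∧
    fderiv ℝ (fderiv ℝ fun z : V => Real.exp (-α * ‖z - y‖ ^ 2)) z =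
      Real.exp (-α * ‖z - y‖ ^ 2) • ((4 * α ^ 2) • innerSq (z - y) - (2 * α) • innerBilin V) := by
  have hsq (z : V) : HasFDerivAt (fun z : V => -α * ‖z - y‖ ^ 2)
      ((-α * 2) • innerBilin V (z - y)) z := by
    have := ((hasFDerivAt_id z).sub_const y).norm_sq.const_mul (-α)
    refine this.congr_fderiv ?_
    ext x
    simp [mul_assoc, innerBilin_apply]
  have h1 (z : V) : HasFDerivAt (fun z : V => Real.exp (-α * ‖z - y‖ ^ 2))
      (Real.exp (-α * ‖z - y‖ ^ 2) • ((-α * 2) • innerBilin V (z - y))) z := (hsq z).exp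
  have hsm : ContDiff ℝ ∞ (fun z : V => Real.exp (-α * ‖z - y‖ ^ 2)) := by
    have : ContDiff ℝ ∞ (fun z : V => ‖z - y‖ ^ 2) :=
      (contDiff_norm_sq ℝ).comp (contDiff_id.sub contDiff_const)
    exact (contDiff_const.mul this).exp
  refine ⟨hsm, ?_⟩
  rw [show fderiv ℝ (fun z : V => Real.exp (-α * ‖z - y‖ ^ 2)) = _ from
    funext fun z => (h1 z).fderiv]
  have hl : HasFDerivAt (fun z : V => (-α * 2) • innerBilin V (z - y))
      ((-α * 2) • innerBilin V) z := by
    have := ((innerBilin V).hasFDerivAt.comp z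
      ((hasFDerivAt_id z).sub_const y)).const_smul (-α * 2)
    exact this
  refine ((h1 z).smul hl).fderiv.trans ?_
  ext x x'
  simp [innerSq_apply, innerBilin_apply, inner_sub_left]
  ring

set_option maxHeartbeats 1000000 in
/-- Hopf's strong maximum principle for elliptic operators `v ↦ A(D²v)` with continuous
coefficients and no lower order terms. -/
theorem eventually_eq_of_isLocalMax [FiniteDimensional ℝ V] {U : Set V} (hU : IsOpen U)
    {A : V → (V →L[ℝ] V →L[ℝ] ℝ) →L[ℝ] ℝ} (hA : ContinuousOn A U)
    (hneg : ∀ z ∈ U, ∀ B : V →L[ℝ] V →L[ℝ] ℝ, (∀ x, B x x ≤ 0) → A z B ≤ 0)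
    (hpos : ∀ z ∈ U, ∀ a : V, a ≠ 0 → 0 < A z (innerSq a))
    {v : V → ℝ} (hv : ContDiffOn ℝ 2 v U) (hsub : ∀ z ∈ U, 0 ≤ A z (fderiv ℝ (fderiv ℝ v) z))
    {z₀ : V} (hz₀ : z₀ ∈ U) (hmax : IsLocalMax v z₀) : v =ᶠ[𝓝 z₀] fun _ => v z₀ := by
  by_contra hne
  obtain ⟨R, hR, hRU⟩ : ∃ R > 0, ball z₀ R ⊆ U ∩ {z | v z ≤ v z₀} :=
    Metric.mem_nhds_iff.mp (inter_mem (hU.mem_nhds hz₀) hmax)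
  have hcont : ContinuousOn v (ball z₀ R) := hv.continuousOn.mono fun z hz => (hRU hz).1
  -- The radius R/2 keeps the closed ball around y through z₀ inside the ball of radius R.
  obtain ⟨y, hyR, hy⟩ : ∃ y ∈ ball z₀ (R / 2), v y < v z₀ := by
    by_contra hall
    push Not at hall
    refine hne ?_
    filter_upwards [ball_mem_nhds z₀ (half_pos hR)] with z hz
    exact le_antisymm (hRU (ball_subset_ball (by linarith) hz)).2 (hall z hz)
  have hyz : dist z₀ y < R / 2 := by
    rw [dist_comm]
    exact hyR
  have hclosed : closedBall y (dist z₀ y) ⊆ ball z₀ R := by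
    intro w hw
    rw [mem_closedBall] at hw
    rw [mem_ball]
    linarith [dist_triangle w y z₀, dist_comm y z₀]
  -- the point of `{v = max}` nearest to `y`
  obtain ⟨p, ⟨hpball, hpv⟩, hpmin⟩ : ∃ p ∈ closedBall y (dist z₀ y) ∩ v ⁻¹' {v z₀},
      IsMinOn (fun w => dist w y) (closedBall y (dist z₀ y) ∩ v ⁻¹' {v z₀}) p := by
    have hz₀' : z₀ ∈ closedBall y (dist z₀ y) ∩ v ⁻¹' {v z₀} :=
      ⟨mem_closedBall.mpr le_rfl, rfl⟩
    refine IsCompact.exists_isMinOn ?_ ⟨z₀, hz₀'⟩ (by fun_prop)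
    exact (isCompact_closedBall y _).of_isClosed_subset
        ((hcont.mono hclosed).preimage_isClosed_of_isClosed isClosed_closedBall isClosed_singleton)
        inter_subset_left
  have hpv : v p = v z₀ := hpv
  have hlt (w : V) (hw : dist w y < dist p y) : v w < v z₀ := by
    have hw' : w ∈ closedBall y (dist z₀ y) := by
      rw [mem_closedBall] at hpball ⊢
      linarith
    refine lt_of_le_of_ne (hRU (hclosed hw')).2 fun h => ?_
    exact absurd (hpmin ⟨hw', h⟩) (not_le.mpr hw)
  have hpy : p ≠ y := fun h => by
    rw [h] at hpv
    linarith
  -- a smaller ball touching `{v = max}` only at `p`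
  set y' : V := midpoint ℝ p y with hy'
  have hpy' : dist p y' = dist p y / 2 := by
    rw [hy', dist_left_midpoint]
    norm_num
    ring
  have hyy' : dist y' y = dist p y / 2 := by
    rw [hy', dist_midpoint_right]
    norm_num
    ring
  have htouch (w : V) (hw : dist w y' ≤ dist p y') (hwp : w ≠ p) : v w < v z₀ := by
    refine hlt w (lt_of_le_of_ne ?_ fun h => hwp ?_)
    · linarith [dist_triangle w y' y]
    · have hc : y' - y = p - y' := by
        rw [hy', midpoint_sub_right, left_sub_midpoint]
      -- As y' is the midpoint of p and y, the parallelogram law gives |w - y|² + |w - p|² = 2|w -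
      -- y'|² + 2|p - y'|² ≤ |p - y|². So |w - y| = |p - y| forces w = p.
      have hpar := parallelogram_law_with_norm ℝ (w - y') (p - y')
      have e1 : w - y' + (p - y') = w - y := by rw [← hc]; abel
      have e2 : w - y' - (p - y') = w - p := by abel
      rw [e1, e2, ← dist_eq_norm, ← dist_eq_norm, ← dist_eq_norm, ← dist_eq_norm, h, hpy'] at hpar
      rw [hpy'] at hw
      have hw2 : dist w y' * dist w y' ≤ dist p y / 2 * (dist p y / 2) :=
        mul_self_le_mul_self dist_nonneg hw
      have : dist w p * dist w p ≤ 0 := by linarith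
      exact dist_eq_zero.mp (mul_self_eq_zero.mp (le_antisymm this (mul_self_nonneg _)))
  have hp' : p - y' ≠ 0 := by
    rw [sub_ne_zero]
    intro h
    have : dist p y' = 0 := by rw [← h, dist_self]
    rw [hpy'] at this
    exact hpy (dist_eq_zero.mp (by linarith))
  have hpU : p ∈ ball z₀ R := hclosed hpball
  have hpU' : p ∈ U := (hRU hpU).1
  -- choice of the exponent
  obtain ⟨α, hα0, hα⟩ : ∃ α : ℝ, 0 < α ∧
      0 < A p ((4 * α ^ 2) • innerSq (p - y') - (2 * α) • innerBilin V) := by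
    have h1 := hpos p hpU' _ hp'
    set a := A p (innerSq (p - y'))
    set b := A p (innerBilin V) with hb
    -- For this α the quadratic term 4α²a exceeds 2αb.
    refine ⟨(|b| + 1) / a, by positivity, ?_⟩
    rw [map_sub, map_smul, map_smul]
    simp only [smul_eq_mul]
    have : 4 * ((|b| + 1) / a) ^ 2 * a - 2 * ((|b| + 1) / a) * b =
        2 * ((|b| + 1) / a) * (2 * (|b| + 1) - b) := by
      field_simp
      ring
    rw [this]
    have : b ≤ |b| := le_abs_self b
    have : 0 ≤ |b| := abs_nonneg b
    have : 0 < 2 * (|b| + 1) - b := by linarith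
    positivity
  set w : V → ℝ := fun z => Real.exp (-α * ‖z - y'‖ ^ 2) with hw
  have hwc : ContDiff ℝ ∞ w := (fderiv_fderiv_gaussian α y' 0).1
  have hwA : ∀ᶠ z in 𝓝 p, 0 < A z (fderiv ℝ (fderiv ℝ w) z) := by
    have hc : ContinuousAt (fun z => A z ((4 * α ^ 2) • innerSq (z - y') -
        (2 * α) • innerBilin V)) p := by
      have hAc : ContinuousAt A p := hA.continuousAt (hU.mem_nhds hpU')
      exact hAc.clm_apply (continuous_barrier_hessian (4 * α ^ 2) (2 * α) y').continuousAt
    filter_upwards [hc.eventually (lt_mem_nhds hα)] with z hz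
    rw [(fderiv_fderiv_gaussian α y' z).2, map_smul]
    exact mul_pos (Real.exp_pos _) hz
  obtain ⟨ε, hε, hεs⟩ : ∃ ε > 0, closedBall p ε ⊆ ball z₀ R ∩
      {z | 0 < A z (fderiv ℝ (fderiv ℝ w) z)} :=
    Metric.nhds_basis_closedBall.mem_iff.mp (inter_mem (isOpen_ball.mem_nhds hpU) hwA)
  have hwlt (z : V) (hz : dist p y' < dist z y') : w z < w p := by
    simp only [hw]
    rw [Real.exp_lt_exp, ← dist_eq_norm, ← dist_eq_norm]
    have := pow_lt_pow_left₀ hz dist_nonneg two_ne_zero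
    nlinarith
  -- choice of the size of the perturbation
  obtain ⟨δ, hδ0, hδ⟩ : ∃ δ > 0, ∀ z ∈ sphere p ε ∩ closedBall y' (dist p y'),
      v z + δ * w z < v p := by
    rcases (sphere p ε ∩ closedBall y' (dist p y')).eq_empty_or_nonempty with hemp | hne
    · exact ⟨1, one_pos, by simp [hemp]⟩
    · have hcv : ContinuousOn v (sphere p ε ∩ closedBall y' (dist p y')) :=
        hcont.mono fun z hz => (hεs (sphere_subset_closedBall hz.1)).1
      obtain ⟨q, hq, hqmax⟩ := ((isCompact_sphere p ε).inter_right
        isClosed_closedBall).exists_isMaxOn hne hcv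
      have hqp : q ≠ p := fun h => by
        have := hq.1
        rw [h, mem_sphere, dist_self] at this
        linarith
      have hqv : v q < v p := by
        rw [hpv]
        exact htouch q hq.2 hqp
      -- Since w ≤ 1, adding δw uses up at most half of the gap between v p and the maximum v q on
      -- the cap.
      refine ⟨(v p - v q) / 2, by linarith, fun z hz => ?_⟩
      have h1 : v z ≤ v q := hqmax hz
      have h2 : w z ≤ 1 := by
        simp only [hw]
        rw [Real.exp_le_one_iff]
        have : 0 ≤ ‖z - y'‖ ^ 2 := by positivity
        nlinarith
      nlinarith
  -- The perturbed function is smaller on the sphere around p than at p: on the cap by the choice of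
  -- δ, off the cap because w is smaller than at p. So its maximum over the closed ball is interior,
  -- where A(D²u) ≤ 0 contradicts A(D²v) ≥ 0 and A(D²w) > 0.
  set u : V → ℝ := fun z => v z + δ * (w z - w p) with hu
  have hup : u p = v p := by simp [hu]
  have hwp0 : 0 < w p := Real.exp_pos _
  have husphere (z : V) (hz : z ∈ sphere p ε) : u z < u p := by
    rw [hup]
    by_cases h : z ∈ closedBall y' (dist p y')
    · have := hδ z ⟨hz, h⟩
      have h3 := mul_pos hδ0 hwp0
      simp only [hu]
      linarith
    · rw [mem_closedBall, not_le] at h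
      have h1 := hwlt z h
      have h2 : v z ≤ v z₀ := (hRU (hεs (sphere_subset_closedBall hz)).1).2
      simp only [hu]
      nlinarith
  have hucont : ContinuousOn u (closedBall p ε) := by
    have := (hcont.mono fun z hz => (hεs hz).1 : ContinuousOn v (closedBall p ε))
    exact this.add ((hwc.continuous.sub continuous_const).const_mul δ).continuousOn
  obtain ⟨q, hq, hqmax⟩ := (isCompact_closedBall p ε).exists_isMaxOn
    ⟨p, mem_closedBall_self hε.le⟩ hucont
  have hqin : q ∈ ball p ε := by
    rcases (mem_closedBall.mp hq).lt_or_eq with h | h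
    · exact h
    · exact absurd (hqmax (mem_closedBall_self hε.le)) (not_le.mpr (husphere q h))
  have hqloc : IsLocalMax u q :=
    Filter.mem_of_superset (isOpen_ball.mem_nhds hqin) fun z hz =>
      hqmax (ball_subset_closedBall hz)
  have hqU : q ∈ U := (hRU (hεs hq).1).1
  have hvq : ContDiffAt ℝ 2 v q := hv.contDiffAt (hU.mem_nhds hqU)
  have hwq : ContDiffAt ℝ 2 (fun z => δ * (w z - w p)) q :=
    (contDiff_const.mul ((hwc.of_le ENat.LEInfty.out).sub contDiff_const)).contDiffAt
  have h1 : A q (fderiv ℝ (fderiv ℝ u) q) ≤ 0 :=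
    hneg q hqU _ (second_deriv_nonpos_of_isLocalMax (hvq.add hwq) hqloc)
  have h2 : fderiv ℝ (fderiv ℝ u) q =
      fderiv ℝ (fderiv ℝ v) q + δ • fderiv ℝ (fderiv ℝ w) q := by
    have e1 : fderiv ℝ u =ᶠ[𝓝 q] fun z => fderiv ℝ v z + δ • fderiv ℝ w z := by
      filter_upwards [hvq.eventually (by simp)] with z hz
      have hwd : DifferentiableAt ℝ w z := hwc.differentiable (by simp) z
      rw [hu, fderiv_fun_add (hz.differentiableAt (by simp)) (by fun_prop),
        fderiv_const_mul (by fun_prop), fderiv_sub_const]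
    have hdv : DifferentiableAt ℝ (fderiv ℝ v) q :=
      (hvq.fderiv_right (m := 1) (by norm_num)).differentiableAt (by simp)
    have hdw : DifferentiableAt ℝ (fderiv ℝ w) q :=
      ((hwc.contDiffAt (x := q)).fderiv_right (m := 1)
        (by rw [one_add_one_eq_two]; exact ENat.LEInfty.out)).differentiableAt
        (by simp)
    rw [e1.fderiv_eq]
    exact (hdv.hasFDerivAt.add (hdw.hasFDerivAt.const_smul δ)).fderiv
  rw [h2, map_add, map_smul] at h1
  have h3 := hsub q hqU
  have h4 := mul_pos hδ0 (hεs hq).2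
  simp only [smul_eq_mul] at h1
  linarith

end MaximumPrinciple

/-! ### Polarization of forms that are linear in two slots and antilinear in two. -/

section Polarization

variable {n : ℕ}

/-- The quadrilinear form with coefficients `T`, complex linear in the first and third argument and
antilinear in the others. -/
def sesqQuad (T : Fin n → Fin n → Fin n → Fin n → ℂ) (X Y Z W : Fin n → ℂ) : ℂ :=
  ∑ i, ∑ j, ∑ k, ∑ l, T i j k l * X i * star (Y j) * Z k * star (W l)

variable (T : Fin n → Fin n → Fin n → Fin n → ℂ)

theorem sesqQuad_add_smul (X Y : Fin n → ℂ) (t : ℂ) :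
    sesqQuad T (X + t • Y) (X + t • Y) (X + t • Y) (X + t • Y) =
      sesqQuad T X X X X + t * (sesqQuad T Y X X X + sesqQuad T X X Y X) +
      star t * (sesqQuad T X Y X X + sesqQuad T X X X Y) +
      t ^ 2 * sesqQuad T Y X Y X + (star t) ^ 2 * sesqQuad T X Y X Y +
      t * star t * (sesqQuad T Y Y X X + sesqQuad T Y X X Y + sesqQuad T X Y Y X +
        sesqQuad T X X Y Y) +
      t ^ 2 * star t * (sesqQuad T Y Y Y X + sesqQuad T Y X Y Y) +
      t * (star t) ^ 2 * (sesqQuad T X Y Y Y + sesqQuad T Y Y X Y) +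
      t ^ 2 * (star t) ^ 2 * sesqQuad T Y Y Y Y := by
  simp only [sesqQuad, Finset.mul_sum, ← Finset.sum_add_distrib]
  refine Finset.sum_congr rfl fun i _ => Finset.sum_congr rfl fun j _ =>
    Finset.sum_congr rfl fun k _ => Finset.sum_congr rfl fun l _ => ?_
  simp only [Pi.add_apply, Pi.smul_apply, smul_eq_mul, star_add, star_mul']
  ring

/-- On X + tY the diagonal value is a polynomial in t and t̄ that vanishes identically. Substituting
t, -t, ±it and combining with signs isolates the monomials t² and t̄²; the wanted value is the
coefficient of t². -/
theorem sesqQuad_eq_zero_of_diagonal (h : ∀ X, sesqQuad T X X X X = 0) (X Y : Fin n → ℂ) :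
    sesqQuad T Y X Y X = 0 := by
  have key (t : ℂ) := (sesqQuad_add_smul T X Y t).symm.trans (h _)
  generalize sesqQuad T X X X X = c0 at key
  generalize sesqQuad T Y X X X + sesqQuad T X X Y X = c1 at key
  generalize sesqQuad T X Y X X + sesqQuad T X X X Y = c2 at key
  generalize sesqQuad T Y X Y X = c3 at key ⊢
  generalize sesqQuad T X Y X Y = c4 at key
  generalize sesqQuad T Y Y X X + sesqQuad T Y X X Y + sesqQuad T X Y Y X + sesqQuad T X X Y Y = c5
    at key
  generalize sesqQuad T Y Y Y X + sesqQuad T Y X Y Y = c6 at key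
  generalize sesqQuad T X Y Y Y + sesqQuad T Y Y X Y = c7 at key
  generalize sesqQuad T Y Y Y Y = c8 at key
  have hI : Complex.I ^ 2 = -1 := Complex.I_sq
  have hsI : star Complex.I = -Complex.I := Complex.conj_I
  have four (a : ℂ) : a ^ 2 * c3 + (star a) ^ 2 * c4 = 0 := by
    have h1 := key a
    have h2 := key (-a)
    have h3 := key (Complex.I * a)
    have h4 := key (-(Complex.I * a))
    simp only [star_neg, star_mul', hsI] at h1 h2 h3 h4
    linear_combination (1 / 4 : ℂ) * (h1 + h2 - h3 - h4) + (1 / 2 : ℂ) * hI * (a ^ 2 * c3 +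
      (star a) ^ 2 * c4 - a * star a * c5 + a ^ 2 * (star a) ^ 2 * c8 * (Complex.I ^ 2 - 1))
  -- Since 1² = 1 and (1 + i)² = 2i, these two values give c3 + c4 = 0 and c3 - c4 = 0.
  have e1 := four 1
  have e2 := four (1 + Complex.I)
  simp only [star_add, star_one, hsI] at e1 e2
  linear_combination (1 / 2 : ℂ) * e1 - (1 / 4 : ℂ) * Complex.I * e2 + (1 / 2 : ℂ) * hI * (c3 - c4)
    + (1 / 4 : ℂ) * hI * Complex.I * (c3 + c4)

theorem sesqQuad_add₁ (X X' Y Z W : Fin n → ℂ) :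
    sesqQuad T (X + X') Y Z W = sesqQuad T X Y Z W + sesqQuad T X' Y Z W := by
  simp only [sesqQuad, ← Finset.sum_add_distrib]
  refine Finset.sum_congr rfl fun i _ => Finset.sum_congr rfl fun j _ =>
    Finset.sum_congr rfl fun k _ => Finset.sum_congr rfl fun l _ => ?_
  simp only [Pi.add_apply]
  ring

theorem sesqQuad_add₂ (X Y Y' Z W : Fin n → ℂ) :
    sesqQuad T X (Y + Y') Z W = sesqQuad T X Y Z W + sesqQuad T X Y' Z W := by
  simp only [sesqQuad, ← Finset.sum_add_distrib]
  refine Finset.sum_congr rfl fun i _ => Finset.sum_congr rfl fun j _ =>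
    Finset.sum_congr rfl fun k _ => Finset.sum_congr rfl fun l _ => ?_
  simp only [Pi.add_apply, star_add]
  ring

theorem sesqQuad_add₃ (X Y Z Z' W : Fin n → ℂ) :
    sesqQuad T X Y (Z + Z') W = sesqQuad T X Y Z W + sesqQuad T X Y Z' W := by
  simp only [sesqQuad, ← Finset.sum_add_distrib]
  refine Finset.sum_congr rfl fun i _ => Finset.sum_congr rfl fun j _ =>
    Finset.sum_congr rfl fun k _ => Finset.sum_congr rfl fun l _ => ?_
  simp only [Pi.add_apply]
  ring

theorem sesqQuad_add₄ (X Y Z W W' : Fin n → ℂ) :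
    sesqQuad T X Y Z (W + W') = sesqQuad T X Y Z W + sesqQuad T X Y Z W' := by
  simp only [sesqQuad, ← Finset.sum_add_distrib]
  refine Finset.sum_congr rfl fun i _ => Finset.sum_congr rfl fun j _ =>
    Finset.sum_congr rfl fun k _ => Finset.sum_congr rfl fun l _ => ?_
  simp only [Pi.add_apply, star_add]
  ring

theorem sesqQuad_single (i j k l : Fin n) :
    sesqQuad T (Pi.single i 1) (Pi.single j 1) (Pi.single k 1) (Pi.single l 1) = T i j k l := by
  simp only [sesqQuad, Pi.single_apply, apply_ite star, star_one, star_zero, mul_ite, mul_one,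
    mul_zero, Finset.sum_ite_eq', Finset.mem_univ, if_true]

/-- A quadrilinear form vanishing on the diagonal has zero symmetrization. -/
theorem polarization (h : ∀ X, sesqQuad T X X X X = 0) (i j k l : Fin n) :
    T i j k l + T i l k j + T k j i l + T k l i j = 0 := by
  have h1 := sesqQuad_eq_zero_of_diagonal T h
  -- The two linear slots are polarized first, the two antilinear ones afterwards.
  have h2 (X Y Y' : Fin n → ℂ) : sesqQuad T Y X Y' X + sesqQuad T Y' X Y X = 0 := by
    have e := h1 X (Y + Y')
    rw [sesqQuad_add₁, sesqQuad_add₃, sesqQuad_add₃, h1, h1] at e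
    linear_combination e
  have h3 (X X' Y Y' : Fin n → ℂ) : sesqQuad T Y X Y' X' + sesqQuad T Y X' Y' X +
      sesqQuad T Y' X Y X' + sesqQuad T Y' X' Y X = 0 := by
    have e := h2 (X + X') Y Y'
    rw [sesqQuad_add₂, sesqQuad_add₂, sesqQuad_add₄, sesqQuad_add₄, sesqQuad_add₄,
      sesqQuad_add₄] at e
    linear_combination e - h2 X Y Y' - h2 X' Y Y'
  have e := h3 (Pi.single j 1) (Pi.single l 1) (Pi.single i 1) (Pi.single k 1)
  simpa only [sesqQuad_single] using e

end Polarization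

/-! ### Rules for Wirtinger derivatives of functions. -/

section WirtingerCalculus

variable {n : ℕ} {s t : ℂ} {F G : Model n → ℂ} {z : Model n}

theorem dz_eq (i : Fin n) (F : Model n → ℂ) (z : Model n) :
    dz i F z = wirtinger (-Complex.I) F z (basisVec i) := by
  simp [dz, wirtinger_apply, sub_eq_add_neg]

theorem dzbar_eq (i : Fin n) (F : Model n → ℂ) (z : Model n) :
    dzbar i F z = wirtinger Complex.I F z (basisVec i) := by
  simp [dzbar, wirtinger_apply]

theorem wirtinger_congr (s : ℂ) (h : F =ᶠ[nhds z] G) : wirtinger s F z = wirtinger s G z := by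
  rw [wirtinger, wirtinger, h.fderiv_eq]

theorem wirtinger_const (s c : ℂ) (z u : Model n) : wirtinger s (fun _ => c) z u = 0 := by
  simp [wirtinger_apply]

theorem wirtinger_add (hF : DifferentiableAt ℝ F z) (hG : DifferentiableAt ℝ G z)
    (u : Model n) : wirtinger s (fun y => F y + G y) z u =
      wirtinger s F z u + wirtinger s G z u := by
  simp only [wirtinger_apply, fderiv_fun_add hF hG, _root_.add_apply, smul_eq_mul]
  ring

theorem wirtinger_sub (hF : DifferentiableAt ℝ F z) (hG : DifferentiableAt ℝ G z)
    (u : Model n) : wirtinger s (fun y => F y - G y) z u =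
      wirtinger s F z u - wirtinger s G z u := by
  simp only [wirtinger_apply, fderiv_fun_sub hF hG, _root_.sub_apply, smul_eq_mul]
  ring

theorem wirtinger_mul (hF : DifferentiableAt ℝ F z) (hG : DifferentiableAt ℝ G z)
    (u : Model n) : wirtinger s (fun y => F y * G y) z u =
      wirtinger s F z u * G z + F z * wirtinger s G z u := by
  simp only [wirtinger_apply, fderiv_fun_mul hF hG, _root_.add_apply, _root_.smul_apply,
    smul_eq_mul]
  ring

theorem wirtinger_const_mul (hF : DifferentiableAt ℝ F z) (c : ℂ)
    (u : Model n) : wirtinger s (fun y => c * F y) z u = c * wirtinger s F z u := by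
  rw [wirtinger_mul (differentiableAt_const c) hF, wirtinger_const, zero_mul, zero_add]

theorem wirtinger_sum {ι : Type*} (S : Finset ι) {F : ι → Model n → ℂ}
    (hF : ∀ i ∈ S, DifferentiableAt ℝ (F i) z) (u : Model n) :
    wirtinger s (fun y => ∑ i ∈ S, F i y) z u = ∑ i ∈ S, wirtinger s (F i) z u := by
  simp only [wirtinger_apply, fderiv_fun_sum hF, _root_.sum_apply, smul_eq_mul,
    Finset.mul_sum, ← Finset.sum_add_distrib]

theorem wirtinger_star (hF : DifferentiableAt ℝ F z) (u : Model n) :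
    wirtinger s (fun y => star (F y)) z u = star (wirtinger (star s) F z u) := by
  have h : fderiv ℝ (fun y => star (F y)) z = Complex.conjCLE.toContinuousLinearMap.comp
      (fderiv ℝ F z) :=
    (Complex.conjCLE.toContinuousLinearMap.hasFDerivAt.comp z hF.hasFDerivAt).fderiv
  simp only [wirtinger_apply, h, smul_eq_mul, star_mul', star_add, star_star]
  simp

theorem wirtinger_wirtinger_apply (hF : ContDiffAt ℝ 2 F z) (u v : Model n) :
    wirtinger s (fun y => wirtinger t F y v) z u = (1 / 4 : ℂ) *
      (fderiv ℝ (fderiv ℝ F) z u v + t * fderiv ℝ (fderiv ℝ F) z u (mulI n v) +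
      s * fderiv ℝ (fderiv ℝ F) z (mulI n u) v +
      s * t * fderiv ℝ (fderiv ℝ F) z (mulI n u) (mulI n v)) := by
  have hd : DifferentiableAt ℝ (fderiv ℝ F) z :=
    (hF.fderiv_right (m := 1) (by norm_num)).differentiableAt (by simp)
  have h (w : Model n) : fderiv ℝ (fun y => wirtinger t F y v) z w =
      (1 / 2 : ℂ) * (fderiv ℝ (fderiv ℝ F) z w v + t * fderiv ℝ (fderiv ℝ F) z w (mulI n v)) := by
    have e (v : Model n) : HasFDerivAt (fun y => fderiv ℝ F y v)
        ((fderiv ℝ (fderiv ℝ F) z).flip v) z := by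
      have := hd.hasFDerivAt.clm_apply (hasFDerivAt_const v z)
      refine this.congr_fderiv ?_
      ext w
      simp
    have := ((e v).add ((e (mulI n v)).const_smul t)).const_smul (1 / 2 : ℂ)
    have e2 : (fun y => wirtinger t F y v) = fun y => (1 / 2 : ℂ) •
        (fderiv ℝ F y v + t • fderiv ℝ F y (mulI n v)) := rfl
    rw [e2]
    refine (congrArg (fun L => L w) this.fderiv).trans ?_
    simp [mul_add]
  rw [wirtinger_apply, h, h]
  simp only [smul_eq_mul]
  ring

theorem wirtinger_comm (hF : ContDiffAt ℝ 2 F z) (u v : Model n) :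
    wirtinger s (fun y => wirtinger t F y v) z u =
      wirtinger t (fun y => wirtinger s F y u) z v := by
  have hs : IsSymmSndFDerivAt ℝ F z := hF.isSymmSndFDerivAt (by simp)
  rw [wirtinger_wirtinger_apply hF, wirtinger_wirtinger_apply hF, hs.eq u v, hs.eq u (mulI n v),
    hs.eq (mulI n u) v, hs.eq (mulI n u) (mulI n v)]
  ring

theorem ContDiffOn.wirtinger_apply {U : Set (Model n)} (hU : IsOpen U) (hF : ContDiffOn ℝ ∞ F U)
    (s : ℂ) (u : Model n) : ContDiffOn ℝ ∞ (fun y => HermGeom.wirtinger s F y u) U := by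
  intro y hy
  have h : ContDiffAt ℝ ∞ F y := hF.contDiffAt (hU.mem_nhds hy)
  exact ((ContDiffAt.wirtinger (r' := ∞) h (by simp)).clm_apply contDiffAt_const).contDiffWithinAt

end WirtingerCalculus

/-! ### Curvature symmetries of a locally conformally Kähler metric. -/

section ChernCurvature

variable {n : ℕ}

/-- The Chern symbols of a Hermitian matrix function. -/
def hermSymbol (h : Model n → Matrix (Fin n) (Fin n) ℂ) (i j k : Fin n) (z : Model n) : ℂ :=
  ∑ l, (h z)⁻¹ l k * dz i (fun y => h y j l) z

/-- The Chern curvature of a Hermitian matrix function. -/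
def hermCurvature (h : Model n → Matrix (Fin n) (Fin n) ℂ) (z : Model n) (i j k l : Fin n) : ℂ :=
  -∑ p, h z p l * dzbar j (hermSymbol h i k p) z

/-- A smooth Hermitian metric on an open set together with a smooth real function `f` such that
`e^{-f} h` is Kähler. -/
structure LocalLCK (U : Set (Model n)) (h : Model n → Matrix (Fin n) (Fin n) ℂ)
    (f : Model n → ℝ) : Prop where
  isOpen : IsOpen U
  smooth : ∀ i j, ContDiffOn ℝ ∞ (fun z => h z i j) U
  star_apply : ∀ z ∈ U, ∀ i j, star (h z i j) = h z j i
  isUnit_det : ∀ z ∈ U, IsUnit (h z).det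
  diag_ne_zero : ∀ z ∈ U, ∀ i, h z i i ≠ 0
  smooth_potential : ContDiffOn ℝ ∞ (fun z => (f z : ℂ)) U
  torsion : ∀ z ∈ U, ∀ i j l, dz i (fun y => h y j l) z - dz i (fun y => (f y : ℂ)) z * h z j l =
    dz j (fun y => h y i l) z - dz j (fun y => (f y : ℂ)) z * h z i l

theorem contDiffOn_det {U : Set (Model n)} {m : ℕ} {h : Model n → Matrix (Fin m) (Fin m) ℂ}
    (hs : ∀ i j, ContDiffOn ℝ ∞ (fun z => h z i j) U) : ContDiffOn ℝ ∞ (fun z => (h z).det) U := by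
  simp only [Matrix.det_apply]
  refine ContDiffOn.sum fun σ _ => ?_
  refine ContDiffOn.const_smul (Equiv.Perm.sign σ) ?_
  exact contDiffOn_prod fun i _ => hs _ _

theorem contDiffOn_inv {U : Set (Model n)} {h : Model n → Matrix (Fin n) (Fin n) ℂ}
    (hs : ∀ i j, ContDiffOn ℝ ∞ (fun z => h z i j) U) (hdet : ∀ z ∈ U, (h z).det ≠ 0)
    (i j : Fin n) : ContDiffOn ℝ ∞ (fun z => (h z)⁻¹ i j) U := by
  have hadj : ContDiffOn ℝ ∞ (fun z => (h z).adjugate i j) U := by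
    simp only [Matrix.adjugate_apply]
    refine contDiffOn_det fun k l => ?_
    by_cases hk : k = j
    · subst hk
      simp only [Matrix.updateRow_self]
      exact contDiffOn_const
    · simp only [Matrix.updateRow_ne hk]
      exact hs k l
  have := ((contDiffOn_det hs).inv hdet).mul hadj
  refine this.congr fun z hz => ?_
  rw [Matrix.inv_def, Matrix.smul_apply, Ring.inverse_eq_inv', smul_eq_mul]
  rfl

theorem dz_congr {F G : Model n → ℂ} {z : Model n} {i : Fin n} (h : F =ᶠ[nhds z] G) :
    dz i F z = dz i G z := by
  rw [dz_eq, dz_eq, wirtinger_congr _ h]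

theorem dzbar_congr {F G : Model n → ℂ} {z : Model n} {i : Fin n} (h : F =ᶠ[nhds z] G) :
    dzbar i F z = dzbar i G z := by
  rw [dzbar_eq, dzbar_eq, wirtinger_congr _ h]

theorem dzbar_star {F : Model n → ℂ} {z : Model n} {i : Fin n} (hF : DifferentiableAt ℝ F z) :
    dzbar i (fun y => star (F y)) z = star (dz i F z) := by
  have : star Complex.I = -Complex.I := Complex.conj_I
  rw [dzbar_eq, wirtinger_star hF, this, dz_eq]

theorem dz_star {F : Model n → ℂ} {z : Model n} {i : Fin n} (hF : DifferentiableAt ℝ F z) :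
    dz i (fun y => star (F y)) z = star (dzbar i F z) := by
  have : star (-Complex.I) = Complex.I := by
    rw [star_neg, show star Complex.I = -Complex.I from Complex.conj_I, neg_neg]
  rw [dz_eq, wirtinger_star hF, this, dzbar_eq]

theorem dz_dzbar_comm {F : Model n → ℂ} {z : Model n} {i j : Fin n} (hF : ContDiffAt ℝ 2 F z) :
    dz i (dzbar j F) z = dzbar j (dz i F) z := by
  rw [dz_eq, dzbar_eq, funext (dz_eq i F), funext (dzbar_eq j F), wirtinger_comm hF]

theorem dz_dz_comm {F : Model n → ℂ} {z : Model n} {i j : Fin n} (hF : ContDiffAt ℝ 2 F z) :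
    dz i (dz j F) z = dz j (dz i F) z := by
  rw [dz_eq, dz_eq, funext (dz_eq i F), funext (dz_eq j F), wirtinger_comm hF]

namespace LocalLCK

variable {U : Set (Model n)} {h : Model n → Matrix (Fin n) (Fin n) ℂ} {f : Model n → ℝ}

section

variable (L : LocalLCK U h f) {z : Model n} (hz : z ∈ U)
include L hz

theorem diffAt {F : Model n → ℂ} (hF : ContDiffOn ℝ ∞ F U) : DifferentiableAt ℝ F z :=
  (hF.contDiffAt (L.isOpen.mem_nhds hz)).differentiableAt (by simp)

theorem contDiffAt_two {F : Model n → ℂ} (hF : ContDiffOn ℝ ∞ F U) : ContDiffAt ℝ 2 F z :=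
  (hF.contDiffAt (L.isOpen.mem_nhds hz)).of_le ENat.LEInfty.out

theorem sum_mul_inv (i j : Fin n) : ∑ p, h z i p * (h z)⁻¹ p j = if i = j then 1 else 0 := by
  rw [← Matrix.mul_apply, Matrix.mul_nonsing_inv _ (L.isUnit_det z hz), Matrix.one_apply]

theorem sum_inv_mul (i j : Fin n) : ∑ p, (h z)⁻¹ i p * h z p j = if i = j then 1 else 0 := by
  rw [← Matrix.mul_apply, Matrix.nonsing_inv_mul _ (L.isUnit_det z hz), Matrix.one_apply]

/-- Cancellation of the metric. -/
theorem eq_of_sum_mul_eq {a b : Fin n → ℂ} (hab : ∀ l, ∑ p, a p * h z p l = ∑ p, b p * h z p l) :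
    a = b := by
  have : Matrix.vecMul a (h z) = Matrix.vecMul b (h z) := by
    ext l
    exact hab l
  have e := congrArg (fun v => Matrix.vecMul v (h z)⁻¹) this
  simpa [Matrix.vecMul_vecMul, Matrix.mul_nonsing_inv _ (L.isUnit_det z hz)] using e

theorem sum_symbol_mul (i k l : Fin n) :
    ∑ p, hermSymbol h i k p z * h z p l = dz i (fun y => h y k l) z := by
  simp only [hermSymbol, Finset.sum_mul]
  rw [Finset.sum_comm]
  have (q : Fin n) : ∑ p, (h z)⁻¹ q p * dz i (fun y => h y k q) z * h z p l =
      dz i (fun y => h y k q) z * if q = l then 1 else 0 := by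
    rw [← L.sum_inv_mul hz, Finset.mul_sum]
    refine Finset.sum_congr rfl fun p _ => ?_
    ring
  rw [Finset.sum_congr rfl fun q _ => this q]
  simp

/-- Symmetry of ∂_i(e^{-f}h_{jl̄}) in i and j, with the metric cancelled. The torsion of the Chern
connection is thus expressed by ∂f alone. -/
theorem symbol_sub_symbol (i k p : Fin n) : hermSymbol h i k p z - hermSymbol h k i p z =
    dz i (fun y => (f y : ℂ)) z * (if p = k then 1 else 0) -
      dz k (fun y => (f y : ℂ)) z * (if p = i then 1 else 0) := by
  refine congrFun (L.eq_of_sum_mul_eq hz (a := fun p => hermSymbol h i k p z - hermSymbol h k i p z)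
    (b := fun p => dz i (fun y => (f y : ℂ)) z * (if p = k then 1 else 0) -
      dz k (fun y => (f y : ℂ)) z * (if p = i then 1 else 0)) fun l => ?_) p
  simp only [sub_mul, Finset.sum_sub_distrib, L.sum_symbol_mul hz, mul_assoc, ite_mul, one_mul,
    zero_mul, mul_ite, mul_zero, Finset.sum_ite_eq', Finset.mem_univ, if_true]
  linear_combination L.torsion z hz i k l

end

variable (L : LocalLCK U h f)
include L

theorem contDiffOn_dz {F : Model n → ℂ} (hF : ContDiffOn ℝ ∞ F U) (i : Fin n) :
    ContDiffOn ℝ ∞ (dz i F) U := by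
  simp only [funext (dz_eq i F)]
  exact ContDiffOn.wirtinger_apply L.isOpen hF _ _

theorem contDiffOn_dzbar {F : Model n → ℂ} (hF : ContDiffOn ℝ ∞ F U) (i : Fin n) :
    ContDiffOn ℝ ∞ (dzbar i F) U := by
  simp only [funext (dzbar_eq i F)]
  exact ContDiffOn.wirtinger_apply L.isOpen hF _ _

theorem contDiffOn_symbol (i k p : Fin n) : ContDiffOn ℝ ∞ (hermSymbol h i k p) U := by
  unfold hermSymbol
  exact ContDiffOn.sum fun l _ => (contDiffOn_inv L.smooth
    (fun z hz => (L.isUnit_det z hz).ne_zero) l p).mul (L.contDiffOn_dz (L.smooth k l) i)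

variable {z : Model n} (hz : z ∈ U)
include hz

theorem eventually_mem : ∀ᶠ y in nhds z, y ∈ U := L.isOpen.mem_nhds hz

/-- Applying ∂̄ to the torsion identity gives the first Bianchi identity; the torsion enters through
the complex Hessian of f. -/
theorem curvature_sub_curvature (i j k l : Fin n) :
    hermCurvature h z i j k l - hermCurvature h z k j i l =
      -dzbar j (dz i fun y => (f y : ℂ)) z * h z k l +
        dzbar j (dz k fun y => (f y : ℂ)) z * h z i l := by
  have e (p : Fin n) : dzbar j (hermSymbol h i k p) z - dzbar j (hermSymbol h k i p) z =
      dzbar j (dz i fun y => (f y : ℂ)) z * (if p = k then 1 else 0) -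
        dzbar j (dz k fun y => (f y : ℂ)) z * (if p = i then 1 else 0) := by
    have d1 := L.diffAt hz (L.contDiffOn_symbol i k p)
    have d2 := L.diffAt hz (L.contDiffOn_symbol k i p)
    have d3 := L.diffAt hz (L.contDiffOn_dz L.smooth_potential i)
    have d4 := L.diffAt hz (L.contDiffOn_dz L.smooth_potential k)
    simp only [dzbar_eq]
    rw [← wirtinger_sub d1 d2, wirtinger_congr _ (G := fun y =>
      (if p = k then 1 else 0) * dz i (fun y => (f y : ℂ)) y -
        (if p = i then 1 else 0) * dz k (fun y => (f y : ℂ)) y), wirtinger_sub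
        (d3.const_mul _) (d4.const_mul _), wirtinger_const_mul d3, wirtinger_const_mul d4]
    · ring
    · filter_upwards [L.eventually_mem hz] with y hy
      rw [L.symbol_sub_symbol hy]
      ring
  have : ∑ p, h z p l * (dzbar j (hermSymbol h i k p) z - dzbar j (hermSymbol h k i p) z) =
      dzbar j (dz i fun y => (f y : ℂ)) z * h z k l -
        dzbar j (dz k fun y => (f y : ℂ)) z * h z i l := by
    simp only [e, mul_sub, Finset.sum_sub_distrib, mul_ite, mul_one, mul_zero,
      Finset.sum_ite_eq', Finset.mem_univ, if_true]
    ring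
  simp only [mul_sub, Finset.sum_sub_distrib] at this
  simp only [hermCurvature]
  linear_combination -this

/-- The derivative of the identity `Γ h = ∂h`. -/
theorem sum_wirtinger_symbol_mul (s : ℂ) (u : Model n) (i k l : Fin n) :
    ∑ p, (wirtinger s (hermSymbol h i k p) z u * h z p l +
      hermSymbol h i k p z * wirtinger s (fun y => h y p l) z u) =
      wirtinger s (dz i fun y => h y k l) z u := by
  have d1 (p : Fin n) := L.diffAt hz (L.contDiffOn_symbol i k p)
  have d2 (p : Fin n) := L.diffAt hz (L.smooth p l)
  rw [← wirtinger_congr s (F := fun y => ∑ p, hermSymbol h i k p y * h y p l)]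
  · rw [wirtinger_sum (F := fun p y => hermSymbol h i k p y * h y p l) _
      fun p _ => (d1 p).mul (d2 p)]
    exact Finset.sum_congr rfl fun p _ => (wirtinger_mul (d1 p) (d2 p) u).symm
  · filter_upwards [L.eventually_mem hz] with y hy
    exact L.sum_symbol_mul hy i k l

theorem dzbar_metric (j p l : Fin n) :
    dzbar j (fun y => h y p l) z = ∑ q, star (hermSymbol h j l q z) * h z p q := by
  have e1 : dzbar j (fun y => h y p l) z = star (dz j (fun y => h y l p) z) := by
    rw [← dzbar_star (L.diffAt hz (L.smooth l p))]
    · refine dzbar_congr ?_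
      filter_upwards [L.eventually_mem hz] with y hy
      exact (L.star_apply y hy l p).symm
  rw [e1, ← L.sum_symbol_mul hz j l p, star_sum]
  refine Finset.sum_congr rfl fun q _ => ?_
  rw [star_mul', L.star_apply z hz]

/-- Since ∂̄h is given by the conjugate symbols, the derivative of Γh = ∂h yields the classical
formula R = -∂∂̄h + ∂h h⁻¹ ∂̄h, whose Hermitian symmetry is visible. -/
theorem curvature_eq (i j k l : Fin n) : hermCurvature h z i j k l =
    -dzbar j (dz i fun y => h y k l) z +
      ∑ p, ∑ q, hermSymbol h i k p z * star (hermSymbol h j l q z) * h z p q := by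
  have e := L.sum_wirtinger_symbol_mul hz Complex.I (basisVec j) i k l
  simp only [← dzbar_eq, L.dzbar_metric hz, Finset.sum_add_distrib] at e
  rw [← e, hermCurvature]
  simp only [Finset.mul_sum, mul_assoc, mul_comm (h z _ l)]
  ring

theorem star_curvature (i j k l : Fin n) :
    star (hermCurvature h z i j k l) = hermCurvature h z j i l k := by
  have h1 : star (dzbar j (dz i fun y => h y k l) z) = dzbar i (dz j fun y => h y l k) z := by
    rw [← dz_star (L.diffAt hz (L.contDiffOn_dz (L.smooth k l) i)),
      ← dz_dzbar_comm (L.contDiffAt_two hz (L.smooth l k))]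
    refine dz_congr ?_
    filter_upwards [L.eventually_mem hz] with y hy
    rw [← dzbar_star (L.diffAt hy (L.smooth k l))]
    refine dzbar_congr ?_
    filter_upwards [L.eventually_mem hy] with x hx
    exact L.star_apply x hx k l
  rw [L.curvature_eq hz, L.curvature_eq hz, star_add, star_neg, star_sum, h1]
  congr 1
  simp only [star_sum, star_mul', star_star, L.star_apply z hz]
  rw [Finset.sum_comm]
  refine Finset.sum_congr rfl fun p _ => Finset.sum_congr rfl fun q _ => ?_
  ring

theorem star_potential (i j : Fin n) : star (dzbar i (dz j fun y => (f y : ℂ)) z) =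
    dzbar j (dz i fun y => (f y : ℂ)) z := by
  rw [← dz_star (L.diffAt hz (L.contDiffOn_dz L.smooth_potential j)),
    ← dz_dzbar_comm (L.contDiffAt_two hz L.smooth_potential)]
  refine dz_congr ?_
  filter_upwards [L.eventually_mem hz] with y hy
  rw [← dzbar_star (L.diffAt hy L.smooth_potential)]
  congr 1
  ext x
  exact Complex.conj_ofReal _

/-- The exchange law for the unbarred indices, conjugated by means of the Hermitian symmetry. -/
theorem curvature_sub_curvature' (i j k l : Fin n) :
    hermCurvature h z i j k l - hermCurvature h z i l k j =
      -dzbar j (dz i fun y => (f y : ℂ)) z * h z k l +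
        dzbar l (dz i fun y => (f y : ℂ)) z * h z k j := by
  have e := congrArg star (L.curvature_sub_curvature hz j i l k)
  simpa only [star_sub, L.star_curvature hz, star_add, star_mul', star_neg, L.star_potential hz,
    L.star_apply z hz] using e

/-- The curvature of a metric of pointwise constant holomorphic sectional curvature. -/
theorem four_mul_curvature {c : ℂ}
    (hc : ∀ X : Fin n → ℂ, sesqQuad (hermCurvature h z) X X X X =
      c * (∑ i, ∑ j, h z i j * X i * star (X j)) ^ 2) (i j k l : Fin n) :
    4 * hermCurvature h z i j k l + 3 * dzbar j (dz i fun y => (f y : ℂ)) z * h z k l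
      - dzbar j (dz k fun y => (f y : ℂ)) z * h z i l
      - dzbar l (dz i fun y => (f y : ℂ)) z * h z k j
      - dzbar l (dz k fun y => (f y : ℂ)) z * h z i j =
    2 * c * (h z i j * h z k l + h z i l * h z k j) := by
  have hT (X : Fin n → ℂ) : sesqQuad (fun i j k l => hermCurvature h z i j k l -
      c * h z i j * h z k l) X X X X = 0 := by
    have e1 : sesqQuad (fun i j k l => hermCurvature h z i j k l -
        c * h z i j * h z k l) X X X X = sesqQuad (hermCurvature h z) X X X X -
        sesqQuad (fun i j k l => c * h z i j * h z k l) X X X X := by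
      simp only [sesqQuad, ← Finset.sum_sub_distrib]
      refine Finset.sum_congr rfl fun i _ => Finset.sum_congr rfl fun j _ =>
        Finset.sum_congr rfl fun k _ => Finset.sum_congr rfl fun l _ => ?_
      ring
    rw [e1, hc, sub_eq_zero, sq]
    simp only [sesqQuad, Finset.sum_mul, Finset.mul_sum]
    refine Finset.sum_congr rfl fun i _ => Finset.sum_congr rfl fun j _ =>
      Finset.sum_congr rfl fun k _ => Finset.sum_congr rfl fun l _ => ?_
    ring
  -- Of the four polarized terms three are brought back to R_{ij̄kl̄} by the exchange laws. The term
  -- with both pairs exchanged is reached through R_{kj̄il̄}, so that law is used twice.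
  have e := polarization _ hT i j k l
  linear_combination e + L.curvature_sub_curvature' hz i j k l +
    L.curvature_sub_curvature hz i j k l + L.curvature_sub_curvature hz i j k l +
    L.curvature_sub_curvature' hz k j i l

end LocalLCK

end ChernCurvature

/-! ### The Schur lemma for pointwise constant holomorphic sectional curvature. -/

section Schur

variable {n : ℕ}

/-- The trace of the complex Hessian of `f` with respect to `h`. -/
def hermLaplacian (h : Model n → Matrix (Fin n) (Fin n) ℂ) (f : Model n → ℝ) (z : Model n) : ℂ :=
  ∑ k, ∑ l, dzbar l (dz k fun y => (f y : ℂ)) z * (h z)⁻¹ l k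

/-- The `(1, 0)`-form whose `∂̄` is pointwise proportional to the metric if the holomorphic
sectional curvature is pointwise constant. -/
def schurForm (h : Model n → Matrix (Fin n) (Fin n) ℂ) (f : Model n → ℝ) (i : Fin n)
    (z : Model n) : ℂ :=
  -4 * (∑ p, hermSymbol h i p p z) + (3 * n - 2) * dz i (fun y => (f y : ℂ)) z

theorem mulI_apply (u : Model n) (j : Fin n) : mulI n u j = Complex.I * u j := rfl

theorem mulI_mulI (u : Model n) : mulI n (mulI n u) = -u := by
  ext j
  simp only [mulI_apply, PiLp.neg_apply]
  linear_combination u j * Complex.I_sq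

theorem eq_sum_basisVec (u : Model n) :
    u = ∑ m, ((u m).re • basisVec m + (u m).im • mulI n (basisVec m)) := by
  ext j
  simp only [WithLp.ofLp_sum, Finset.sum_apply, PiLp.add_apply, PiLp.smul_apply,
    mulI_apply, basisVec, EuclideanSpace.single, PiLp.single_apply, Complex.real_smul]
  rw [Finset.sum_eq_single j]
  · simp only [if_true, mul_one]
    rw [Complex.re_add_im]
  · intro b _ hb
    simp [hb.symm]
  · simp

namespace LocalLCK

variable {U : Set (Model n)} {h : Model n → Matrix (Fin n) (Fin n) ℂ} {f : Model n → ℝ}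
  (L : LocalLCK U h f) {z : Model n} (hz : z ∈ U)
include L hz

theorem trace_metric : ∑ k, ∑ l, h z k l * (h z)⁻¹ l k = n := by
  simp [L.sum_mul_inv hz]

theorem trace_curvature (i j : Fin n) : ∑ k, ∑ l, hermCurvature h z i j k l * (h z)⁻¹ l k =
    -∑ p, dzbar j (hermSymbol h i p p) z := by
  rw [← Finset.sum_neg_distrib]
  refine Finset.sum_congr rfl fun k _ => ?_
  simp only [hermCurvature, neg_mul, Finset.sum_mul, Finset.sum_neg_distrib]
  congr 1
  rw [Finset.sum_comm]
  have (p : Fin n) : ∑ l, h z p l * dzbar j (hermSymbol h i k p) z * (h z)⁻¹ l k =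
      dzbar j (hermSymbol h i k p) z * if p = k then 1 else 0 := by
    rw [← L.sum_mul_inv hz, Finset.mul_sum]
    refine Finset.sum_congr rfl fun l _ => ?_
    ring
  rw [Finset.sum_congr rfl fun p _ => this p]
  simp

theorem trace_left (a : Fin n → ℂ) (i : Fin n) :
    ∑ k, ∑ l, a k * h z i l * (h z)⁻¹ l k = a i := by
  have (k : Fin n) : ∑ l, a k * h z i l * (h z)⁻¹ l k = a k * if i = k then 1 else 0 := by
    rw [← L.sum_mul_inv hz, Finset.mul_sum]
    refine Finset.sum_congr rfl fun l _ => ?_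
    ring
  rw [Finset.sum_congr rfl fun k _ => this k]
  simp

theorem trace_right (a : Fin n → ℂ) (j : Fin n) :
    ∑ k, ∑ l, a l * h z k j * (h z)⁻¹ l k = a j := by
  rw [Finset.sum_comm]
  have (l : Fin n) : ∑ k, a l * h z k j * (h z)⁻¹ l k = a l * if l = j then 1 else 0 := by
    rw [← L.sum_inv_mul hz, Finset.mul_sum]
    refine Finset.sum_congr rfl fun k _ => ?_
    ring
  rw [Finset.sum_congr rfl fun l _ => this l]
  simp

/-- Contract the curvature formula with the inverse metric in k and l. The curvature gives the
∂̄-derivative of the traced symbols, the Hessian terms in i, j̄ add up to 3n - 1 - 1, and all the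
rest is proportional to h_{ij̄}. This explains the coefficients of `schurForm`. -/
theorem dzbar_schurForm {c : ℂ}
    (hc : ∀ X : Fin n → ℂ, sesqQuad (hermCurvature h z) X X X X =
      c * (∑ i, ∑ j, h z i j * X i * star (X j)) ^ 2) (i j : Fin n) :
    dzbar j (schurForm h f i) z = (hermLaplacian h f z + 2 * (n + 1) * c) * h z i j := by
  have hs := fun p => L.diffAt hz (L.contDiffOn_symbol i p p)
  have hf := L.diffAt hz (L.contDiffOn_dz L.smooth_potential i)
  have hsum : DifferentiableAt ℝ (fun y => ∑ p, hermSymbol h i p p y) z :=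
    DifferentiableAt.fun_sum fun p _ => hs p
  have e1 : dzbar j (schurForm h f i) z = -4 * (∑ p, dzbar j (hermSymbol h i p p) z) +
      (3 * n - 2) * dzbar j (dz i fun y => (f y : ℂ)) z := by
    simp only [dzbar_eq]
    unfold schurForm
    rw [wirtinger_add (hsum.const_mul _) (hf.const_mul _), wirtinger_const_mul hsum,
      wirtinger_const_mul hf, wirtinger_sum _ fun p _ => hs p]
  have e2 : ∑ k, ∑ l, (4 * hermCurvature h z i j k l +
      3 * dzbar j (dz i fun y => (f y : ℂ)) z * h z k l
      - dzbar j (dz k fun y => (f y : ℂ)) z * h z i l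
      - dzbar l (dz i fun y => (f y : ℂ)) z * h z k j
      - dzbar l (dz k fun y => (f y : ℂ)) z * h z i j) * (h z)⁻¹ l k =
      ∑ k, ∑ l, (2 * c * (h z i j * h z k l + h z i l * h z k j)) * (h z)⁻¹ l k := by
    refine Finset.sum_congr rfl fun k _ => Finset.sum_congr rfl fun l _ => ?_
    rw [L.four_mul_curvature hz hc]
  have e3 := L.trace_curvature hz i j
  have e4 := L.trace_metric hz
  have e5 := L.trace_left hz (fun k => dzbar j (dz k fun y => (f y : ℂ)) z) i
  have e6 := L.trace_right hz (fun l => dzbar l (dz i fun y => (f y : ℂ)) z) j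
  have e7 := L.trace_left hz (fun k => h z k j) i
  have e8 : ∑ k, ∑ l, (4 * hermCurvature h z i j k l +
      3 * dzbar j (dz i fun y => (f y : ℂ)) z * h z k l
      - dzbar j (dz k fun y => (f y : ℂ)) z * h z i l
      - dzbar l (dz i fun y => (f y : ℂ)) z * h z k j
      - dzbar l (dz k fun y => (f y : ℂ)) z * h z i j) * (h z)⁻¹ l k =
      4 * (∑ k, ∑ l, hermCurvature h z i j k l * (h z)⁻¹ l k) +
      3 * dzbar j (dz i fun y => (f y : ℂ)) z * (∑ k, ∑ l, h z k l * (h z)⁻¹ l k) -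
      (∑ k, ∑ l, dzbar j (dz k fun y => (f y : ℂ)) z * h z i l * (h z)⁻¹ l k) -
      (∑ k, ∑ l, dzbar l (dz i fun y => (f y : ℂ)) z * h z k j * (h z)⁻¹ l k) -
      hermLaplacian h f z * h z i j := by
    simp only [hermLaplacian, Finset.mul_sum, Finset.sum_mul, ← Finset.sum_add_distrib,
      ← Finset.sum_sub_distrib]
    refine Finset.sum_congr rfl fun k _ => Finset.sum_congr rfl fun l _ => ?_
    ring
  have e9 : ∑ k, ∑ l, (2 * c * (h z i j * h z k l + h z i l * h z k j)) * (h z)⁻¹ l k =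
      2 * c * (h z i j * (∑ k, ∑ l, h z k l * (h z)⁻¹ l k) +
        ∑ k, ∑ l, h z k j * h z i l * (h z)⁻¹ l k) := by
    simp only [Finset.mul_sum, ← Finset.sum_add_distrib]
    refine Finset.sum_congr rfl fun k _ => Finset.sum_congr rfl fun l _ => ?_
    ring
  rw [e8, e9, e3, e4, e5, e6, e7] at e2
  rw [e1]
  linear_combination e2

/-- The form is ∂-closed because mixed second derivatives of f and of the metric commute; for the
latter, the commutator of the symbols that appears has trace zero. -/
theorem dz_schurForm_comm (i m : Fin n) :
    dz m (schurForm h f i) z = dz i (schurForm h f m) z := by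
  have hs := fun i p => L.diffAt hz (L.contDiffOn_symbol i p p)
  have hf := fun i => L.diffAt hz (L.contDiffOn_dz L.smooth_potential i)
  have hsum (i : Fin n) : DifferentiableAt ℝ (fun y => ∑ p, hermSymbol h i p p y) z :=
    DifferentiableAt.fun_sum fun p _ => hs i p
  have e1 (i m : Fin n) : dz m (schurForm h f i) z = -4 * (∑ p, dz m (hermSymbol h i p p) z) +
      (3 * n - 2) * dz m (dz i fun y => (f y : ℂ)) z := by
    simp only [dz_eq m]
    unfold schurForm
    rw [wirtinger_add ((hsum i).const_mul _) ((hf i).const_mul _), wirtinger_const_mul (hsum i),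
      wirtinger_const_mul (hf i), wirtinger_sum _ fun p _ => hs i p]
  -- the (2, 0) part of the curvature vanishes
  have e2 (i m k l : Fin n) : ∑ p, (dz m (hermSymbol h i k p) z +
      ∑ q, hermSymbol h i k q z * hermSymbol h m q p z) * h z p l =
      dz m (dz i fun y => h y k l) z := by
    have e := L.sum_wirtinger_symbol_mul hz (-Complex.I) (basisVec m) i k l
    simp only [← dz_eq, Finset.sum_add_distrib, ← L.sum_symbol_mul hz m] at e
    rw [← e]
    simp only [add_mul, Finset.sum_add_distrib, Finset.sum_mul, Finset.mul_sum]
    congr 1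
    rw [Finset.sum_comm]
    refine Finset.sum_congr rfl fun p _ => Finset.sum_congr rfl fun q _ => ?_
    ring
  have e3 (k : Fin n) := L.eq_of_sum_mul_eq hz (a := fun p => dz m (hermSymbol h i k p) z +
      ∑ q, hermSymbol h i k q z * hermSymbol h m q p z) (b := fun p => dz i (hermSymbol h m k p) z +
      ∑ q, hermSymbol h m k q z * hermSymbol h i q p z) fun l => by
    rw [e2, e2, dz_dz_comm (L.contDiffAt_two hz (L.smooth k l))]
  have e4 : ∑ p, (dz m (hermSymbol h i p p) z +
      ∑ q, hermSymbol h i p q z * hermSymbol h m q p z) = ∑ p, (dz i (hermSymbol h m p p) z +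
      ∑ q, hermSymbol h m p q z * hermSymbol h i q p z) :=
    Finset.sum_congr rfl fun p _ => congrFun (e3 p) p
  have e5 : ∑ p, ∑ q, hermSymbol h i p q z * hermSymbol h m q p z =
      ∑ p, ∑ q, hermSymbol h m p q z * hermSymbol h i q p z := by
    rw [Finset.sum_comm]
    refine Finset.sum_congr rfl fun p _ => Finset.sum_congr rfl fun q _ => ?_
    ring
  rw [Finset.sum_add_distrib, Finset.sum_add_distrib, e5] at e4
  rw [e1, e1, dz_dz_comm (L.contDiffAt_two hz L.smooth_potential)]
  linear_combination (-4 : ℂ) * e4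

/-- A Schur lemma: if the holomorphic sectional curvature is pointwise constant and `n ≥ 2`, then
`Φ = tr ∂∂̄f + 2(n + 1)c` satisfies `dΦ = -Φ df`. -/
theorem schur (hn : 2 ≤ n) {c Φ : Model n → ℝ}
    (hc : ∀ y ∈ U, ∀ X : Fin n → ℂ, sesqQuad (hermCurvature h y) X X X X =
      c y * (∑ i, ∑ j, h y i j * X i * star (X j)) ^ 2)
    (hΦ : ∀ y ∈ U, (Φ y : ℂ) = hermLaplacian h f y + 2 * (n + 1) * c y) :
    ContDiffAt ℝ ∞ (fun y => (Φ y : ℂ)) z ∧ ∀ m,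
      dz m (fun y => (Φ y : ℂ)) z = -(Φ z * dz m (fun y => (f y : ℂ)) z) := by
  have hβ (i : Fin n) : ContDiffOn ℝ ∞ (schurForm h f i) U :=
    (contDiffOn_const.mul (ContDiffOn.sum fun p _ => L.contDiffOn_symbol i p p)).add
      (contDiffOn_const.mul (L.contDiffOn_dz L.smooth_potential i))
  have e1 (y) (hy : y ∈ U) (i j : Fin n) : dzbar j (schurForm h f i) y = Φ y * h y i j := by
    rw [L.dzbar_schurForm hy (hc y hy), hΦ y hy]
  -- Smoothness of Φ, and hence of c, is not assumed: it follows by dividing ∂̄β by a diagonal entry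
  -- of the metric.
  have hΦs : ContDiffOn ℝ ∞ (fun y => (Φ y : ℂ)) U := by
    let i : Fin n := ⟨0, by omega⟩
    refine ((L.contDiffOn_dzbar (hβ i) i).mul
      ((L.smooth i i).inv fun y hy => L.diag_ne_zero y hy i)).congr fun y hy => ?_
    simp only [e1 y hy, Pi.inv_apply]
    rw [mul_assoc, mul_inv_cancel₀ (L.diag_ne_zero y hy i), mul_one]
  refine ⟨hΦs.contDiffAt (L.isOpen.mem_nhds hz), ?_⟩
  have hΦd := L.diffAt hz hΦs
  have e2 (m i j : Fin n) : dz m (fun y => (Φ y : ℂ)) z * h z i j +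
      Φ z * dz m (fun y => h y i j) z = dzbar j (dz m (schurForm h f i)) z := by
    rw [← dz_dzbar_comm (L.contDiffAt_two hz (hβ i)), dz_eq m (fun y => h y i j), dz_eq m (fun y =>
      (Φ y : ℂ)), ← wirtinger_mul hΦd (L.diffAt hz (L.smooth i j)), ← dz_eq]
    refine dz_congr ?_
    filter_upwards [L.eventually_mem hz] with y hy
    rw [e1 y hy]
  have e3 (m i j : Fin n) : dzbar j (dz m (schurForm h f i)) z =
      dzbar j (dz i (schurForm h f m)) z := by
    refine dzbar_congr ?_
    filter_upwards [L.eventually_mem hz] with y hy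
    exact L.dz_schurForm_comm hy i m
  -- The torsion identity replaces the derivative of h in ∂_m(Φh_{ij̄}), so A m h_{ij̄} is symmetric
  -- in m and i. Contracting with the inverse metric for some i ≠ m, which exists as n ≥ 2, gives A
  -- m = 0.
  set A : Fin n → ℂ := fun m => dz m (fun y => (Φ y : ℂ)) z +
    Φ z * dz m (fun y => (f y : ℂ)) z with hA
  have e4 (m i j : Fin n) : A m * h z i j = A i * h z m j := by
    have := (e2 m i j).trans ((e3 m i j).trans (e2 i m j).symm)
    simp only [hA]
    linear_combination this - Φ z * L.torsion z hz m i j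
  intro m
  obtain ⟨i, hi⟩ : ∃ i : Fin n, i ≠ m := by
    have : Nontrivial (Fin n) := Fin.nontrivial_iff_two_le.mpr hn
    exact exists_ne m
  have e5 : ∑ j, A m * h z i j * (h z)⁻¹ j i = ∑ j, A i * h z m j * (h z)⁻¹ j i :=
    Finset.sum_congr rfl fun j _ => by rw [e4]
  simp only [mul_assoc, ← Finset.mul_sum, L.sum_mul_inv hz, if_true, if_neg hi.symm, mul_one,
    mul_zero, hA] at e5
  linear_combination e5

/-- The function `Φ e^f` is locally constant. -/
theorem fderiv_schur (hn : 2 ≤ n) {c Φ : Model n → ℝ}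
    (hc : ∀ y ∈ U, ∀ X : Fin n → ℂ, sesqQuad (hermCurvature h y) X X X X =
      c y * (∑ i, ∑ j, h y i j * X i * star (X j)) ^ 2)
    (hΦ : ∀ y ∈ U, (Φ y : ℂ) = hermLaplacian h f y + 2 * (n + 1) * c y) :
    DifferentiableAt ℝ (fun y => Φ y * Real.exp (f y)) z ∧
      fderiv ℝ (fun y => Φ y * Real.exp (f y)) z = 0 := by
  obtain ⟨hs, hd⟩ := L.schur hz hn hc hΦ
  have re_diff {F : Model n → ℝ} (hF : DifferentiableAt ℝ (fun y => (F y : ℂ)) z) :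
      DifferentiableAt ℝ F z := Complex.reCLM.differentiableAt.comp z hF
  have hΦd : DifferentiableAt ℝ Φ z := re_diff (hs.differentiableAt (by simp))
  have hfd : DifferentiableAt ℝ f z := re_diff (L.diffAt hz L.smooth_potential)
  have hof {F : Model n → ℝ} (hF : DifferentiableAt ℝ F z) (u : Model n) :
      fderiv ℝ (fun y => (F y : ℂ)) z u = (fderiv ℝ F z u : ℂ) := by
    have : fderiv ℝ (fun y => (F y : ℂ)) z = Complex.ofRealCLM.comp (fderiv ℝ F z) :=
      (Complex.ofRealCLM.hasFDerivAt.comp z hF.hasFDerivAt).fderiv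
    rw [this]
    rfl
  refine ⟨hΦd.mul hfd.exp, ?_⟩
  have hE : HasFDerivAt (fun y => Φ y * Real.exp (f y)) (Real.exp (f z) •
      (fderiv ℝ Φ z + Φ z • fderiv ℝ f z)) z := by
    refine (hΦd.hasFDerivAt.mul hfd.hasFDerivAt.exp).congr_fderiv ?_
    ext u
    simp
    ring
  rw [hE.fderiv]
  have key : fderiv ℝ Φ z + Φ z • fderiv ℝ f z = 0 := by
    set D := fderiv ℝ Φ z + Φ z • fderiv ℝ f z with hD
    -- D is real, so its (1,0)-part being zero kills its values on both the real and the imaginary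
    -- coordinate direction.
    have hb (m : Fin n) : D (basisVec m) = 0 ∧ D (mulI n (basisVec m)) = 0 := by
      have e := hd m
      simp only [dz, hof hΦd, hof hfd] at e
      have e' : ((D (basisVec m) : ℝ) : ℂ) - Complex.I * (D (mulI n (basisVec m)) : ℝ) = 0 := by
        simp only [hD, _root_.add_apply, _root_.smul_apply, smul_eq_mul]
        push_cast
        linear_combination 2 * e
      have h1 := congrArg Complex.re e'
      have h2 := congrArg Complex.im e'
      simp at h1 h2
      exact ⟨h1, h2⟩
    ext u
    rw [eq_sum_basisVec u, map_sum]
    simp [hb]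
  rw [key, smul_zero]

end LocalLCK

end Schur

/-! ### Hermitian inner products, unitary frames and traces. -/

section Frames

variable {n : ℕ}

theorem basisVec_apply (i j : Fin n) : basisVec i j = if j = i then 1 else 0 := by
  simp only [basisVec, EuclideanSpace.single, PiLp.single_apply]

theorem basisVec_ne_zero (i : Fin n) : (basisVec i : Model n) ≠ 0 := by
  intro h
  have := congrArg (fun v : Model n => v i) h
  simp [basisVec_apply] at this

theorem complex_smul_eq (c : ℂ) (u : Model n) : c • u = c.re • u + c.im • mulI n u := by
  ext j
  simp only [PiLp.add_apply, PiLp.smul_apply, mulI_apply, Complex.real_smul, smul_eq_mul]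
  linear_combination -(u j) * Complex.re_add_im c

theorem eq_sum_smul_basisVec (u : Model n) : u = ∑ i, u i • basisVec i := by
  conv_lhs => rw [eq_sum_basisVec u]
  exact Finset.sum_congr rfl fun i _ => (complex_smul_eq _ _).symm

/-- The part of a real bilinear form on `ℂⁿ` which is complex linear in the first and complex
antilinear in the second argument. -/
def hermExt (B : Model n →L[ℝ] Model n →L[ℝ] ℝ) : Model n →ₗ[ℂ] Model n →ₗ⋆[ℂ] ℂ :=
  LinearMap.mk₂'ₛₗ (RingHom.id ℂ) (starRingEnd ℂ)
    (fun u v => (1 / 4) * ((B u v : ℂ) + (B (mulI n u) (mulI n v) : ℂ)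
      + Complex.I * ((B u (mulI n v) : ℂ) - (B (mulI n u) v : ℂ))))
    (fun u u' v => by simp only [map_add, _root_.add_apply, Complex.ofReal_add]; ring)
    (fun c u v => by
      have hc := Complex.re_add_im c
      simp only [complex_smul_eq c u, map_add, map_smul, _root_.add_apply, _root_.smul_apply,
        mulI_mulI, map_neg, neg_apply, Complex.ofReal_add, Complex.ofReal_mul,
        Complex.ofReal_neg, smul_eq_mul, RingHom.id_apply]
      conv_rhs => rw [← hc]
      linear_combination (1 / 4) * c.im * ((B (mulI n u) v : ℂ) - B u (mulI n v)) * Complex.I_sq)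
    (fun u v v' => by simp only [map_add, Complex.ofReal_add]; ring)
    (fun c u v => by
      have hc : starRingEnd ℂ c = c.re - c.im * Complex.I :=
        Complex.ext (by simp) (by simp)
      simp only [complex_smul_eq c v, map_add, map_smul, mulI_mulI, map_neg, Complex.ofReal_add,
        Complex.ofReal_mul, Complex.ofReal_neg, smul_eq_mul, hc]
      linear_combination (1 / 4) * c.im * ((B u (mulI n v) : ℂ) - B (mulI n u) v) * Complex.I_sq)

theorem hermExt_apply (B : Model n →L[ℝ] Model n →L[ℝ] ℝ) (u v : Model n) :
    hermExt B u v = (1 / 4) * ((B u v : ℂ) + (B (mulI n u) (mulI n v) : ℂ)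
      + Complex.I * ((B u (mulI n v) : ℂ) - (B (mulI n u) v : ℂ))) := rfl

/-- The matrix of `hermExt B` in the standard basis. -/
def hermMatrix (B : Model n →L[ℝ] Model n →L[ℝ] ℝ) : Matrix (Fin n) (Fin n) ℂ := fun i j =>
  hermExt B (basisVec i) (basisVec j)

theorem sum_hermMatrix (B : Model n →L[ℝ] Model n →L[ℝ] ℝ) (u v : Model n) :
    ∑ i, ∑ j, hermMatrix B i j * u i * star (v j) = hermExt B u v := by
  conv_rhs => rw [eq_sum_smul_basisVec u, eq_sum_smul_basisVec v]
  simp only [map_sum, LinearMap.sum_apply, map_smul, LinearMap.smul_apply, LinearMap.map_smulₛₗ,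
    smul_eq_mul, Finset.mul_sum]
  rw [Finset.sum_comm]
  refine Finset.sum_congr rfl fun i _ => Finset.sum_congr rfl fun j _ => ?_
  rw [hermMatrix, starRingEnd_apply]
  ring

/-- A Hermitian inner product on `ℂⁿ`, given by its real part. -/
structure IsHermInner (G : Model n →L[ℝ] Model n →L[ℝ] ℝ) : Prop where
  symm : ∀ u v, G u v = G v u
  map_mulI : ∀ u v, G (mulI n u) (mulI n v) = G u v
  pos : ∀ u, u ≠ 0 → 0 < G u u

namespace IsHermInner

variable {G : Model n →L[ℝ] Model n →L[ℝ] ℝ} (hG : IsHermInner G)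
include hG

theorem mulI_left (u v : Model n) : G (mulI n u) v = -G u (mulI n v) := by
  rw [← hG.map_mulI u, mulI_mulI, map_neg, neg_neg]

theorem apply_mulI_self (u : Model n) : G u (mulI n u) = 0 := by
  have h1 := hG.mulI_left u u
  rw [hG.symm] at h1
  linarith

theorem hermExt_eq (u v : Model n) :
    hermExt G u v = (1 / 2) * ((G u v : ℂ) + Complex.I * (G u (mulI n v) : ℂ)) := by
  rw [hermExt_apply, hG.map_mulI, hG.mulI_left]
  push_cast
  ring

theorem hermExt_self (u : Model n) : hermExt G u u = ((1 / 2 * G u u : ℝ) : ℂ) := by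
  rw [hG.hermExt_eq, hG.apply_mulI_self]
  push_cast
  ring

theorem star_hermMatrix (i j : Fin n) : star (hermMatrix G i j) = hermMatrix G j i := by
  rw [hermMatrix, hermMatrix, hG.hermExt_eq, hG.hermExt_eq, hG.symm (basisVec j) (basisVec i),
    hG.symm (basisVec j), hG.mulI_left]
  simp

open scoped ComplexOrder in
theorem posDef_hermMatrix : (hermMatrix G).PosDef := by
  refine Matrix.PosDef.of_dotProduct_mulVec_pos ?_ fun x hx => ?_
  · ext i j
    rw [Matrix.conjTranspose_apply, hG.star_hermMatrix]
  · have hx' : (WithLp.toLp 2 (star x) : Model n) ≠ 0 := by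
      intro h0
      apply hx
      have := congrArg (fun v : Model n => star (v.ofLp)) h0
      simpa using this
    have e : dotProduct (star x) (Matrix.mulVec (hermMatrix G) x) =
        hermExt G (WithLp.toLp 2 (star x)) (WithLp.toLp 2 (star x)) := by
      rw [← sum_hermMatrix]
      simp only [dotProduct, Matrix.mulVec, Finset.mul_sum, Pi.star_apply, star_star]
      refine Finset.sum_congr rfl fun i _ => Finset.sum_congr rfl fun j _ => ?_
      ring
    rw [e, hG.hermExt_self]
    exact_mod_cast mul_pos one_half_pos (hG.pos _ hx')

theorem isUnit_det_hermMatrix : IsUnit (hermMatrix G).det := by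
  open scoped ComplexOrder in
  exact isUnit_iff_ne_zero.mpr hG.posDef_hermMatrix.det_pos.ne'

theorem hermMatrix_diag_ne_zero (i : Fin n) : hermMatrix G i i ≠ 0 := by
  rw [hermMatrix, hG.hermExt_self]
  exact_mod_cast (mul_pos one_half_pos (hG.pos _ (basisVec_ne_zero i))).ne'

end IsHermInner

/-- `e` is a unitary frame for the Hermitian inner product with real part `G`. -/
structure IsUnitaryFrame (G : Model n →L[ℝ] Model n →L[ℝ] ℝ) (e : Fin n → Model n) : Prop where
  inner_eq : ∀ a b, G (e a) (e b) = if a = b then 1 else 0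
  inner_mulI : ∀ a b, G (e a) (mulI n (e b)) = 0
  inv_hermMatrix : ∀ k l, (hermMatrix G)⁻¹ l k = 2 * ∑ a, star (e a l) * e a k

open scoped ComplexOrder MatrixOrder in
theorem exists_eq_conjTranspose_mul_self {A : Matrix (Fin n) (Fin n) ℂ} (hA : A.PosDef) :
    ∃ B : Matrix (Fin n) (Fin n) ℂ, A = B.conjTranspose * B := by
  obtain ⟨B, hB⟩ := CStarAlgebra.nonneg_iff_eq_star_mul_self.mp hA.posSemidef.nonneg
  exact ⟨B, hB⟩

/-- Factor the inverse matrix as B*B. The rows of B are orthonormal for the Hermitian form, which is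
half the real metric on the diagonal, hence the scaling by 1/√2. -/
theorem IsHermInner.exists_unitaryFrame {G : Model n →L[ℝ] Model n →L[ℝ] ℝ}
    (hG : IsHermInner G) : ∃ e, IsUnitaryFrame G e := by
  obtain ⟨B, hB⟩ : ∃ B : Matrix (Fin n) (Fin n) ℂ, (hermMatrix G)⁻¹ = B.conjTranspose * B := by
    open scoped ComplexOrder in
    exact exists_eq_conjTranspose_mul_self hG.posDef_hermMatrix.inv
  set r : ℂ := (((Real.sqrt 2)⁻¹ : ℝ) : ℂ) with hr
  have hr2 : r * r = 1 / 2 := by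
    rw [hr, ← Complex.ofReal_mul, ← mul_inv, Real.mul_self_sqrt zero_le_two]
    simp
  have hrs : star r = r := Complex.conj_ofReal _
  let e : Fin n → Model n := fun a => WithLp.toLp 2 fun k => r * B a k
  have he (a k : Fin n) : e a k = r * B a k := rfl
  have hone : B * (hermMatrix G * B.conjTranspose) = 1 := by
    rw [mul_eq_one_comm, mul_assoc, ← hB]
    exact Matrix.mul_nonsing_inv _ hG.isUnit_det_hermMatrix
  have hext (a b : Fin n) : hermExt G (e a) (e b) = (1 / 2) * if a = b then 1 else 0 := by
    rw [← Matrix.one_apply, ← hone, ← sum_hermMatrix, ← hr2]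
    simp only [Matrix.mul_apply, Finset.mul_sum, he, star_mul', hrs, Matrix.conjTranspose_apply]
    refine Finset.sum_congr rfl fun i _ => Finset.sum_congr rfl fun j _ => ?_
    ring
  have key (a b : Fin n) : (G (e a) (e b) : ℂ) + Complex.I * (G (e a) (mulI n (e b)) : ℂ) =
      if a = b then 1 else 0 := by
    have := hext a b
    rw [hG.hermExt_eq] at this
    linear_combination 2 * this
  refine ⟨e, fun a b => ?_, fun a b => ?_, fun k l => ?_⟩
  · have := congrArg Complex.re (key a b)
    split_ifs at this ⊢ <;> simpa using this
  · have := congrArg Complex.im (key a b)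
    split_ifs at this <;> simpa using this
  · rw [hB, Matrix.mul_apply, Finset.mul_sum]
    refine Finset.sum_congr rfl fun a _ => ?_
    rw [he, he, star_mul', hrs, Matrix.conjTranspose_apply]
    linear_combination (-2) * star (B a l) * B a k * hr2

namespace IsUnitaryFrame

variable {G : Model n →L[ℝ] Model n →L[ℝ] ℝ} {e : Fin n → Model n} (he : IsUnitaryFrame G e)
include he

theorem trace_eq (B : Model n →L[ℝ] Model n →L[ℝ] ℝ) :
    ∑ k, ∑ l, hermMatrix B k l * (hermMatrix G)⁻¹ l k = 2 * ∑ a, hermExt B (e a) (e a) := by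
  simp only [he.inv_hermMatrix, ← sum_hermMatrix B, Finset.mul_sum]
  rw [Finset.sum_comm]
  conv_rhs => rw [Finset.sum_comm]; enter [2, k]; rw [Finset.sum_comm]
  rw [Finset.sum_comm]
  refine Finset.sum_congr rfl fun k _ => Finset.sum_congr rfl fun l _ =>
    Finset.sum_congr rfl fun a _ => ?_
  ring

theorem trace_re (B : Model n →L[ℝ] Model n →L[ℝ] ℝ) :
    (∑ k, ∑ l, hermMatrix B k l * (hermMatrix G)⁻¹ l k).re =
      1 / 2 * ∑ a, (B (e a) (e a) + B (mulI n (e a)) (mulI n (e a))) := by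
  rw [he.trace_eq, ← Complex.ofReal_ofNat, Complex.re_ofReal_mul, Complex.re_sum, Finset.mul_sum,
    Finset.mul_sum]
  refine Finset.sum_congr rfl fun a _ => ?_
  have : hermExt B (e a) (e a) =
      ((1 / 4 * (B (e a) (e a) + B (mulI n (e a)) (mulI n (e a))) : ℝ) : ℂ)
      + ((1 / 4 * (B (e a) (mulI n (e a)) - B (mulI n (e a)) (e a)) : ℝ) : ℂ) * Complex.I := by
    rw [hermExt_apply]
    push_cast
    ring
  rw [this, Complex.add_re, Complex.ofReal_re, Complex.re_ofReal_mul, Complex.I_re]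
  ring

theorem trace_of_symm {B : Model n →L[ℝ] Model n →L[ℝ] ℝ} (hB : ∀ u v, B u v = B v u) :
    ∑ k, ∑ l, hermMatrix B k l * (hermMatrix G)⁻¹ l k =
      ((1 / 2 * ∑ a, (B (e a) (e a) + B (mulI n (e a)) (mulI n (e a))) : ℝ) : ℂ) := by
  rw [he.trace_eq, Finset.mul_sum, Finset.mul_sum, Complex.ofReal_sum]
  refine Finset.sum_congr rfl fun a _ => ?_
  rw [hermExt_apply, hB (e a) (mulI n (e a))]
  push_cast
  ring

/-- Inserting h h⁻¹ = 1 and the frame expression of h⁻¹ gives the coefficients as Hermitian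
products; their real and imaginary parts are the two real coefficients. -/
theorem eq_sum (hG : IsHermInner G) (x : Model n) :
    x = ∑ a, (G x (e a) • e a + G x (mulI n (e a)) • mulI n (e a)) := by
  have h1 (k : Fin n) : x k = ∑ l, (∑ j, x j * hermMatrix G j l) * (hermMatrix G)⁻¹ l k := by
    have : x k = ∑ j, x j * (hermMatrix G * (hermMatrix G)⁻¹) j k := by
      rw [Matrix.mul_nonsing_inv _ hG.isUnit_det_hermMatrix]
      simp [Matrix.one_apply]
    rw [this]
    simp only [Matrix.mul_apply, Finset.mul_sum, Finset.sum_mul]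
    rw [Finset.sum_comm]
    refine Finset.sum_congr rfl fun l _ => Finset.sum_congr rfl fun j _ => ?_
    ring
  ext k
  rw [h1 k]
  simp only [he.inv_hermMatrix, WithLp.ofLp_sum, Finset.sum_apply]
  have h2 (a : Fin n) : (G x (e a) • e a + G x (mulI n (e a)) • mulI n (e a)) k =
      2 * hermExt G x (e a) * e a k := by
    rw [hG.hermExt_eq]
    simp only [PiLp.add_apply, PiLp.smul_apply, mulI_apply, Complex.real_smul]
    ring
  simp only [h2, ← sum_hermMatrix, Finset.mul_sum, Finset.sum_mul]
  conv_rhs => rw [Finset.sum_comm]; enter [2, j]; rw [Finset.sum_comm]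
  rw [Finset.sum_comm]
  conv_lhs => enter [2, a]; rw [Finset.sum_comm]
  rw [Finset.sum_comm]
  conv_lhs => enter [2, a]; rw [Finset.sum_comm]
  refine Finset.sum_congr rfl fun k _ => Finset.sum_congr rfl fun l _ =>
    Finset.sum_congr rfl fun a _ => ?_
  ring

/-- The Riesz representation of covectors. -/
theorem exists_dual (hG : IsHermInner G) (ℓ : Model n →L[ℝ] ℝ) : ∃ ξ, ∀ w, G ξ w = ℓ w := by
  refine ⟨∑ a, (ℓ (e a) • e a + ℓ (mulI n (e a)) • mulI n (e a)), fun w => ?_⟩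
  conv_rhs => rw [he.eq_sum hG w]
  rw [map_sum, map_sum, _root_.sum_apply]
  refine Finset.sum_congr rfl fun a _ => ?_
  simp only [map_add, map_smul, _root_.add_apply, _root_.smul_apply, smul_eq_mul]
  rw [hG.symm w, hG.symm w]
  ring

/-- Parseval's identity for the covector dual to `ξ`. -/
theorem sum_sq (hG : IsHermInner G) (ξ : Model n) :
    ∑ a, (G ξ (e a) ^ 2 + G ξ (mulI n (e a)) ^ 2) = G ξ ξ := by
  conv_rhs => rw [he.eq_sum hG ξ]
  rw [hG.symm, map_sum]
  conv_rhs => enter [2, a]; rw [← he.eq_sum hG ξ]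
  refine Finset.sum_congr rfl fun a _ => ?_
  rw [map_add, map_smul, map_smul, smul_eq_mul, smul_eq_mul]
  ring

end IsUnitaryFrame

/-- The trace of the `(1, 1)`-part of a bilinear form against `w`. -/
def traceOp (w : Matrix (Fin n) (Fin n) ℂ) : (Model n →L[ℝ] Model n →L[ℝ] ℝ) →L[ℝ] ℝ :=
  let ev (u v : Model n) : (Model n →L[ℝ] Model n →L[ℝ] ℝ) →L[ℝ] ℝ :=
    (ContinuousLinearMap.apply ℝ ℝ v).comp (ContinuousLinearMap.apply ℝ (Model n →L[ℝ] ℝ) u)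
  ∑ k, ∑ l, ((w l k).re • (1 / 4 : ℝ) • (ev (basisVec k) (basisVec l) +
      ev (mulI n (basisVec k)) (mulI n (basisVec l))) -
    (w l k).im • (1 / 4 : ℝ) • (ev (basisVec k) (mulI n (basisVec l)) -
      ev (mulI n (basisVec k)) (basisVec l)))

theorem traceOp_apply (w : Matrix (Fin n) (Fin n) ℂ) (B : Model n →L[ℝ] Model n →L[ℝ] ℝ) :
    traceOp w B = (∑ k, ∑ l, hermMatrix B k l * w l k).re := by
  simp only [traceOp, _root_.sum_apply, Complex.re_sum]
  refine Finset.sum_congr rfl fun k _ => Finset.sum_congr rfl fun l _ => ?_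
  rw [hermMatrix, hermExt_apply]
  simp [Complex.mul_re]
  ring

theorem continuousOn_traceOp {X : Type*} [TopologicalSpace X] {s : Set X}
    {w : X → Matrix (Fin n) (Fin n) ℂ} (hw : ∀ i j, ContinuousOn (fun x => w x i j) s) :
    ContinuousOn (fun x => traceOp (w x)) s := by
  unfold traceOp
  refine continuousOn_finsetSum _ fun k _ => continuousOn_finsetSum _ fun l _ => ?_
  exact ((Complex.continuous_re.comp_continuousOn (hw l k)).smul continuousOn_const).sub
    ((Complex.continuous_im.comp_continuousOn (hw l k)).smul continuousOn_const)

theorem fderiv_fderiv_clm_comp {E F F' : Type*} [NormedAddCommGroup E] [NormedSpace ℝ E]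
    [NormedAddCommGroup F] [NormedSpace ℝ F] [NormedAddCommGroup F'] [NormedSpace ℝ F']
    (L : F →L[ℝ] F') {f : E → F} {z : E} (hf : ContDiffAt ℝ 2 f z) (u v : E) :
    fderiv ℝ (fderiv ℝ fun y => L (f y)) z u v = L (fderiv ℝ (fderiv ℝ f) z u v) := by
  have hD : fderiv ℝ (fun y => L (f y)) =ᶠ[nhds z] fun y => L.comp (fderiv ℝ f y) := by
    filter_upwards [hf.eventually (by simp)] with y hy
    exact (L.hasFDerivAt.comp y (hy.differentiableAt (by simp)).hasFDerivAt).fderiv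
  have hd : DifferentiableAt ℝ (fderiv ℝ f) z :=
    (hf.fderiv_right (m := 1) (by norm_num)).differentiableAt (by simp)
  rw [hD.fderiv_eq]
  have := ((ContinuousLinearMap.compL ℝ E F F' L).hasFDerivAt.comp z hd.hasFDerivAt).fderiv
  have e : (fun y => L.comp (fderiv ℝ f y)) =
    (ContinuousLinearMap.compL ℝ E F F' L) ∘ fderiv ℝ f := rfl
  rw [e, this]
  rfl

theorem fderiv_fderiv_exp_const_mul {E : Type*} [NormedAddCommGroup E] [NormedSpace ℝ E]
    {f : E → ℝ} {z : E} (hf : ContDiffAt ℝ 2 f z) (r : ℝ) (u v : E) :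
    fderiv ℝ (fderiv ℝ fun y => Real.exp (r * f y)) z u v = Real.exp (r * f z) *
      (r ^ 2 * fderiv ℝ f z u * fderiv ℝ f z v + r * fderiv ℝ (fderiv ℝ f) z u v) := by
  have h1 {y : E} (hy : ContDiffAt ℝ 2 f y) : HasFDerivAt (fun y => Real.exp (r * f y))
      (Real.exp (r * f y) • r • fderiv ℝ f y) y :=
    ((hy.differentiableAt (by simp)).hasFDerivAt.const_mul r).exp
  have hD : fderiv ℝ (fun y => Real.exp (r * f y)) =ᶠ[nhds z]
      fun y => Real.exp (r * f y) • r • fderiv ℝ f y := by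
    filter_upwards [hf.eventually (by simp)] with y hy
    exact (h1 hy).fderiv
  have hd : DifferentiableAt ℝ (fderiv ℝ f) z :=
    (hf.fderiv_right (m := 1) (by norm_num)).differentiableAt (by simp)
  have h2 : HasFDerivAt (fun y => Real.exp (r * f y) • r • fderiv ℝ f y) _ z :=
    (h1 hf).smul (hd.hasFDerivAt.const_smul r)
  rw [hD.fderiv_eq, h2.fderiv]
  simp only [_root_.add_apply, _root_.smul_apply, ContinuousLinearMap.smulRight_apply, smul_eq_mul]
  ring

theorem dzbar_dz_ofReal {f : Model n → ℝ} {z : Model n} (hf : ContDiffAt ℝ 2 f z) (k l : Fin n) :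
    dzbar l (dz k fun y => (f y : ℂ)) z = hermMatrix (fderiv ℝ (fderiv ℝ f) z) k l := by
  have hF : ContDiffAt ℝ 2 (fun y => (f y : ℂ)) z := Complex.ofRealCLM.contDiff.contDiffAt.comp z hf
  have hD2 (u v : Model n) : fderiv ℝ (fderiv ℝ fun y => (f y : ℂ)) z u v =
      (fderiv ℝ (fderiv ℝ f) z u v : ℂ) := fderiv_fderiv_clm_comp Complex.ofRealCLM hf u v
  have hs := hf.isSymmSndFDerivAt (by simp)
  rw [dzbar_eq, funext (dz_eq k fun y => (f y : ℂ)), wirtinger_wirtinger_apply hF]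
  simp only [hD2]
  rw [hermMatrix, hermExt_apply, hs.eq (basisVec l), hs.eq (basisVec l),
    hs.eq (mulI n (basisVec l)), hs.eq (mulI n (basisVec l))]
  linear_combination (-1 / 4 * (fderiv ℝ (fderiv ℝ f) z (mulI n (basisVec k)) (mulI n (basisVec l)))
    : ℂ) * Complex.I_sq

theorem IsUnitaryFrame.hermLaplacian_eq {h : Model n → Matrix (Fin n) (Fin n) ℂ}
    {G : Model n →L[ℝ] Model n →L[ℝ] ℝ} {e : Fin n → Model n} (he : IsUnitaryFrame G e)
    {f : Model n → ℝ} {z : Model n} (hf : ContDiffAt ℝ 2 f z) (hz : h z = hermMatrix G) :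
    hermLaplacian h f z = ((1 / 2 * ∑ a, (fderiv ℝ (fderiv ℝ f) z (e a) (e a) +
      fderiv ℝ (fderiv ℝ f) z (mulI n (e a)) (mulI n (e a))) : ℝ) : ℂ) := by
  rw [← he.trace_of_symm (fun u v => (hf.isSymmSndFDerivAt (by simp)).eq u v), hermLaplacian, hz]
  simp only [dzbar_dz_ofReal hf]

end Frames

/-! ### Locally conformally Kähler metrics on open sets of ℂⁿ, and the parallel case. -/

section LocalConformal

variable {n : ℕ}

/-- A smooth Hermitian inner product `G` on an open set of `ℂⁿ` whose fundamental form `Ω`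
satisfies `dΩ = df ∧ Ω`. -/
structure LocalConformal (U : Set (Model n)) (G : Model n → Model n →L[ℝ] Model n →L[ℝ] ℝ)
    (f : Model n → ℝ) : Prop where
  isOpen : IsOpen U
  smooth : ContDiffOn ℝ ∞ G U
  herm : ∀ z ∈ U, IsHermInner (G z)
  smooth_potential : ContDiffOn ℝ ∞ f U
  cyclic : ∀ z ∈ U, ∀ u v w,
    fderiv ℝ G z u (mulI n v) w + fderiv ℝ G z v (mulI n w) u + fderiv ℝ G z w (mulI n u) v =
      fderiv ℝ f z u * G z (mulI n v) w + fderiv ℝ f z v * G z (mulI n w) u +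
        fderiv ℝ f z w * G z (mulI n u) v

/-- The derivative of `e^{-f} G`, up to the factor `e^{-f}`. -/
def twistedDeriv (G : Model n → Model n →L[ℝ] Model n →L[ℝ] ℝ) (f : Model n → ℝ) (z : Model n) :
    Model n →L[ℝ] Model n →L[ℝ] Model n →L[ℝ] ℝ :=
  fderiv ℝ G z - (fderiv ℝ f z).smulRight (G z)

theorem twistedDeriv_apply (G : Model n → Model n →L[ℝ] Model n →L[ℝ] ℝ) (f : Model n → ℝ)
    (z u v w : Model n) :
    twistedDeriv G f z u v w = fderiv ℝ G z u v w - fderiv ℝ f z u * G z v w := rfl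

namespace LocalConformal

variable {U : Set (Model n)} {G : Model n → Model n →L[ℝ] Model n →L[ℝ] ℝ} {f : Model n → ℝ}
  (L : LocalConformal U G f) {z : Model n} (hz : z ∈ U)
include L hz

theorem mem_nhds : U ∈ nhds z := L.isOpen.mem_nhds hz

theorem hasFDerivAt : HasFDerivAt G (fderiv ℝ G z) z :=
  ((L.smooth.contDiffAt (L.mem_nhds hz)).differentiableAt (by simp)).hasFDerivAt

theorem hasFDerivAt_potential : HasFDerivAt f (fderiv ℝ f z) z :=
  ((L.smooth_potential.contDiffAt (L.mem_nhds hz)).differentiableAt (by simp)).hasFDerivAt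

theorem contDiffAt_potential : ContDiffAt ℝ 2 f z :=
  (L.smooth_potential.contDiffAt (L.mem_nhds hz)).of_le ENat.LEInfty.out

theorem hasFDerivAt_apply (u v : Model n) :
    HasFDerivAt (fun y => G y u v) (((fderiv ℝ G z).flip u).flip v) z := by
  have := ((L.hasFDerivAt hz).clm_apply (hasFDerivAt_const u z)).clm_apply (hasFDerivAt_const v z)
  refine this.congr_fderiv ?_
  ext w
  simp

theorem fderiv_apply (u v w : Model n) : fderiv ℝ (fun y => G y v w) z u = fderiv ℝ G z u v w := by
  rw [(L.hasFDerivAt_apply hz v w).fderiv]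
  rfl

theorem fderiv_symm (u v w : Model n) : fderiv ℝ G z u v w = fderiv ℝ G z u w v := by
  rw [← L.fderiv_apply hz, ← L.fderiv_apply hz]
  congr 1
  refine Filter.EventuallyEq.fderiv_eq ?_
  filter_upwards [L.mem_nhds hz] with y hy
  exact (L.herm y hy).symm v w

theorem fderiv_mulI (u v w : Model n) :
    fderiv ℝ G z u (mulI n v) (mulI n w) = fderiv ℝ G z u v w := by
  rw [← L.fderiv_apply hz, ← L.fderiv_apply hz]
  congr 1
  refine Filter.EventuallyEq.fderiv_eq ?_
  filter_upwards [L.mem_nhds hz] with y hy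
  exact (L.herm y hy).map_mulI v w

theorem twistedDeriv_symm (u v w : Model n) :
    twistedDeriv G f z u v w = twistedDeriv G f z u w v := by
  rw [twistedDeriv_apply, twistedDeriv_apply, L.fderiv_symm hz, (L.herm z hz).symm]

theorem twistedDeriv_mulI (u v w : Model n) :
    twistedDeriv G f z u (mulI n v) (mulI n w) = twistedDeriv G f z u v w := by
  rw [twistedDeriv_apply, twistedDeriv_apply, L.fderiv_mulI hz, (L.herm z hz).map_mulI]

theorem twistedDeriv_mulI_left (u v w : Model n) :
    twistedDeriv G f z u (mulI n v) w = -twistedDeriv G f z u v (mulI n w) := by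
  rw [← L.twistedDeriv_mulI hz u (mulI n v), mulI_mulI, map_neg, neg_apply]

/-- Closedness of e^{-f}Ω, written without the exponential factor. -/
theorem twistedDeriv_cyclic (u v w : Model n) : twistedDeriv G f z u (mulI n v) w +
    twistedDeriv G f z v (mulI n w) u + twistedDeriv G f z w (mulI n u) v = 0 := by
  simp only [twistedDeriv_apply]
  linear_combination L.cyclic z hz u v w

theorem hermExt_twistedDeriv (u v w : Model n) : hermExt (twistedDeriv G f z u) v w =
    (1 / 2) * ((twistedDeriv G f z u v w : ℂ) +
      Complex.I * (twistedDeriv G f z u v (mulI n w) : ℂ)) := by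
  rw [hermExt_apply, L.twistedDeriv_mulI hz, L.twistedDeriv_mulI_left hz]
  push_cast
  ring

theorem dz_hermExt (i : Fin n) (v w : Model n) :
    dz i (fun y => hermExt (G y) v w) z - dz i (fun y => (f y : ℂ)) z * hermExt (G z) v w =
      (1 / 2) * (hermExt (twistedDeriv G f z (basisVec i)) v w -
        Complex.I * hermExt (twistedDeriv G f z (mulI n (basisVec i))) v w) := by
  have hG : HasFDerivAt (fun y => hermExt (G y) v w) ((1 / 4 : ℂ) •
      ((Complex.ofRealCLM.comp (((fderiv ℝ G z).flip v).flip w) +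
        Complex.ofRealCLM.comp (((fderiv ℝ G z).flip (mulI n v)).flip (mulI n w))) +
      Complex.I • (Complex.ofRealCLM.comp (((fderiv ℝ G z).flip v).flip (mulI n w)) -
        Complex.ofRealCLM.comp (((fderiv ℝ G z).flip (mulI n v)).flip w)))) z := by
    have h (a b : Model n) := Complex.ofRealCLM.hasFDerivAt.comp z (L.hasFDerivAt_apply hz a b)
    exact (((h v w).add (h (mulI n v) (mulI n w))).add
      (((h v (mulI n w)).sub (h (mulI n v) w)).const_smul Complex.I)).const_smul (1 / 4 : ℂ)
  have hf : HasFDerivAt (fun y => (f y : ℂ)) (Complex.ofRealCLM.comp (fderiv ℝ f z)) z :=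
    Complex.ofRealCLM.hasFDerivAt.comp z (L.hasFDerivAt_potential hz)
  have e (u : Model n) : ((1 / 4 : ℂ) •
      ((Complex.ofRealCLM.comp (((fderiv ℝ G z).flip v).flip w) +
        Complex.ofRealCLM.comp (((fderiv ℝ G z).flip (mulI n v)).flip (mulI n w))) +
      Complex.I • (Complex.ofRealCLM.comp (((fderiv ℝ G z).flip v).flip (mulI n w)) -
        Complex.ofRealCLM.comp (((fderiv ℝ G z).flip (mulI n v)).flip w)))) u -
      fderiv ℝ f z u * hermExt (G z) v w = hermExt (twistedDeriv G f z u) v w := by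
    rw [hermExt_apply, hermExt_apply]
    simp only [twistedDeriv_apply, _root_.smul_apply, _root_.add_apply, _root_.sub_apply,
      ContinuousLinearMap.comp_apply, ContinuousLinearMap.flip_apply, Complex.ofRealCLM_apply,
      smul_eq_mul, Complex.ofReal_sub, Complex.ofReal_mul]
    ring
  rw [← e, ← e, dz, dz, hG.fderiv, hf.fderiv]
  simp only [ContinuousLinearMap.comp_apply, Complex.ofRealCLM_apply]
  ring

omit hz in
-- The torsion condition is the closedness of the (1,1)-form e^{-f}Ω. Its real and imaginary parts
-- follow from the cyclic identity at suitable vectors a, b, Ja, Jb together with J-invariance.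
theorem toLocalLCK : LocalLCK U (fun z => hermMatrix (G z)) f where
  isOpen := L.isOpen
  smooth i j := by
    have h (a b : Model n) : ContDiffOn ℝ ∞ (fun y => (G y a b : ℂ)) U :=
      Complex.ofRealCLM.contDiff.comp_contDiffOn
        ((L.smooth.clm_apply contDiffOn_const).clm_apply contDiffOn_const)
    exact contDiffOn_const.mul (((h _ _).add (h _ _)).add
      (contDiffOn_const.mul ((h _ _).sub (h _ _))))
  star_apply z hz i j := (L.herm z hz).star_hermMatrix i j
  isUnit_det z hz := (L.herm z hz).isUnit_det_hermMatrix
  diag_ne_zero z hz i := (L.herm z hz).hermMatrix_diag_ne_zero i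
  smooth_potential := Complex.ofRealCLM.contDiff.comp_contDiffOn L.smooth_potential
  torsion z hz i j l := by
    have h1 := L.dz_hermExt hz i (basisVec j) (basisVec l)
    have h2 := L.dz_hermExt hz j (basisVec i) (basisVec l)
    refine h1.trans (Eq.trans ?_ h2.symm)
    simp only [L.hermExt_twistedDeriv hz]
    set T := twistedDeriv G f z
    set a : Model n := basisVec i
    set b : Model n := basisVec j
    set x : Model n := basisVec l
    have hre : T a b x + T (mulI n a) b (mulI n x) = T b a x + T (mulI n b) a (mulI n x) := by
      have c1 := L.twistedDeriv_cyclic hz (mulI n a) b x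
      have c2 := L.twistedDeriv_cyclic hz (mulI n b) a x
      rw [mulI_mulI, map_neg, neg_apply, L.twistedDeriv_mulI hz,
        L.twistedDeriv_mulI_left hz] at c1 c2
      have s1 := L.twistedDeriv_symm hz b x a
      have s2 := L.twistedDeriv_symm hz a x b
      have s3 := L.twistedDeriv_symm hz x a b
      linarith
    have him : T a b (mulI n x) - T (mulI n a) b x = T b a (mulI n x) - T (mulI n b) a x := by
      have c1 := L.twistedDeriv_cyclic hz a b x
      have c2 := L.twistedDeriv_cyclic hz (mulI n a) (mulI n b) x
      rw [mulI_mulI, mulI_mulI, map_neg, map_neg, neg_apply, neg_apply,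
        L.twistedDeriv_mulI hz] at c2
      have s1 := L.twistedDeriv_mulI_left hz a b x
      have s2 := L.twistedDeriv_symm hz b (mulI n x) a
      have s3 := L.twistedDeriv_symm hz (mulI n b) x a
      have s4 := L.twistedDeriv_mulI_left hz x a b
      linarith
    have hre' : (T a b x : ℂ) + T (mulI n a) b (mulI n x) =
        T b a x + T (mulI n b) a (mulI n x) := by
      exact_mod_cast hre
    have him' : (T a b (mulI n x) : ℂ) - T (mulI n a) b x =
        T b a (mulI n x) - T (mulI n b) a x := by
      exact_mod_cast him
    linear_combination (1 / 4) * hre' + (1 / 4) * Complex.I * him' -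
      (1 / 4) * ((T (mulI n a) b (mulI n x) : ℂ) - T (mulI n b) a (mulI n x)) * Complex.I_sq

/-- For a parallel Lee form the trace of the complex Hessian of the potential is determined by the
norm of the Lee form. -/
theorem sum_hessian_of_parallel {e : Fin n → Model n} (he : IsUnitaryFrame (G z) e) {ξ : Model n}
    (hξ : ∀ w, G z ξ w = fderiv ℝ f z w)
    (hpar : ∀ u v Γ, (∀ w, 2 * G z Γ w =
      fderiv ℝ G z u v w + fderiv ℝ G z v u w - fderiv ℝ G z w u v) →
      fderiv ℝ (fderiv ℝ f) z u v = fderiv ℝ f z Γ) :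
    ∑ a, (fderiv ℝ (fderiv ℝ f) z (e a) (e a) +
      fderiv ℝ (fderiv ℝ f) z (mulI n (e a)) (mulI n (e a))) = -((n : ℝ) - 1) * G z ξ ξ := by
  have hG := L.herm z hz
  -- Koszul's formula tested against the Lee vector ξ, since df(Γ) = G(Γ, ξ).
  have hess (u : Model n) : 2 * fderiv ℝ (fderiv ℝ f) z u u =
      2 * fderiv ℝ G z u u ξ - fderiv ℝ G z ξ u u := by
    obtain ⟨Γ, hΓ⟩ := he.exists_dual hG ((1 / 2 : ℝ) • (fderiv ℝ G z u u + fderiv ℝ G z u u -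
      ((fderiv ℝ G z).flip u).flip u))
    have hΓ' (w : Model n) : 2 * G z Γ w =
        fderiv ℝ G z u u w + fderiv ℝ G z u u w - fderiv ℝ G z w u u := by
      rw [hΓ]
      simp only [_root_.smul_apply, _root_.add_apply, _root_.sub_apply,
        ContinuousLinearMap.flip_apply, smul_eq_mul]
      ring
    rw [hpar u u Γ hΓ', ← hξ, hG.symm, hΓ']
    ring
  have key (u : Model n) : fderiv ℝ (fderiv ℝ f) z u u +
      fderiv ℝ (fderiv ℝ f) z (mulI n u) (mulI n u) =
      G z ξ u ^ 2 + G z ξ (mulI n u) ^ 2 - G z ξ ξ * G z u u := by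
    have h1 := hess u
    have h2 := hess (mulI n u)
    -- The derivatives of G in the Hessians at u and Ju combine to those in dΩ(u, Ju, ξ), which dΩ =
    -- df ∧ Ω expresses without derivatives.
    have c := L.cyclic z hz u (mulI n u) ξ
    rw [mulI_mulI, map_neg, map_neg, neg_apply, neg_apply, ← hξ, ← hξ, ← hξ, hG.map_mulI,
      L.fderiv_mulI hz, hG.mulI_left ξ u, hG.symm u ξ,
      L.fderiv_symm hz (mulI n u) (mulI n ξ) u] at c
    rw [L.fderiv_mulI hz] at h2
    have s := L.fderiv_mulI hz (mulI n u) u (mulI n ξ)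
    rw [mulI_mulI, map_neg] at s
    linarith
  simp only [key]
  -- Parseval gives |ξ|² for the squares, and the n unit vectors give n|ξ|² for the last term.
  rw [Finset.sum_sub_distrib, he.sum_sq hG, ← Finset.mul_sum]
  simp [he.inner_eq]
  ring

end LocalConformal

end LocalConformal

/-! ### The Gauduchon condition in a local potential. -/

section LocalGauduchon

open ContinuousAlternatingMap

variable {n m : ℕ}

theorem bilinPow_smul {E : Type*} [NormedAddCommGroup E] [NormedSpace ℝ E] (c : ℂ)
    (B : E →L[ℝ] E →L[ℝ] ℂ) (m : ℕ) : bilinPow (c • B) m = c ^ m • bilinPow B m := by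
  induction m with
  | zero => rw [pow_zero, one_smul]; rfl
  | succ m ih =>
    rw [bilinPow_succ, ih, bilinWedge_smul_left, bilinWedge_smul_right, smul_smul, ← pow_succ]
    rfl

variable (n) in
/-- The bilinear form `(u, v) ↦ B(J u, v)` with complex values. -/
def toOmega : (Model n →L[ℝ] Model n →L[ℝ] ℝ) →L[ℝ] (Model n →L[ℝ] Model n →L[ℝ] ℂ) :=
  (ContinuousLinearMap.compL ℝ (Model n) (Model n →L[ℝ] ℝ) (Model n →L[ℝ] ℂ)
    (ContinuousLinearMap.compL ℝ (Model n) ℝ ℂ Complex.ofRealCLM)).comp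
  ((ContinuousLinearMap.compL ℝ (Model n) (Model n) (Model n →L[ℝ] ℝ)).flip (mulI n))

theorem toOmega_apply (B : Model n →L[ℝ] Model n →L[ℝ] ℝ) (u v : Model n) :
    toOmega n B u v = (B (mulI n u) v : ℂ) := rfl

theorem sum_div_two (q : ℕ → ℂ) (m : ℕ) :
    ∑ i : Fin (2 * m + 2), q ((i : ℕ) / 2) = 2 * ∑ a : Fin (m + 1), q a := by
  rw [Fin.sum_univ_eq_sum_range (fun i => q (i / 2)), Fin.sum_univ_eq_sum_range q]
  have h (k : ℕ) : ∑ i ∈ Finset.range (2 * k), q (i / 2) = 2 * ∑ a ∈ Finset.range k, q a := by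
    induction k with
    | zero => simp
    | succ k ih =>
      rw [mul_add, mul_one, Finset.sum_range_succ, Finset.sum_range_succ, ih,
        Finset.sum_range_succ, show (2 * k + 1) / 2 = k by omega, show 2 * k / 2 = k by omega]
      ring
  exact h (m + 1)

/-- The family `e₀, J e₀, e₁, J e₁, …`. -/
def realFrame (e : Fin (m + 1) → Model n) (i : Fin (2 * m + 2)) : Model n :=
  if i.val % 2 = 0 then e ⟨i / 2, by omega⟩ else mulI n (e ⟨i / 2, by omega⟩)

theorem isSymplecticFamily_realFrame {G : Model (m + 1) →L[ℝ] Model (m + 1) →L[ℝ] ℝ}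
    (hG : IsHermInner G) {e : Fin (m + 1) → Model (m + 1)} (he : IsUnitaryFrame G e) (r : ℝ) :
    IsSymplecticFamily (toOmega (m + 1) (r • G)) r (realFrame e) := by
  intro i j
  have h1 (a b : Fin (m + 1)) : G (mulI _ (e a)) (e b) = 0 := by
    rw [hG.mulI_left, he.inner_mulI, neg_zero]
  rw [toOmega_apply, _root_.smul_apply, _root_.smul_apply, smul_eq_mul, Complex.ofReal_mul]
  congr 1
  unfold realFrame stdSymplectic
  by_cases hi : i.val % 2 = 0 <;> by_cases hj : j.val % 2 = 0
  · rw [if_pos hi, if_pos hj, h1, if_neg (by omega), if_neg (by omega)]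
    simp
  · rw [if_pos hi, if_neg hj, hG.map_mulI, he.inner_eq,
      if_neg (by omega : ¬ (i.val = j.val + 1 ∧ _))]
    simp only [Fin.mk.injEq]
    have : (i : ℕ) / 2 = j / 2 ↔ (j : ℕ) = i + 1 ∧ (i : ℕ) % 2 = 0 := by omega
    simp only [this]
    split_ifs <;> simp
  · rw [if_neg hi, if_pos hj, mulI_mulI, map_neg, _root_.neg_apply, he.inner_eq,
      if_neg (by omega : ¬ (j.val = i.val + 1 ∧ _))]
    simp only [Fin.mk.injEq]
    have : (i : ℕ) / 2 = j / 2 ↔ (i : ℕ) = j + 1 ∧ (j : ℕ) % 2 = 0 := by omega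
    simp only [this]
    split_ifs <;> simp
  · rw [if_neg hi, if_neg hj, mulI_mulI, map_neg, _root_.neg_apply, he.inner_mulI,
      if_neg (by omega), if_neg (by omega)]
    simp

theorem wirtinger_del_delbar_apply {φ : Model n → ℂ} {z : Model n} (hφ : ContDiffAt ℝ 2 φ z)
    (u v : Model n) : wirtinger (-Complex.I) (wirtinger Complex.I φ) z u v = (1 / 4 : ℂ) *
      (fderiv ℝ (fderiv ℝ φ) z u v + Complex.I * fderiv ℝ (fderiv ℝ φ) z u (mulI n v) -
      Complex.I * fderiv ℝ (fderiv ℝ φ) z (mulI n u) v +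
      fderiv ℝ (fderiv ℝ φ) z (mulI n u) (mulI n v)) := by
  have hd : DifferentiableAt ℝ (wirtinger Complex.I φ) z :=
    (ContDiffAt.wirtinger (r' := 1) hφ (by norm_num)).differentiableAt (by simp)
  have h (w : Model n) : fderiv ℝ (fun y => wirtinger Complex.I φ y v) z w =
      fderiv ℝ (wirtinger Complex.I φ) z w v := by
    have := (hd.hasFDerivAt.clm_apply (hasFDerivAt_const v z)).fderiv
    rw [this]
    simp
  have e : wirtinger (-Complex.I) (wirtinger Complex.I φ) z u v =
      wirtinger (-Complex.I) (fun y => wirtinger Complex.I φ y v) z u := by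
    rw [wirtinger_apply, wirtinger_apply, h, h]
    rfl
  rw [e, wirtinger_wirtinger_apply hφ]
  linear_combination (-1 / 4) * fderiv ℝ (fderiv ℝ φ) z (mulI n u) (mulI n v) * Complex.I_sq

/-- Partners are of the form x, Jx, and on them ∂∂̄φ is ∓(i/4)(D(x,x) + D(Jx,Jx)) according to their
order. The alternating sign makes both orders add up, so the trace of the Hessian appears. -/
theorem alternating_sum_realFrame {φ : Model n → ℂ} {z : Model n} (hφ : ContDiffAt ℝ 2 φ z)
    (e : Fin (m + 1) → Model n) :
    ∑ i : Fin (2 * m + 2), (-1 : ℤ) ^ (i : ℕ) •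
      wirtinger (-Complex.I) (wirtinger Complex.I φ) z (realFrame e i) (realFrame e (partner i)) =
    -(Complex.I / 2) * ∑ a, (fderiv ℝ (fderiv ℝ φ) z (e a) (e a) +
      fderiv ℝ (fderiv ℝ φ) z (mulI n (e a)) (mulI n (e a))) := by
  have hs := hφ.isSymmSndFDerivAt (by simp)
  set D := fderiv ℝ (fderiv ℝ φ) z
  let q : ℕ → ℂ := fun k => if h : k < m + 1 then
    D (e ⟨k, h⟩) (e ⟨k, h⟩) + D (mulI n (e ⟨k, h⟩)) (mulI n (e ⟨k, h⟩)) else 0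
  have hq (a : Fin (m + 1)) : q a = D (e a) (e a) + D (mulI n (e a)) (mulI n (e a)) :=
    dif_pos a.2
  have h1 (x : Model n) : wirtinger (-Complex.I) (wirtinger Complex.I φ) z x (mulI n x) =
      -(Complex.I / 4) * (D x x + D (mulI n x) (mulI n x)) := by
    rw [wirtinger_del_delbar_apply hφ, mulI_mulI, map_neg, map_neg, hs.eq (mulI n x) x]
    change (1 / 4 : ℂ) * (D _ _ + Complex.I * -D _ _ - Complex.I * D _ _ + -D _ _) = _
    ring
  have h2 (x : Model n) : wirtinger (-Complex.I) (wirtinger Complex.I φ) z (mulI n x) x =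
      (Complex.I / 4) * (D x x + D (mulI n x) (mulI n x)) := by
    rw [wirtinger_del_delbar_apply hφ, mulI_mulI, map_neg, _root_.neg_apply, _root_.neg_apply,
      hs.eq (mulI n x) x]
    change (1 / 4 : ℂ) * (D _ _ + Complex.I * D _ _ - Complex.I * -D _ _ + -D _ _) = _
    ring
  have h3 (i : Fin (2 * m + 2)) : (-1 : ℤ) ^ (i : ℕ) •
      wirtinger (-Complex.I) (wirtinger Complex.I φ) z (realFrame e i) (realFrame e (partner i)) =
      -(Complex.I / 4) * q ((i : ℕ) / 2) := by
    have hlt : (i : ℕ) / 2 < m + 1 := by omega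
    have hqi : q ((i : ℕ) / 2) = D (e ⟨i / 2, hlt⟩) (e ⟨i / 2, hlt⟩) +
      D (mulI n (e ⟨i / 2, hlt⟩)) (mulI n (e ⟨i / 2, hlt⟩)) := hq ⟨i / 2, hlt⟩
    rw [hqi]
    rcases partner_val i with ⟨hi, hp⟩ | ⟨hi, hp⟩
    · have e1 : realFrame e i = e ⟨i / 2, hlt⟩ := if_pos hi
      have e2 : realFrame e (partner i) = mulI n (e ⟨i / 2, hlt⟩) := by
        rw [realFrame, if_neg (by omega)]
        congr 2
        exact Fin.ext (by simp only; omega)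
      rw [e1, e2, h1, (Nat.even_iff.mpr hi).neg_one_pow, one_smul]
    · have e1 : realFrame e i = mulI n (e ⟨i / 2, hlt⟩) := if_neg (by omega)
      have e2 : realFrame e (partner i) = e ⟨i / 2, hlt⟩ := by
        rw [realFrame, if_pos (by omega)]
        congr 1
        exact Fin.ext (by simp only; omega)
      rw [e1, e2, h2, (Nat.odd_iff.mpr hi).neg_one_pow, neg_smul, one_smul, neg_mul]
  rw [Finset.sum_congr rfl fun i _ => h3 i, ← Finset.mul_sum, sum_div_two]
  simp only [hq]
  ring

namespace LocalConformal

theorem wirtinger_toOmega {U : Set (Model n)} {G : Model n → Model n →L[ℝ] Model n →L[ℝ] ℝ}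
    {f : Model n → ℝ} (L : LocalConformal U G f) {z : Model n} (hz : z ∈ U) (s : ℂ)
    (u v w : Model n) :
    wirtinger s (fun y => toOmega n (Real.exp (-f y) • G y)) z u v w =
      (1 / 2) * Real.exp (-f z) * ((twistedDeriv G f z u (mulI n v) w : ℂ) +
        s * twistedDeriv G f z (mulI n u) (mulI n v) w) := by
  have h0 : HasFDerivAt (fun y => Real.exp (-f y)) (Real.exp (-f z) • -fderiv ℝ f z) z :=
    (L.hasFDerivAt_potential hz).neg.exp
  have h1 : HasFDerivAt (fun y => Real.exp (-f y) • G y) _ z := h0.smul (L.hasFDerivAt hz)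
  have h2 := (toOmega n).hasFDerivAt.comp z h1
  have h3 (x : Model n) : fderiv ℝ (fun y => toOmega n (Real.exp (-f y) • G y)) z x v w =
      Real.exp (-f z) * (twistedDeriv G f z x (mulI n v) w : ℂ) := by
    have e : fderiv ℝ (fun y => toOmega n (Real.exp (-f y) • G y)) z = _ := h2.fderiv
    rw [e]
    simp only [ContinuousLinearMap.comp_apply, toOmega_apply, _root_.add_apply, _root_.smul_apply,
      ContinuousLinearMap.smulRight_apply, _root_.neg_apply, smul_eq_mul, twistedDeriv_apply]
    push_cast
    ring
  rw [wirtinger_apply]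
  change (1 / 2 : ℂ) * (fderiv ℝ (fun y => toOmega n (Real.exp (-f y) • G y)) z u v w +
    s * fderiv ℝ (fun y => toOmega n (Real.exp (-f y) • G y)) z (mulI n u) v w) = _
  rw [h3, h3]
  ring

/-- A closed real form of type (1,1) is both ∂- and ∂̄-closed. Concretely, the cyclic identity is
used at (u, v, w) and at (Ju, Jv, Jw), where J-invariance of the metric removes a J in the last two
slots. -/
theorem wirtinger_toOmega_cyclic {U : Set (Model n)}
    {G : Model n → Model n →L[ℝ] Model n →L[ℝ] ℝ}
    {f : Model n → ℝ} (L : LocalConformal U G f) {z : Model n} (hz : z ∈ U) (s : ℂ)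
    (u v w : Model n) :
    wirtinger s (fun y => toOmega n (Real.exp (-f y) • G y)) z u v w +
    wirtinger s (fun y => toOmega n (Real.exp (-f y) • G y)) z v w u +
    wirtinger s (fun y => toOmega n (Real.exp (-f y) • G y)) z w u v = 0 := by
  simp only [L.wirtinger_toOmega hz]
  have c1 := L.twistedDeriv_cyclic hz u v w
  have c2 := L.twistedDeriv_cyclic hz (mulI n u) (mulI n v) (mulI n w)
  simp only [L.twistedDeriv_mulI hz] at c2
  have c1' : ((_ : ℝ) : ℂ) = ((0 : ℝ) : ℂ) := congrArg Complex.ofReal c1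
  have c2' : ((_ : ℝ) : ℂ) = ((0 : ℝ) : ℂ) := congrArg Complex.ofReal c2
  push_cast at c1' c2'
  linear_combination (1 / 2) * (Real.exp (-f z) : ℂ) * c1' +
    (1 / 2) * (Real.exp (-f z) : ℂ) * s * c2'

/-- For a Gauduchon metric the trace of the complex Hessian of the potential is determined by the
norm of the Lee form. -/
theorem sum_hessian_of_gauduchon {U : Set (Model (m + 1))}
    {G : Model (m + 1) → Model (m + 1) →L[ℝ] Model (m + 1) →L[ℝ] ℝ}
    {f : Model (m + 1) → ℝ} (L : LocalConformal U G f) {z : Model (m + 1)} (hz : z ∈ U)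
    (hm : m ≠ 0) {α : Model (m + 1) → Model (m + 1) [⋀^Fin 2]→L[ℝ] ℂ}
    (hα : ∀ y ∈ U, ∀ u v, α y ![u, v] = (G y (mulI _ u) v : ℂ))
    (hdd : del (delbar fun y => wedgePow (α y) m) z = 0)
    {e : Fin (m + 1) → Model (m + 1)} (he : IsUnitaryFrame (G z) e) {ξ : Model (m + 1)}
    (hξ : ∀ w, G z ξ w = fderiv ℝ f z w) :
    ∑ a, (fderiv ℝ (fderiv ℝ f) z (e a) (e a) +
      fderiv ℝ (fderiv ℝ f) z (mulI _ (e a)) (mulI _ (e a))) = -(m : ℝ) * G z ξ ξ := by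
  have hG := L.herm z hz
  obtain ⟨κ, hκ, hpow⟩ := wedgePow_eq_smul_bilinPow (m + 1) m
  set B : Model (m + 1) → Model (m + 1) →L[ℝ] Model (m + 1) →L[ℝ] ℂ :=
    fun y => toOmega (m + 1) (Real.exp (-f y) • G y) with hB
  set ψ : Model (m + 1) → ℝ := fun y => Real.exp (m * f y) with hψ
  -- The normalizing constant κ is absorbed into a real linear map, so that the Hessian of φ is K of
  -- the Hessian of ψ.
  set K : ℝ →L[ℝ] ℂ := κ • Complex.ofRealCLM with hK
  set φ : Model (m + 1) → ℂ := fun y => K (ψ y) with hφdef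
  have hf2 := L.contDiffAt_potential hz
  have hψ2 : ContDiffAt ℝ 2 ψ z := (contDiffAt_const.mul hf2).exp
  have hφ2 : ContDiffAt ℝ 2 φ z := K.contDiff.contDiffAt.comp z hψ2
  have hB2 : ContDiffAt ℝ 2 B z := by
    have h1 : ContDiffAt ℝ 2 G z :=
      (L.smooth.contDiffAt (L.mem_nhds hz)).of_le ENat.LEInfty.out
    exact (toOmega (m + 1)).contDiff.contDiffAt.comp z ((hf2.neg.exp).smul h1)
  -- The identity ω^m = e^{mf}(e^{-f}ω)^m, up to κ, separates a scalar from a closed form.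
  have heq : (fun y => wedgePow (α y) m) =ᶠ[nhds z] fun y => φ y • bilinPow (B y) m := by
    filter_upwards [L.mem_nhds hz] with y hy
    have hexp : toOmega (m + 1) (G y) = (Real.exp (f y) : ℂ) • B y := by
      ext u v
      change (G y (mulI _ u) v : ℂ) =
        Real.exp (f y) * ((Real.exp (-f y) * G y (mulI _ u) v : ℝ) : ℂ)
      rw [← Complex.ofReal_mul, ← mul_assoc, ← Real.exp_add, add_neg_cancel, Real.exp_zero, one_mul]
    rw [hpow (α y) (toOmega (m + 1) (G y)) (fun u v => (hα y hy u v).symm), hexp, bilinPow_smul,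
      smul_smul]
    congr 1
    simp only [hφdef, hK, hψ, _root_.smul_apply, Complex.ofRealCLM_apply, smul_eq_mul,
      Real.exp_nat_mul, Complex.ofReal_pow]
  have hlocal : ∀ᶠ y in nhds z, delbar (fun y => wedgePow (α y) m) y =
      delbar (fun y => φ y • bilinPow (B y) m) y := by
    filter_upwards [heq.eventuallyEq_nhds] with y hy
    rw [delbar, delbar, hy.fderiv_eq]
  have hdel : del (delbar fun y => φ y • bilinPow (B y) m) z = 0 := by
    rw [← hdd, del, del, Filter.EventuallyEq.fderiv_eq hlocal]
  have hcl {s : ℂ} {y : Model (m + 1)} (hy : y ∈ U) :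
      alternatizeUncurryFin (wirtinger s (fun y => bilinPow (B y) m) y) = 0 := by
    refine (alternatize_wirtinger_bilinPow ?_ (L.wirtinger_toOmega_cyclic hy s) m).2
    exact (toOmega (m + 1)).differentiableAt.comp y
      (((L.hasFDerivAt_potential hy).neg.exp.differentiableAt).smul
        (L.hasFDerivAt hy).differentiableAt)
  rw [del_delbar_smul hφ2 (ContDiffAt.bilinPow hB2 m)
    (Filter.Eventually.mono (L.mem_nhds hz) fun y hy => hcl hy) (hcl hz)] at hdel
  have hb : ((Real.exp (-f z) : ℝ) : ℂ) ≠ 0 := by exact_mod_cast (Real.exp_pos _).ne'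
  obtain ⟨C, hC0, hC⟩ := exists_bilinPow_apply_eq (B z) hb m
  -- Evaluating ∂∂̄φ ∧ B^m = 0 on the frame turns it into the trace of the Hessian of φ times a
  -- nonzero constant.
  have hev := bilinWedge_bilinPow_apply (A := wirtinger (-Complex.I) (wirtinger Complex.I φ) z) hC
    (isSymplecticFamily_realFrame hG he (Real.exp (-f z)))
  rw [hdel, alternating_sum_realFrame hφ2] at hev
  have hI : -(Complex.I / 2) ≠ 0 := by simp
  have hsum : ∑ a, (fderiv ℝ (fderiv ℝ φ) z (e a) (e a) +
      fderiv ℝ (fderiv ℝ φ) z (mulI _ (e a)) (mulI _ (e a))) = 0 := by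
    have : _ * C = (0 : ℂ) := hev.symm
    exact (mul_eq_zero.mp ((mul_eq_zero.mp this).resolve_right hC0)).resolve_left hI
  have hD (u v : Model (m + 1)) : fderiv ℝ (fderiv ℝ φ) z u v =
      κ * ((fderiv ℝ (fderiv ℝ ψ) z u v : ℝ) : ℂ) := fderiv_fderiv_clm_comp K hψ2 u v
  simp only [hD, ← mul_add, ← Finset.mul_sum] at hsum
  have hsum' : ∑ a, (fderiv ℝ (fderiv ℝ ψ) z (e a) (e a) +
      fderiv ℝ (fderiv ℝ ψ) z (mulI _ (e a)) (mulI _ (e a))) = 0 := by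
    have := (mul_eq_zero.mp hsum).resolve_left hκ
    exact_mod_cast this
  have hm' : (m : ℝ) ≠ 0 := Nat.cast_ne_zero.mpr hm
  -- The Hessian of e^{mf} is me^{mf}(m df⊗df + D²f), so the vanishing trace becomes tr D²f =
  -- -m|ξ|².
  have hterm (a : Fin (m + 1)) : fderiv ℝ (fderiv ℝ ψ) z (e a) (e a) +
      fderiv ℝ (fderiv ℝ ψ) z (mulI _ (e a)) (mulI _ (e a)) = (Real.exp (m * f z) * m) *
      (m * (G z ξ (e a) ^ 2 + G z ξ (mulI _ (e a)) ^ 2) +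
      (fderiv ℝ (fderiv ℝ f) z (e a) (e a) +
        fderiv ℝ (fderiv ℝ f) z (mulI _ (e a)) (mulI _ (e a)))) := by
    rw [hψ, fderiv_fderiv_exp_const_mul hf2, fderiv_fderiv_exp_const_mul hf2, hξ, hξ]
    ring
  rw [Finset.sum_congr rfl fun a _ => hterm a, ← Finset.mul_sum, Finset.sum_add_distrib,
    ← Finset.mul_sum, he.sum_sq hG] at hsum'
  have := (mul_eq_zero.mp hsum').resolve_left (mul_ne_zero (Real.exp_pos _).ne' hm')
  linarith

end LocalConformal

end LocalGauduchon

/-! ### The metric and the fundamental form in a chart. -/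

section ChartCalculus

variable {n : ℕ} {M : Type*} [TopologicalSpace M] [ChartedSpace (Model n) M]
  [IsManifold 𝓘(ℂ, Model n) ω M] {φ : OpenPartialHomeomorph M (Model n)}

instance instIsManifoldRealOne : IsManifold 𝓘(ℝ, Model n) 1 M :=
  IsManifold.of_le (n := ∞) (by norm_num)

theorem contMDiffOn_chart_symm (hφ : φ ∈ atlas (Model n) M) :
    ContMDiffOn 𝓘(ℝ, Model n) 𝓘(ℝ, Model n) ∞ φ.symm φ.target :=
  contMDiffOn_symm_of_mem_maximalAtlas (IsManifold.subset_maximalAtlas hφ)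

theorem mdifferentiable_chart (hφ : φ ∈ atlas (Model n) M) :
    φ.MDifferentiable 𝓘(ℝ, Model n) 𝓘(ℝ, Model n) :=
  mdifferentiable_of_mem_atlas hφ

theorem chartInvDeriv_bijective (hφ : φ ∈ atlas (Model n) M) {z : Model n} (hz : z ∈ φ.target) :
    Function.Bijective (chartInvDeriv φ z) :=
  (mdifferentiable_chart hφ).symm.mfderiv_bijective hz

/-- The differential of the inverse of a holomorphic chart is complex linear. -/
theorem chartInvDeriv_mulI (hφ : φ ∈ atlas (Model n) M) {z : Model n} (hz : z ∈ φ.target)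
    (u : Model n) :
    chartInvDeriv φ z (mulI n u) = complexStructure (φ.symm z) (chartInvDeriv φ z u) := by
  have hd : MDifferentiableAt 𝓘(ℝ, Model n) 𝓘(ℝ, Model n) φ.symm z :=
    (mdifferentiable_chart hφ).mdifferentiableAt_symm hz
  set ψ := chartAt (Model n) (φ.symm z)
  have hψ : ψ ∈ atlas (Model n) M := chart_mem_atlas _ _
  have hzs : z ∈ (φ.symm.trans ψ).source := by
    rw [OpenPartialHomeomorph.trans_source]
    exact ⟨hz, mem_chart_source _ _⟩
  have hmem : φ.symm.trans ψ ∈ contDiffGroupoid ω 𝓘(ℂ, Model n) :=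
    HasGroupoid.compatible hφ hψ
  have hC : ContDiffOn ℂ ω (φ.symm.trans ψ) (φ.symm.trans ψ).source := by
    have := (mem_groupoid_of_pregroupoid.mp hmem).1
    have h' : ContDiffOn ℂ ω (𝓘(ℂ, Model n) ∘ (φ.symm.trans ψ) ∘ 𝓘(ℂ, Model n).symm)
      (𝓘(ℂ, Model n).symm ⁻¹' (φ.symm.trans ψ).source ∩ Set.range 𝓘(ℂ, Model n)) := this
    simpa using h'
  have hCd : DifferentiableAt ℂ (φ.symm.trans ψ) z :=
    (hC.contDiffAt ((φ.symm.trans ψ).open_source.mem_nhds hzs)).differentiableAt (by simp)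
  let A : Model n →L[ℝ] Model n := chartInvDeriv φ z
  -- Tangent spaces are read in the preferred chart at the base point, so A is the derivative of a
  -- coordinate change, which is holomorphic.
  have e : A = (fderiv ℂ (φ.symm.trans ψ) z).restrictScalars ℝ := by
    rw [← (hCd.hasFDerivAt.restrictScalars ℝ).fderiv]
    have h1 : A = fderivWithin ℝ (writtenInExtChartAt 𝓘(ℝ, Model n) 𝓘(ℝ, Model n) z φ.symm)
          (Set.range 𝓘(ℝ, Model n)) (extChartAt 𝓘(ℝ, Model n) z z) := by
      exact if_pos hd
    rw [h1, modelWithCornersSelf_coe, Set.range_id, fderivWithin_univ]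
    rfl
  have key (w : Model n) : A w = fderiv ℂ (φ.symm.trans ψ) z w := by
    rw [e]
    rfl
  change A (Complex.I • u) = Complex.I • A u
  rw [key, key, map_smul]

variable (g : HermitianMetric n M)

namespace HermitianMetric

/-- The metric in a chart as a bilinear form. -/
def chartForm (φ : OpenPartialHomeomorph M (Model n)) (z : Model n) :
    Model n →L[ℝ] Model n →L[ℝ] ℝ :=
  let B : Model n →L[ℝ] Model n →L[ℝ] ℝ := g.inner (φ.symm z)
  let A : Model n →L[ℝ] Model n := chartInvDeriv φ z
  B.bilinearComp A A

theorem chartForm_apply (φ : OpenPartialHomeomorph M (Model n)) (z u v : Model n) :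
    g.chartForm φ z u v = g.chartInner φ z u v := rfl

/-- Tested on constant vectors: their pushforwards by the inverse chart are smooth sections along
it, and pairing them with the smooth bundle metric is smooth. -/
theorem contDiffOn_chartForm (hφ : φ ∈ atlas (Model n) M) :
    ContDiffOn ℝ ∞ (g.chartForm φ) φ.target := by
  rw [contDiffOn_clm_apply]
  intro u
  rw [contDiffOn_clm_apply]
  intro v
  have hsec (u : Model n) : ContMDiffOn 𝓘(ℝ, Model n) (𝓘(ℝ, Model n).prod 𝓘(ℝ, Model n)) ∞
      (fun z => Bundle.TotalSpace.mk' (Model n) (E := fun x : M => TangentSpace 𝓘(ℝ, Model n) x)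
        (φ.symm z) (chartInvDeriv φ z u)) φ.target := by
    have h1 := (contMDiffOn_chart_symm hφ).contMDiffOn_tangentMapWithin (m := ∞) (by norm_num)
      φ.open_target.uniqueMDiffOn
    have h2 : ContMDiffOn 𝓘(ℝ, Model n) 𝓘(ℝ, Model n).tangent ∞
        (fun z => (⟨z, u⟩ : TangentBundle 𝓘(ℝ, Model n) (Model n))) φ.target :=
      contMDiffOn_vectorSpace_iff_contDiffOn.mpr contDiffOn_const
    refine (h1.comp h2 (fun z hz => hz)).congr fun z hz => ?_
    simp only [Function.comp_apply, tangentMapWithin, chartInvDeriv]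
    rw [mfderivWithin_eq_mfderiv (φ.open_target.uniqueMDiffOn z hz)
      ((mdifferentiable_chart hφ).mdifferentiableAt_symm hz)]
    rfl
  have h := ContMDiffOn.clm_bundle_apply₂ (F₁ := Model n) (F₂ := Model n) (F₃ := ℝ)
    (E₁ := fun x : M => TangentSpace 𝓘(ℝ, Model n) x)
    (E₂ := fun x : M => TangentSpace 𝓘(ℝ, Model n) x)
    (E₃ := Bundle.Trivial M ℝ) (b := φ.symm) (n := ∞)
    (ψ := fun z => g.inner (φ.symm z))
    (g.contMDiff.comp_contMDiffOn (contMDiffOn_chart_symm hφ)) (hsec u) (hsec v)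
  rw [← contMDiffOn_iff_contDiffOn]
  intro z hz
  have hz' := h z hz
  rw [Bundle.contMDiffWithinAt_totalSpace] at hz'
  exact hz'.2

theorem fundamentalForm_inChart (hφ : φ ∈ atlas (Model n) M) {z : Model n} (hz : z ∈ φ.target)
    (u v : Model n) :
    g.fundamentalForm.inChart φ z ![u, v] = g.chartForm φ z (mulI n u) v := by
  rw [chartForm_apply, chartInner, chartInvDeriv_mulI hφ hz]
  rfl

end HermitianMetric

end ChartCalculus

/-! ### Explicit formulas for exterior derivatives and wedge products in low degree. -/

section LeePotential

variable {n : ℕ}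

theorem extDeriv_one_apply {η : Model n → Model n [⋀^Fin 1]→L[ℝ] ℝ} (z u v : Model n) :
    extDeriv η z ![u, v] = fderiv ℝ η z u ![v] - fderiv ℝ η z v ![u] := by
  rw [extDeriv, ContinuousAlternatingMap.alternatizeUncurryFin_apply, Fin.sum_univ_two]
  have e0 : Fin.removeNth 0 ![u, v] = ![v] := by ext i; fin_cases i; rfl
  have e1 : Fin.removeNth 1 ![u, v] = ![u] := by ext i; fin_cases i; rfl
  rw [e0, e1]
  simp [sub_eq_add_neg]

theorem extDeriv_two_apply {η : Model n → Model n [⋀^Fin 2]→L[ℝ] ℝ} (z u v w : Model n) :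
    extDeriv η z ![u, v, w] =
      fderiv ℝ η z u ![v, w] - fderiv ℝ η z v ![u, w] + fderiv ℝ η z w ![u, v] := by
  rw [extDeriv, ContinuousAlternatingMap.alternatizeUncurryFin_apply, Fin.sum_univ_three]
  have e0 : Fin.removeNth 0 ![u, v, w] = ![v, w] := by ext i; fin_cases i <;> rfl
  have e1 : Fin.removeNth 1 ![u, v, w] = ![u, w] := by ext i; fin_cases i <;> rfl
  have e2 : Fin.removeNth 2 ![u, v, w] = ![u, v] := by ext i; fin_cases i <;> rfl
  rw [e0, e1, e2]
  simp [sub_eq_add_neg]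

theorem alternating_swap (β : Model n [⋀^Fin 2]→L[ℝ] ℝ) (u v : Model n) :
    β ![v, u] = -β ![u, v] := by
  have h := β.toAlternatingMap.map_swap ![u, v] (Fin.zero_ne_one : (0 : Fin 2) ≠ 1)
  have e : ![u, v] ∘ Equiv.swap (0 : Fin 2) 1 = ![v, u] := by
    ext i
    fin_cases i <;> simp
  rw [e] at h
  exact h

theorem wedge_one_two_apply (α : Model n [⋀^Fin 1]→L[ℝ] ℝ) (β : Model n [⋀^Fin 2]→L[ℝ] ℝ)
    (u v w : Model n) : wedge α β ![u, v, w] =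
      α ![u] * β ![v, w] - α ![v] * β ![u, w] + α ![w] * β ![u, v] := by
  rw [wedge_apply]
  change _ • (∑ σ : Equiv.Perm (Fin 3), _) = _
  have huniv : (Finset.univ : Finset (Equiv.Perm (Fin 3))) =
      {1, Equiv.swap 1 2, Equiv.swap 0 1, Equiv.swap 0 1 * Equiv.swap 1 2,
        Equiv.swap 0 2, Equiv.swap 1 2 * Equiv.swap 0 1} := by decide
  have hα (σ : Equiv.Perm (Fin 3)) (x : Model n) (hx : ![u, v, w] (σ 0) = x) :
      α (fun i : Fin 1 => ![u, v, w] (σ (Fin.castAdd 2 i))) = α ![x] := by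
    congr 1
    ext i
    fin_cases i
    rw [← hx]
    rfl
  have hβ (σ : Equiv.Perm (Fin 3)) (x y : Model n) (hx : ![u, v, w] (σ 1) = x)
      (hy : ![u, v, w] (σ 2) = y) :
      β (fun i : Fin 2 => ![u, v, w] (σ (Fin.natAdd 1 i))) = β ![x, y] := by
    congr 1
    ext i
    fin_cases i
    · rw [← hx]
      rfl
    · rw [← hy]
      rfl
  have hterm (σ : Equiv.Perm (Fin 3)) (s : ℤˣ) (x y t : Model n) (hs : Equiv.Perm.sign σ = s)
      (hx : ![u, v, w] (σ 0) = x) (hy : ![u, v, w] (σ 1) = y) (ht : ![u, v, w] (σ 2) = t) :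
      Equiv.Perm.sign σ • (α (fun i : Fin 1 => ![u, v, w] (σ (Fin.castAdd 2 i))) *
        β (fun i : Fin 2 => ![u, v, w] (σ (Fin.natAdd 1 i)))) = s • (α ![x] * β ![y, t]) := by
    rw [hα σ x hx, hβ σ y t hy ht, hs]
  -- The two permutations with the same first entry contribute equally; the resulting 2 cancels the
  -- factor 2! of the wedge normalization.
  have hsum : ∑ σ : Equiv.Perm (Fin 3), Equiv.Perm.sign σ •
      (α (fun i : Fin 1 => ![u, v, w] (σ (Fin.castAdd 2 i))) *
        β (fun i : Fin 2 => ![u, v, w] (σ (Fin.natAdd 1 i)))) =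
      2 * (α ![u] * β ![v, w] - α ![v] * β ![u, w] + α ![w] * β ![u, v]) := by
    rw [huniv, Finset.sum_insert (by decide), Finset.sum_insert (by decide),
      Finset.sum_insert (by decide), Finset.sum_insert (by decide), Finset.sum_insert (by decide),
      Finset.sum_singleton,
      hterm 1 1 u v w (by decide) rfl rfl rfl,
      hterm (Equiv.swap 1 2) (-1) u w v (by decide) rfl rfl rfl,
      hterm (Equiv.swap 0 1) (-1) v u w (by decide) rfl rfl rfl,
      hterm (Equiv.swap 0 1 * Equiv.swap 1 2) 1 v w u (by decide) rfl rfl rfl,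
      hterm (Equiv.swap 0 2) (-1) w v u (by decide) rfl rfl rfl,
      hterm (Equiv.swap 1 2 * Equiv.swap 0 1) 1 w u v (by decide) rfl rfl rfl,
      alternating_swap β v w, alternating_swap β u w, alternating_swap β u v]
    simp only [one_smul, Units.neg_smul]
    ring
  refine (congrArg _ hsum).trans ?_
  simp only [smul_eq_mul, Nat.factorial_one, Nat.factorial_two]
  push_cast
  ring

theorem wedge_zero_left {k l : ℕ} (β : Model n [⋀^Fin l]→L[ℝ] ℝ) :
    wedge (0 : Model n [⋀^Fin k]→L[ℝ] ℝ) β = 0 := by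
  ext v
  rw [wedge_apply]
  have (σ : Equiv.Perm (Fin (k + l))) : Equiv.Perm.sign σ •
      ((0 : Model n [⋀^Fin k]→L[ℝ] ℝ) (fun i => v (σ (Fin.castAdd l i))) *
        β (fun j => v (σ (Fin.natAdd k j)))) = 0 := by
    change _ • ((0 : ℝ) * _) = 0
    rw [zero_mul, smul_zero]
  simp only [this, Finset.sum_const_zero, smul_zero]
  rfl

theorem eq_zero_of_finrank_lt {E : Type*} [NormedAddCommGroup E] [NormedSpace ℝ E]
    [FiniteDimensional ℝ E] {k : ℕ} (hk : Module.finrank ℝ E < k) (α : E [⋀^Fin k]→L[ℝ] ℝ) :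
    α = 0 := by
  ext v
  refine α.toAlternatingMap.map_linearDependent v fun h => ?_
  have := h.fintype_card_le_finrank
  rw [Fintype.card_fin] at this
  omega

theorem fderiv_alternating_apply {k : ℕ} {η : Model n → Model n [⋀^Fin k]→L[ℝ] ℝ} {z : Model n}
    (hη : DifferentiableAt ℝ η z) (v : Fin k → Model n) (u : Model n) :
    fderiv ℝ (fun y => η y v) z u = fderiv ℝ η z u v := by
  have := ((ContinuousAlternatingMap.apply ℝ (Model n) ℝ v).hasFDerivAt.comp z
    hη.hasFDerivAt).fderiv
  exact congrArg (fun l => l u) this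

end LeePotential

/-! ### Local potentials of the Lee form. -/

section LeeForm

variable {n : ℕ} {M : Type*} [TopologicalSpace M] [ChartedSpace (Model n) M]
  {φ : OpenPartialHomeomorph M (Model n)}

/-- In the chart `φ`, the function `f` is a primitive of the `1`-form `θ` on `U`. -/
structure IsPotential (θ : FormField n M ℝ 1) (φ : OpenPartialHomeomorph M (Model n))
    (U : Set (Model n)) (f : Model n → ℝ) : Prop where
  isOpen : IsOpen U
  subset_target : U ⊆ φ.target
  smooth : ContDiffOn ℝ ∞ f U
  fderiv_eq : ∀ z ∈ U, ∀ u, fderiv ℝ f z u = θ.inChart φ z ![u]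

/-- The Poincaré lemma on a ball: for a 1-form, closedness means that the derivative is symmetric.
-/
theorem exists_isPotential {θ : FormField n M ℝ 1} (hs : θ.IsSmooth) (hc : θ.IsClosed)
    (hφ : φ ∈ atlas (Model n) M) {z : Model n} (hz : z ∈ φ.target) :
    ∃ U f, z ∈ U ∧ IsPotential θ φ U f := by
  obtain ⟨r, hr, hball⟩ := Metric.isOpen_iff.mp φ.open_target z hz
  set E : (Model n →L[ℝ] ℝ) ≃ₗᵢ[ℝ] (Model n [⋀^Fin 1]→L[ℝ] ℝ) :=
    ContinuousAlternatingMap.ofSubsingletonLIE (0 : Fin 1)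
  set η : Model n → Model n →L[ℝ] ℝ := fun y => E.symm (θ.inChart φ y) with hη
  have hηapp (y u : Model n) : η y u = θ.inChart φ y ![u] := by
    have h : E (η y) = θ.inChart φ y := E.apply_symm_apply _
    rw [← h]
    rfl
  have hηs : ContDiffOn ℝ ∞ η (Metric.ball z r) :=
    E.symm.contDiff.comp_contDiffOn ((hs φ hφ).mono hball)
  have hd {y : Model n} (hy : y ∈ Metric.ball z r) : DifferentiableAt ℝ η y :=
    (hηs.contDiffAt (Metric.isOpen_ball.mem_nhds hy)).differentiableAt (by simp)
  obtain ⟨f, hf⟩ := (convex_ball z r).exists_forall_hasFDerivAt_of_fderiv_symmetric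
    Metric.isOpen_ball (fun y hy => (hd hy).differentiableWithinAt : DifferentiableOn ℝ η _)
    (by
      intro y hy u v
      have hθd : DifferentiableAt ℝ (θ.inChart φ) y :=
        (((hs φ hφ).mono hball).contDiffAt (Metric.isOpen_ball.mem_nhds hy)).differentiableAt
          (by simp)
      have e (u v : Model n) : fderiv ℝ η y u v = fderiv ℝ (θ.inChart φ) y u ![v] := by
        have h1 := ((hd hy).hasFDerivAt.clm_apply (hasFDerivAt_const v y)).fderiv
        have h2 := congrArg (fun l => l u) h1
        rw [← fderiv_alternating_apply hθd, ← funext fun y => hηapp y v]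
        rw [h1]
        simp
      have h0 := congrArg (fun α => α ![u, v]) (hc φ hφ y (hball hy))
      have h1 : extDeriv (θ.inChart φ) y ![u, v] = 0 := h0
      rw [extDeriv_one_apply] at h1
      rw [e, e]
      linarith)
  refine ⟨Metric.ball z r, f, Metric.mem_ball_self hr, Metric.isOpen_ball, hball, ?_, ?_⟩
  · rw [contDiffOn_infty_iff_fderiv_of_isOpen Metric.isOpen_ball]
    refine ⟨fun y hy => (hf y hy).differentiableAt.differentiableWithinAt, ?_⟩
    exact hηs.congr fun y hy => (hf y hy).fderiv
  · intro y hy u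
    rw [(hf y hy).fderiv, hηapp]

variable [IsManifold 𝓘(ℂ, Model n) ω M] (g : HermitianMetric n M)

namespace HermitianMetric

theorem isHermInner_chartForm (hφ : φ ∈ atlas (Model n) M) {z : Model n} (hz : z ∈ φ.target) :
    IsHermInner (g.chartForm φ z) where
  symm u v := g.symm (φ.symm z) (chartInvDeriv φ z u) (chartInvDeriv φ z v)
  map_mulI u v := by
    rw [chartForm_apply, chartInner, chartInvDeriv_mulI hφ hz, chartInvDeriv_mulI hφ hz]
    exact g.inner_complexStructure (φ.symm z) (chartInvDeriv φ z u) (chartInvDeriv φ z v)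
  pos u hu := g.pos (φ.symm z) (chartInvDeriv φ z u) fun h =>
    hu ((chartInvDeriv_bijective hφ hz).1 (h.trans (_root_.map_zero (chartInvDeriv φ z)).symm))

theorem contDiffOn_fundamentalForm (hφ : φ ∈ atlas (Model n) M) :
    ContDiffOn ℝ ∞ (g.fundamentalForm.inChart φ) φ.target := by
  -- The fundamental form is a fixed linear image of the metric, hence smooth with it. Alternatizing
  -- the already alternating B(J·, ·) doubles it, hence the factor 1/2.
  let K : (Model n →L[ℝ] Model n →L[ℝ] ℝ) →L[ℝ] Model n [⋀^Fin 2]→L[ℝ] ℝ :=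
    (1 / 2 : ℝ) • (ContinuousAlternatingMap.alternatizeUncurryFinCLM ℝ (Model n) ℝ).comp
      ((ContinuousLinearMap.compL ℝ (Model n) (Model n →L[ℝ] ℝ) (Model n [⋀^Fin 1]→L[ℝ] ℝ)
        (ContinuousAlternatingMap.ofSubsingletonLIE (𝕜 := ℝ) (E := Model n) (F := ℝ)
          (0 : Fin 1)).toContinuousLinearEquiv.toContinuousLinearMap).comp
      ((ContinuousLinearMap.compL ℝ (Model n) (Model n) (Model n →L[ℝ] ℝ)).flip (mulI n)))
  have hK (B : Model n →L[ℝ] Model n →L[ℝ] ℝ) (u v : Model n) :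
      K B ![u, v] = 1 / 2 * (B (mulI n u) v - B (mulI n v) u) := by
    change (1 / 2 : ℝ) * (ContinuousAlternatingMap.alternatizeUncurryFin _ ![u, v]) = _
    rw [ContinuousAlternatingMap.alternatizeUncurryFin_apply, Fin.sum_univ_two, sub_eq_add_neg,
      ← neg_one_mul (B (mulI n v) u)]
    simp only [Fin.val_zero, Fin.val_one, pow_zero, pow_one, one_smul, neg_smul, neg_one_mul]
    rfl
  refine (K.contDiff.comp_contDiffOn (g.contDiffOn_chartForm hφ)).congr fun z hz => ?_
  ext v
  have hv : v = ![v 0, v 1] := by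
    ext i
    fin_cases i <;> rfl
  have hG := g.isHermInner_chartForm hφ hz
  rw [hv, fundamentalForm_inChart g hφ hz, Function.comp_apply, hK, hG.mulI_left (v 1),
    hG.symm (v 1)]
  ring

variable {g} {θ : FormField n M ℝ 1} (hθ : g.IsLeeForm θ) (hφ : φ ∈ atlas (Model n) M)
include hθ hφ

theorem IsLeeForm.localConformal {U : Set (Model n)} {f : Model n → ℝ}
    (hf : IsPotential θ φ U f) : LocalConformal U (g.chartForm φ) f where
  isOpen := hf.isOpen
  smooth := (g.contDiffOn_chartForm hφ).mono hf.subset_target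
  herm z hz := g.isHermInner_chartForm hφ (hf.subset_target hz)
  smooth_potential := hf.smooth
  cyclic z hz u v w := by
    have hzt := hf.subset_target hz
    have hn : φ.target ∈ nhds z := φ.open_target.mem_nhds hzt
    have hΩ : DifferentiableAt ℝ (g.fundamentalForm.inChart φ) z :=
      ((g.contDiffOn_fundamentalForm hφ).contDiffAt hn).differentiableAt (by simp)
    have hG : DifferentiableAt ℝ (g.chartForm φ) z :=
      ((g.contDiffOn_chartForm hφ).contDiffAt hn).differentiableAt (by simp)
    have hI := g.isHermInner_chartForm hφ hzt
    have e (u v w : Model n) : fderiv ℝ (g.fundamentalForm.inChart φ) z u ![v, w] =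
        fderiv ℝ (g.chartForm φ) z u (mulI n v) w := by
      have h1 : (fun y => g.fundamentalForm.inChart φ y ![v, w]) =ᶠ[nhds z]
          fun y => g.chartForm φ y (mulI n v) w := by
        filter_upwards [hn] with y hy
        exact g.fundamentalForm_inChart hφ hy v w
      rw [← fderiv_alternating_apply hΩ, h1.fderiv_eq]
      have h2 := ((hG.hasFDerivAt.clm_apply (hasFDerivAt_const (mulI n v) z)).clm_apply
        (hasFDerivAt_const w z)).fderiv
      rw [h2]
      simp
    have h := congrArg (fun α => α ![u, v, w]) (hθ.eq_wedge φ hφ z hzt)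
    have h' : extDeriv (g.fundamentalForm.inChart φ) z ![u, v, w] =
      wedge (θ.inChart φ z) (g.fundamentalForm.inChart φ z) ![u, v, w] := h
    have s1 := alternating_swap (fderiv ℝ (g.fundamentalForm.inChart φ) z v) w u
    have s2 := alternating_swap (g.fundamentalForm.inChart φ z) w u
    rw [extDeriv_two_apply, wedge_one_two_apply, s1, s2] at h'
    simp only [e, g.fundamentalForm_inChart hφ hzt, ← hf.fderiv_eq z hz] at h'
    linarith

end HermitianMetric

end LeeForm

/-! ### Propagation of local maxima. -/

section LocalMaximum

variable {n : ℕ}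

/-- The relation between the complex Hessian of a potential and the norm of the Lee form which
holds for Gauduchon and for Vaisman metrics. -/
def HessianTrace (U : Set (Model n)) (G : Model n → Model n →L[ℝ] Model n →L[ℝ] ℝ)
    (f : Model n → ℝ) : Prop :=
  ∀ z ∈ U, ∀ (e : Fin n → Model n) (ξ : Model n), IsUnitaryFrame (G z) e →
    (∀ w, G z ξ w = fderiv ℝ f z w) →
    ∑ a, (fderiv ℝ (fderiv ℝ f) z (e a) (e a) +
      fderiv ℝ (fderiv ℝ f) z (mulI n (e a)) (mulI n (e a))) = -((n : ℝ) - 1) * G z ξ ξ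

/-- With v = e^{(n-1)f} the quadratic gradient term cancels the trace of D²f, so the trace of D²v is
exactly zero and Hopf's principle applies to v. This uses n ≥ 2, so that v is an increasing function
of f. -/
theorem LocalConformal.eventually_eq_of_isLocalMax {U : Set (Model n)}
    {G : Model n → Model n →L[ℝ] Model n →L[ℝ] ℝ} {f : Model n → ℝ} (L : LocalConformal U G f)
    (hH : HessianTrace U G f) (hn : 2 ≤ n) {z : Model n} (hz : z ∈ U) (hmax : IsLocalMax f z) :
    f =ᶠ[nhds z] fun _ => f z := by
  have hn1 : (0 : ℝ) < n - 1 := by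
    have : (2 : ℝ) ≤ n := by exact_mod_cast hn
    linarith
  set v : Model n → ℝ := fun y => Real.exp ((n - 1 : ℝ) * f y) with hv
  have hLK := L.toLocalLCK
  have htr {y : Model n} (hy : y ∈ U) {e : Fin n → Model n} (he : IsUnitaryFrame (G y) e)
      (B : Model n →L[ℝ] Model n →L[ℝ] ℝ) : traceOp (hermMatrix (G y))⁻¹ B =
        1 / 2 * ∑ a, (B (e a) (e a) + B (mulI n (e a)) (mulI n (e a))) := by
    rw [traceOp_apply, he.trace_re]
  have hmaxv : IsLocalMax v z := by
    filter_upwards [hmax] with y hy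
    exact Real.exp_le_exp.mpr (mul_le_mul_of_nonneg_left hy hn1.le)
  have hconst : v =ᶠ[nhds z] fun _ => v z := by
    refine HermGeom.eventually_eq_of_isLocalMax L.isOpen
      (A := fun y => traceOp (hermMatrix (G y))⁻¹) ?_ ?_ ?_ ?_ ?_ hz hmaxv
    · exact continuousOn_traceOp fun i j =>
        (contDiffOn_inv hLK.smooth (fun y hy => (hLK.isUnit_det y hy).ne_zero) i j).continuousOn
    · intro y hy B hB
      obtain ⟨e, he⟩ := (L.herm y hy).exists_unitaryFrame
      rw [htr hy he]
      exact mul_nonpos_of_nonneg_of_nonpos (by norm_num)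
        (Finset.sum_nonpos fun a _ => add_nonpos (hB _) (hB _))
    · intro y hy a ha
      obtain ⟨e, he⟩ := (L.herm y hy).exists_unitaryFrame
      rw [htr hy he]
      simp only [innerSq_apply]
      refine mul_pos (by norm_num) (lt_of_le_of_ne (Finset.sum_nonneg fun b _ =>
        add_nonneg (mul_self_nonneg _) (mul_self_nonneg _)) fun h0 => ha ?_)
      have h1 := (Finset.sum_eq_zero_iff_of_nonneg fun b _ =>
        add_nonneg (mul_self_nonneg _) (mul_self_nonneg _)).mp h0.symm
      have h2 (b : Fin n) : inner ℝ a (e b) = 0 ∧ inner ℝ a (mulI n (e b)) = 0 := by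
        have h3 := h1 b (Finset.mem_univ b)
        have h4 := mul_self_nonneg (inner ℝ a (e b))
        have h5 := mul_self_nonneg (inner ℝ a (mulI n (e b)))
        exact ⟨mul_self_eq_zero.mp (by linarith), mul_self_eq_zero.mp (by linarith)⟩
      -- The product here is the Euclidean one, not G; but the frame spans, so a vector
      -- Euclidean-orthogonal to all of it is zero.
      have h6 : inner ℝ a a = 0 := by
        conv_lhs => rw [he.eq_sum (L.herm y hy) a]
        rw [real_inner_comm, inner_sum]
        conv_lhs => enter [2, b]; rw [← he.eq_sum (L.herm y hy) a]
        refine Finset.sum_eq_zero fun b _ => ?_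
        rw [inner_add_right, inner_smul_right, inner_smul_right, (h2 b).1, (h2 b).2]
        simp
      exact inner_self_eq_zero.mp h6
    · exact ((contDiffOn_const.mul L.smooth_potential).exp).of_le ENat.LEInfty.out
    · intro y hy
      obtain ⟨e, he⟩ := (L.herm y hy).exists_unitaryFrame
      obtain ⟨ξ, hξ⟩ := he.exists_dual (L.herm y hy) (fderiv ℝ f y)
      have hf2 := L.contDiffAt_potential hy
      have hterm (a : Fin n) : fderiv ℝ (fderiv ℝ v) y (e a) (e a) +
          fderiv ℝ (fderiv ℝ v) y (mulI n (e a)) (mulI n (e a)) = (v y * (n - 1)) *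
          ((n - 1) * (G y ξ (e a) ^ 2 + G y ξ (mulI n (e a)) ^ 2) +
          (fderiv ℝ (fderiv ℝ f) y (e a) (e a) +
            fderiv ℝ (fderiv ℝ f) y (mulI n (e a)) (mulI n (e a)))) := by
        rw [hv, fderiv_fderiv_exp_const_mul hf2, fderiv_fderiv_exp_const_mul hf2, hξ, hξ]
        ring
      rw [htr hy he, Finset.sum_congr rfl fun a _ => hterm a, ← Finset.mul_sum,
        Finset.sum_add_distrib, ← Finset.mul_sum, he.sum_sq (L.herm y hy), hH y hy e ξ he hξ]
      exact le_of_eq (by ring)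
  filter_upwards [hconst] with y hy
  exact mul_left_cancel₀ hn1.ne' (Real.exp_injective hy)

/-- On a compact, locally connected space a function which is constant near each of its local
maxima is locally constant. -/
theorem eventually_const_of_isLocalMax {X : Type*} [TopologicalSpace X] [CompactSpace X]
    [LocallyConnectedSpace X] {w : X → ℝ} (hw : Continuous w)
    (h : ∀ x, IsLocalMax w x → ∀ᶠ y in nhds x, w y = w x) (p : X) :
    ∀ᶠ y in nhds p, w y = w p := by
  set C := connectedComponent p
  have hCo : IsOpen C := isOpen_connectedComponent
  have hCc : IsClosed C := isClosed_connectedComponent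
  obtain ⟨q, hq, hmax⟩ := hCc.isCompact.exists_isMaxOn ⟨p, mem_connectedComponent⟩ hw.continuousOn
  have hlocal {x : X} (hx : x ∈ C) (hxq : w x = w q) : ∀ᶠ y in nhds x, w y = w q := by
    have : IsLocalMax w x := by
      filter_upwards [hCo.mem_nhds hx] with y hy
      rw [hxq]
      exact hmax hy
    filter_upwards [h x this] with y hy
    rw [hy, hxq]
  -- The part of the component of p where w attains its maximum is closed by continuity and open by
  -- hypothesis, hence is the whole component.
  have hclopen : IsClopen (C ∩ {x | w x = w q}) := by
    refine ⟨hCc.inter (isClosed_eq hw continuous_const), isOpen_iff_mem_nhds.mpr ?_⟩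
    rintro x ⟨hx, hxq⟩
    exact Filter.inter_mem (hCo.mem_nhds hx) (hlocal hx hxq)
  have hsub : C ⊆ C ∩ {x | w x = w q} :=
    isPreconnected_connectedComponent.subset_isClopen hclopen ⟨q, hq, hq, rfl⟩
  have hp : w p = w q := (hsub mem_connectedComponent).2
  rw [hp]
  exact hlocal mem_connectedComponent hp

end LocalMaximum

/-! ### The norm of the Lee form and the global argument. -/

section LeeNorm

variable {n : ℕ} {M : Type*} [TopologicalSpace M] [ChartedSpace (Model n) M]
  [IsManifold 𝓘(ℂ, Model n) ω M] {φ : OpenPartialHomeomorph M (Model n)}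

omit [IsManifold 𝓘(ℂ, Model n) ω M] in
theorem inChart_one_apply (θ : FormField n M ℝ 1) (φ : OpenPartialHomeomorph M (Model n))
    (z u : Model n) : θ.inChart φ z ![u] = θ (φ.symm z) ![chartInvDeriv φ z u] := by
  change θ (φ.symm z) (fun i => chartInvDeriv φ z (![u] i)) = _
  congr 1
  ext i
  fin_cases i
  rfl

namespace HermitianMetric

variable (g : HermitianMetric n M) (θ : FormField n M ℝ 1)

theorem exists_dual_inChart (hφ : φ ∈ atlas (Model n) M) {z : Model n} (hz : z ∈ φ.target) :
    ∃ ξ, ∀ w, g.chartForm φ z ξ w = θ.inChart φ z ![w] := by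
  have hG := g.isHermInner_chartForm hφ hz
  obtain ⟨e, he⟩ := hG.exists_unitaryFrame
  set E : (Model n →L[ℝ] ℝ) ≃ₗᵢ[ℝ] (Model n [⋀^Fin 1]→L[ℝ] ℝ) :=
    ContinuousAlternatingMap.ofSubsingletonLIE (0 : Fin 1)
  obtain ⟨ξ, hξ⟩ := he.exists_dual hG (E.symm (θ.inChart φ z))
  refine ⟨ξ, fun w => ?_⟩
  have h : E (E.symm (θ.inChart φ z)) = θ.inChart φ z := E.apply_symm_apply _
  rw [hξ, ← h]
  simp only [LinearIsometryEquiv.symm_apply_apply]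
  rfl

theorem exists_leeVector (p : M) : ∃ ξ : TangentSpace 𝓘(ℝ, Model n) p,
    ∀ w : TangentSpace 𝓘(ℝ, Model n) p, g.inner p ξ w = θ p ![w] := by
  have key {φ : OpenPartialHomeomorph M (Model n)} (hφ : φ ∈ atlas (Model n) M) {z : Model n}
      (hz : z ∈ φ.target) : ∃ ξ : TangentSpace 𝓘(ℝ, Model n) (φ.symm z),
      ∀ w : TangentSpace 𝓘(ℝ, Model n) (φ.symm z), g.inner (φ.symm z) ξ w = θ (φ.symm z) ![w] := by
    obtain ⟨ξ, hξ⟩ := g.exists_dual_inChart θ hφ hz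
    refine ⟨chartInvDeriv φ z ξ, fun w => ?_⟩
    obtain ⟨u, rfl⟩ := (chartInvDeriv_bijective hφ hz).2 w
    rw [← inChart_one_apply, ← hξ]
    rfl
  have h := key (chart_mem_atlas (Model n) p) (mem_chart_target (Model n) p)
  rwa [(chartAt (Model n) p).left_inv (mem_chart_source _ p)] at h

/-- The squared norm of the `1`-form `θ`. -/
def leeNormSq (p : M) : ℝ :=
  g.inner p (g.exists_leeVector θ p).choose (g.exists_leeVector θ p).choose

/-- Dual vectors at a point all have the same norm, so the norm computed in a chart is that of a
function on M. This makes Φ global. -/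
theorem chartForm_dual_self (hφ : φ ∈ atlas (Model n) M) {z : Model n} (hz : z ∈ φ.target)
    {ξ : Model n} (hξ : ∀ w, g.chartForm φ z ξ w = θ.inChart φ z ![w]) :
    g.chartForm φ z ξ ξ = g.leeNormSq θ (φ.symm z) := by
  have hspec := (g.exists_leeVector θ (φ.symm z)).choose_spec
  obtain ⟨η, hη⟩ := (chartInvDeriv_bijective hφ hz).2 (g.exists_leeVector θ (φ.symm z)).choose
  have h1 (w : Model n) : g.chartForm φ z η w = θ.inChart φ z ![w] := by
    rw [inChart_one_apply, ← hspec, ← hη]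
    rfl
  have h2 : g.leeNormSq θ (φ.symm z) = g.chartForm φ z η η := by
    rw [leeNormSq, ← hη]
    rfl
  have hG := g.isHermInner_chartForm hφ hz
  rw [h2, hξ, h1, ← h1, hG.symm, hξ]

theorem leeNormSq_nonneg (p : M) : 0 ≤ g.leeNormSq θ p := by
  by_cases h : (g.exists_leeVector θ p).choose = 0
  · rw [leeNormSq, h, _root_.map_zero]
  · exact (g.pos p _ h).le

theorem inChart_eq_zero (hφ : φ ∈ atlas (Model n) M) {z : Model n} (hz : z ∈ φ.target)
    (h : g.leeNormSq θ (φ.symm z) = 0) : θ.inChart φ z = 0 := by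
  obtain ⟨ξ, hξ⟩ := g.exists_dual_inChart θ hφ hz
  have hG := g.isHermInner_chartForm hφ hz
  have h0 : ξ = 0 := by
    by_contra hne
    have := hG.pos ξ hne
    rw [g.chartForm_dual_self θ hφ hz hξ, h] at this
    exact lt_irrefl _ this
  ext v
  have hv : v = ![v 0] := by
    ext i
    fin_cases i
    rfl
  rw [hv, ← hξ, h0, _root_.map_zero]
  rfl

variable {g θ}

theorem IsLeeForm.hessianTrace_of_isParallel (hθ : g.IsLeeForm θ) (hpar : g.IsParallel θ)
    (hφ : φ ∈ atlas (Model n) M) {U : Set (Model n)} {f : Model n → ℝ}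
    (hf : IsPotential θ φ U f) : HessianTrace U (g.chartForm φ) f := by
  intro z hz e ξ he hξ
  have L := hθ.localConformal hφ hf
  refine L.sum_hessian_of_parallel hz he hξ fun u v Γ hΓ => ?_
  have hC : g.IsChristoffel φ z u v Γ := fun w => by
    have h := hΓ w
    rw [← L.fderiv_apply hz, ← L.fderiv_apply hz, ← L.fderiv_apply hz] at h
    exact h
  have h := hpar φ hφ z (hf.subset_target hz) u v Γ hC
  have h1 : (fun y => θ.inChart φ y ![v]) =ᶠ[nhds z] fun y => fderiv ℝ f y v := by
    filter_upwards [hf.isOpen.mem_nhds hz] with y hy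
    exact (hf.fderiv_eq y hy v).symm
  have hd : DifferentiableAt ℝ (fderiv ℝ f) z :=
    ((L.contDiffAt_potential hz).fderiv_right (m := 1) (by norm_num)).differentiableAt (by simp)
  have h2 : fderiv ℝ (fun y => fderiv ℝ f y v) z u = fderiv ℝ (fderiv ℝ f) z u v := by
    rw [(hd.hasFDerivAt.clm_apply (hasFDerivAt_const v z)).fderiv]
    simp
  rw [h1.fderiv_eq, h2, ← hf.fderiv_eq z hz] at h
  linarith

end HermitianMetric

theorem HermitianMetric.IsLeeForm.hessianTrace_of_isGauduchon {m : ℕ} {M : Type*}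
    [TopologicalSpace M] [ChartedSpace (Model (m + 1)) M] [IsManifold 𝓘(ℂ, Model (m + 1)) ω M]
    {φ : OpenPartialHomeomorph M (Model (m + 1))} {g : HermitianMetric (m + 1) M}
    {θ : FormField (m + 1) M ℝ 1} (hm : m ≠ 0) (hθ : g.IsLeeForm θ) (hg : g.IsGauduchon)
    (hφ : φ ∈ atlas (Model (m + 1)) M) {U : Set (Model (m + 1))} {f : Model (m + 1) → ℝ}
    (hf : IsPotential θ φ U f) : HessianTrace U (g.chartForm φ) f := by
  intro z hz e ξ he hξ
  have L := hθ.localConformal hφ hf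
  rw [L.sum_hessian_of_gauduchon hz hm (α := g.chartOmega φ) (fun y hy u v => ?_)
    (hg φ hφ z (hf.subset_target hz)) he hξ]
  · push_cast
    ring
  · exact congrArg Complex.ofReal (g.fundamentalForm_inChart hφ (hf.subset_target hy) u v)

namespace HermitianMetric

variable {g : HermitianMetric n M} {θ : FormField n M ℝ 1}

variable (g θ) in
/-- Up to a locally constant factor this is `e^{-f}` for every local potential `f` of `θ`. -/
def leeFactor (c : M → ℝ) (p : M) : ℝ :=
  -((n : ℝ) - 1) / 2 * g.leeNormSq θ p + 2 * (n + 1) * c p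

/-- The trace relation turns tr ∂∂̄f in Φ into -(n-1)/2 |θ|², half of the real trace. So the Schur
lemma applies with the restriction of a global function to the chart. -/
theorem fderiv_leeFactor_mul_exp (hn : 2 ≤ n) {c : M → ℝ} (hH : g.HasPointwiseConstantHSC c)
    (hθ : g.IsLeeForm θ) (hφ : φ ∈ atlas (Model n) M) {U : Set (Model n)} {f : Model n → ℝ}
    (hf : IsPotential θ φ U f) (hT : HessianTrace U (g.chartForm φ) f) {z : Model n} (hz : z ∈ U) :
    DifferentiableAt ℝ (fun y => g.leeFactor θ c (φ.symm y) * Real.exp (f y)) z ∧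
      fderiv ℝ (fun y => g.leeFactor θ c (φ.symm y) * Real.exp (f y)) z = 0 := by
  have L := hθ.localConformal hφ hf
  refine L.toLocalLCK.fderiv_schur hz hn (c := fun y => c (φ.symm y)) ?_ ?_
  · intro y hy X
    by_cases hX : X = 0
    · simp [hX, sesqQuad]
    · have hne : ∑ i, ∑ j, g.chartMatrix φ y i j * X i * star (X j) ≠ 0 := by
        have hG := L.herm y hy
        have h1 := sum_hermMatrix (g.chartForm φ y) (WithLp.toLp 2 X) (WithLp.toLp 2 X)
        rw [hG.hermExt_self] at h1
        have h2 : ∑ i, ∑ j, g.chartMatrix φ y i j * X i * star (X j) = _ := h1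
        rw [h2]
        refine Complex.ofReal_ne_zero.mpr (mul_pos one_half_pos (hG.pos _ ?_)).ne'
        intro h0
        exact hX (congrArg WithLp.ofLp h0)
      have h := hH φ hφ y (hf.subset_target hy) X hX
      rw [holSectCurvature, div_eq_iff (pow_ne_zero 2 hne)] at h
      exact h
  · intro y hy
    obtain ⟨e, he⟩ := (L.herm y hy).exists_unitaryFrame
    obtain ⟨ξ, hξ⟩ := he.exists_dual (L.herm y hy) (fderiv ℝ f y)
    have hN := g.chartForm_dual_self θ hφ (hf.subset_target hy) fun w =>
      (hξ w).trans (hf.fderiv_eq y hy w)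
    rw [he.hermLaplacian_eq (L.contDiffAt_potential hy) rfl, hT y hy e ξ he hξ, leeFactor, hN]
    push_cast
    ring

/-- Both summands are nonpositive, and n ≥ 2 makes the coefficient of |θ|² nonzero. This is where
the sign of the curvature enters. -/
theorem leeFactor_nonpos (hn : 2 ≤ n) {c : M → ℝ} (hc : ∀ p, c p ≤ 0) (p : M) :
    g.leeFactor θ c p ≤ 0 ∧ (g.leeFactor θ c p = 0 → g.leeNormSq θ p = 0) := by
  have hn' : (2 : ℝ) ≤ n := by exact_mod_cast hn
  have h1 := mul_nonneg (by linarith : (0 : ℝ) ≤ (n - 1) / 2) (g.leeNormSq_nonneg θ p)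
  have h2 := mul_nonpos_of_nonneg_of_nonpos (by linarith : (0 : ℝ) ≤ 2 * (n + 1)) (hc p)
  have e : g.leeFactor θ c p = -(((n : ℝ) - 1) / 2 * g.leeNormSq θ p) + 2 * (n + 1) * c p := by
    rw [leeFactor]
    ring
  rw [e]
  refine ⟨by linarith, fun h => ?_⟩
  exact (mul_eq_zero.mp (by linarith : ((n : ℝ) - 1) / 2 * g.leeNormSq θ p = 0)).resolve_left
    (by linarith)

/-- Near every point `leeFactor` is a constant multiple of `e^{-f}` for a potential `f`. -/
theorem exists_leeFactor_mul_exp_eq (hn : 2 ≤ n) {c : M → ℝ} (hH : g.HasPointwiseConstantHSC c)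
    (hθ : g.IsLeeForm θ)
    (hT : ∀ φ ∈ atlas (Model n) M, ∀ U f, IsPotential θ φ U f → HessianTrace U (g.chartForm φ) f)
    (hφ : φ ∈ atlas (Model n) M) {z : Model n} (hz : z ∈ φ.target) :
    ∃ U f a, z ∈ U ∧ IsPotential θ φ U f ∧
      ∀ y ∈ U, -(g.leeFactor θ c (φ.symm y))⁻¹ = -a⁻¹ * Real.exp (f y) ∧
        (a = 0 → g.leeFactor θ c (φ.symm y) = 0) ∧
        (g.leeFactor θ c (φ.symm y) ≤ 0 → a ≤ 0) := by
  obtain ⟨V, f, hzV, hf⟩ := exists_isPotential hθ.smooth hθ.closed hφ hz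
  -- A ball is connected, so a function with zero derivative on it is a constant a.
  obtain ⟨r, hr, hball⟩ := Metric.isOpen_iff.mp hf.isOpen z hzV
  have hfb : IsPotential θ φ (Metric.ball z r) f :=
    ⟨Metric.isOpen_ball, hball.trans hf.subset_target, hf.smooth.mono hball,
      fun y hy => hf.fderiv_eq y (hball hy)⟩
  have hd {y : Model n} (hy : y ∈ Metric.ball z r) :=
    fderiv_leeFactor_mul_exp hn hH hθ hφ hf (hT φ hφ V f hf) (hball hy)
  obtain ⟨a, ha⟩ := Metric.isOpen_ball.exists_is_const_of_fderiv_eq_zero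
    (convex_ball z r).isPreconnected (fun y hy => (hd hy).1.differentiableWithinAt)
    (fun y hy => (hd hy).2)
  refine ⟨Metric.ball z r, f, a, Metric.mem_ball_self hr, hfb, fun y hy => ?_⟩
  have h : g.leeFactor θ c (φ.symm y) * Real.exp (f y) = a := ha y hy
  have hpos := Real.exp_pos (f y)
  refine ⟨?_, fun h0 => ?_, fun hle => ?_⟩
  -- With the convention 0⁻¹ = 0 this also holds for a = 0, where both sides vanish.
  · rw [← h, mul_inv, neg_mul, mul_assoc, inv_mul_cancel₀ hpos.ne', mul_one]
  · exact (mul_eq_zero.mp (h.trans h0)).resolve_right hpos.ne'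
  · rw [← h]
    exact mul_nonpos_of_nonpos_of_nonneg hle hpos.le

/-- A Lee form vanishes on a compact manifold of nonpositive pointwise constant holomorphic
sectional curvature, provided the local potentials satisfy `HessianTrace`. -/
theorem IsLeeForm.inChart_eq_zero_of_hessianTrace [CompactSpace M] (hn : 2 ≤ n) {c : M → ℝ}
    (hc : ∀ p, c p ≤ 0) (hH : g.HasPointwiseConstantHSC c) (hθ : g.IsLeeForm θ)
    (hT : ∀ φ ∈ atlas (Model n) M, ∀ U f, IsPotential θ φ U f → HessianTrace U (g.chartForm φ) f)
    (hφ : φ ∈ atlas (Model n) M) {z : Model n} (hz : z ∈ φ.target) : θ.inChart φ z = 0 := by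
  have : LocallyConnectedSpace M := ChartedSpace.locallyConnectedSpace (Model n) M
  -- The local potentials need not glue, but this function does and is a locally constant multiple
  -- of e^f. It is 0 where the denominator vanishes, and it is continuous there because the
  -- denominator then vanishes on a neighbourhood.
  set w : M → ℝ := fun p => -(g.leeFactor θ c p)⁻¹ with hwdef
  have hsymm {φ : OpenPartialHomeomorph M (Model n)} {z : Model n} (hz : z ∈ φ.target) :
      Filter.Tendsto φ.symm (nhds z) (nhds (φ.symm z)) := φ.continuousAt_symm hz
  have hw : Continuous w := by
    refine continuous_iff_continuousAt.mpr fun p => ?_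
    set ψ := chartAt (Model n) p
    obtain ⟨U, f, a, hpU, hf, ha⟩ := exists_leeFactor_mul_exp_eq hn hH hθ hT
      (chart_mem_atlas (Model n) p) (mem_chart_target (Model n) p)
    have hps : p ∈ ψ.symm.target := mem_chart_source _ p
    rw [ψ.symm.continuousAt_iff_continuousAt_comp_right hps]
    have hfc : ContinuousAt (fun y => -a⁻¹ * Real.exp (f y)) (ψ p) :=
      continuousAt_const.mul
        (Real.continuous_exp.continuousAt.comp (hf.smooth.continuousOn.continuousAt
          (hf.isOpen.mem_nhds hpU)))
    refine hfc.congr ?_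
    filter_upwards [hf.isOpen.mem_nhds hpU] with y hy
    exact (ha y hy).1.symm
  have hmax (p : M) (hp : IsLocalMax w p) : ∀ᶠ q in nhds p, w q = w p := by
    set ψ := chartAt (Model n) p
    have hψ : ψ ∈ atlas (Model n) M := chart_mem_atlas (Model n) p
    have hpt : ψ p ∈ ψ.target := mem_chart_target (Model n) p
    have hpp : ψ.symm (ψ p) = p := ψ.left_inv (mem_chart_source _ p)
    obtain ⟨U, f, a, hpU, hf, ha⟩ := exists_leeFactor_mul_exp_eq hn hH hθ hT hψ hpt
    have hwp : w p = -a⁻¹ * Real.exp (f (ψ p)) := by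
      have := (ha (ψ p) hpU).1
      rwa [hpp] at this
    have hchart : ∀ᶠ y in nhds (ψ p), -a⁻¹ * Real.exp (f y) = w p := by
      -- If a = 0, then w is zero nearby. Otherwise a < 0 and w is a positive multiple of e^f, so f
      -- has a local maximum.
      rcases eq_or_ne a 0 with h0 | h0
      · exact Filter.Eventually.of_forall fun y => by rw [hwp, h0]; simp
      · have ha0 : a < 0 :=
          lt_of_le_of_ne ((ha _ hpU).2.2 (leeFactor_nonpos hn hc _).1) h0
        have hb : 0 < -a⁻¹ := neg_pos.mpr (inv_lt_zero.mpr ha0)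
        have hfm : IsLocalMax f (ψ p) := by
          have ht := hsymm hpt
          rw [hpp] at ht
          filter_upwards [ht.eventually hp, hf.isOpen.mem_nhds hpU] with y hy hyU
          have h1 : w (ψ.symm y) = -a⁻¹ * Real.exp (f y) := (ha y hyU).1
          rw [h1, hwp] at hy
          exact Real.exp_le_exp.mp (le_of_mul_le_mul_left hy hb)
        filter_upwards [(hθ.localConformal hψ hf).eventually_eq_of_isLocalMax (hT ψ hψ U f hf) hn
          hpU hfm] with y hy
        rw [hwp, hy]
    have hψc : Filter.Tendsto ψ (nhds p) (nhds (ψ p)) :=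
      ψ.continuousAt (mem_chart_source _ p)
    filter_upwards [hψc.eventually hchart, hψc.eventually (hf.isOpen.mem_nhds hpU),
      ψ.open_source.mem_nhds (mem_chart_source (Model n) p)] with q h1 h2 h3
    have h4 := (ha (ψ q) h2).1
    rw [ψ.left_inv h3, h1] at h4
    exact h4
  obtain ⟨U, f, a, hzU, hf, ha⟩ := exists_leeFactor_mul_exp_eq hn hH hθ hT hφ hz
  -- If a = 0, then Φ and with it |θ|² vanish at the point. Otherwise local constancy of w passes to
  -- f, and θ = df = 0.
  rcases eq_or_ne a 0 with h0 | h0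
  · exact g.inChart_eq_zero θ hφ hz ((leeFactor_nonpos hn hc _).2 ((ha z hzU).2.1 h0))
  · have hconst := eventually_const_of_isLocalMax hw hmax (φ.symm z)
    have hf0 : f =ᶠ[nhds z] fun _ => f z := by
      filter_upwards [(hsymm hz).eventually hconst, hf.isOpen.mem_nhds hzU] with y hy hyU
      have h1 : w (φ.symm y) = -a⁻¹ * Real.exp (f y) := (ha y hyU).1
      have h2 : w (φ.symm z) = -a⁻¹ * Real.exp (f z) := (ha z hzU).1
      rw [h1, h2] at hy
      exact Real.exp_injective (mul_left_cancel₀ (neg_ne_zero.mpr (inv_ne_zero h0)) hy)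
    ext v
    have hv : v = ![v 0] := by
      ext i
      fin_cases i
      rfl
    rw [hv, ← hf.fderiv_eq z hzU, hf0.fderiv_eq, fderiv_const_apply]
    rfl

theorem isKahler_of_hessianTrace [CompactSpace M] (hn : 2 ≤ n) {c : M → ℝ}
    (hc : ∀ p, c p ≤ 0) (hH : g.HasPointwiseConstantHSC c) (hθ : g.IsLeeForm θ)
    (hT : ∀ φ ∈ atlas (Model n) M, ∀ U f, IsPotential θ φ U f →
      HessianTrace U (g.chartForm φ) f) : g.IsKahler := by
  intro φ hφ z hz
  rw [hθ.eq_wedge φ hφ z hz, hθ.inChart_eq_zero_of_hessianTrace hn hc hH hT hφ hz,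
    wedge_zero_left]

/-- The real dimension is at most 2, so the 3-form dω vanishes. -/
theorem isKahler_of_lt_two (hn : n < 2) : g.IsKahler := by
  intro φ hφ z hz
  refine eq_zero_of_finrank_lt ?_ _
  have h : Module.finrank ℝ (Model n) = 2 * n := by
    rw [← Module.finrank_mul_finrank ℝ ℂ (Model n), Complex.finrank_real_complex,
      finrank_euclideanSpace_fin]
  omega

end HermitianMetric

end LeeNorm

end HermGeom

end

theorem corollary1p3 {n : ℕ} {M : Type*} [TopologicalSpace M] [T2Space M] [CompactSpace M]
    [ChartedSpace (HermGeom.Model n) M] [IsManifold 𝓘(ℂ, HermGeom.Model n) ω M]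
    (g : HermGeom.HermitianMetric n M) (c : M → ℝ) (hc : ∀ p, c p ≤ 0)
    (hH : g.HasPointwiseConstantHSC c) :
    (g.IsVaisman → g.IsKahler) ∧ (g.IsLCK → g.IsGauduchon → g.IsKahler) := by
  rcases lt_or_ge n 2 with hn | hn
  · exact ⟨fun _ => HermGeom.HermitianMetric.isKahler_of_lt_two hn,
      fun _ _ => HermGeom.HermitianMetric.isKahler_of_lt_two hn⟩
  · refine ⟨fun ⟨θ, hθ, hpar⟩ => ?_, fun ⟨θ, hθ⟩ hG => ?_⟩
    · exact HermGeom.HermitianMetric.isKahler_of_hessianTrace hn hc hH hθ fun φ hφ U f hf =>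
        hθ.hessianTrace_of_isParallel hpar hφ hf
    -- The power n - 1 in the Gauduchon condition is a truncated subtraction; writing n = m + 1
    -- removes it, and n ≥ 2 gives m ≠ 0.
    · obtain ⟨m, rfl⟩ : ∃ m, n = m + 1 := ⟨n - 1, by omega⟩
      exact HermGeom.HermitianMetric.isKahler_of_hessianTrace hn hc hH hθ fun φ hφ U f hf =>
        hθ.hessianTrace_of_isGauduchon (by omega) hG hφ hf
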